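/- A \emph{pseudoline} is a simple continuous curve in the Euclidean plane that starts and ends at infinity. A set of pseudolines is an \emph{arrangement} if any two of them meet in precisely one point, at a proper crossing. A \emph{pseudo-configuration} is a finite point set $P$ in the plane together with a pseudoline $\ell(p,q)=\ell(q,p)$ for each pair of distinct points $p,q\in P$ such that $\ell(p,q)\cap P=\{p,q\}$ and the pseudolines $\ell(p,q)$ form an arrangement. The \emph{pseudosegment} of $p,q$ is the bounded portion of $\ell(p,q)$ between $p$ and $q$. For $Q\subseteq P$, $\operatorname{conv} Q$ is the complement of the unbounded connected component of the plane minus all pseudosegments between elements of $Q$ (with $\operatorname{conv}\{q\}=\{q\}$), and $Q$ is in \emph{convex position} if no $p\in Q$ lies in $\operatorname{conv}(Q\setminus\{p\})$. \textbf{Theorem.} For every $n\ge 3$ there is a smallest number $b(n)$ such that every pseudo-configuration with at least $b(n)$ points has $n$ points in convex position, and there is a constant $C$ such that \[ b(n)\le 2^{\,n+C\sqrt{n\log n}}\qquad\text{for all } n\ge 3 . \] Moreover $e(n)\le b(n)$ for all $n\ge 3$, where $e(n)$ is the smallest number such that every set of at least $e(n)$ points in the plane, no three of them collinear, has $n$ elements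 in convex position in the usual sense; hence $e(n)\le 2^{n+C\sqrt{n\log n}}$ as well. -/

import Mathlib

/-- The Euclidean plane. -/
abbrev Plane : Type := EuclideanSpace ℝ (Fin 2)

/-- `γ` is a simple continuous curve in the plane that starts and ends at infinity,
and `L` is the set of points that it traces out. -/
def Parametrizes (γ : ℝ → Plane) (L : Set Plane) : Prop :=
  Continuous γ ∧ Function.Injective γ ∧
    Filter.Tendsto γ (Filter.cocompact ℝ) (Filter.cocompact Plane) ∧ Set.range γ = L

/-- A pseudoline: the trace of a simple continuous curve that starts and ends at infinity. -/
def IsPseudoline (L : Set Plane) : Prop :=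
  ∃ γ : ℝ → Plane, Parametrizes γ L

/-- The bounded portion of the pseudoline `L` between its points `p` and `q`, endpoints included
(it does not depend on the parametrization; it is `{p}` if `p = q`). -/
def pseudosegment (L : Set Plane) (p q : Plane) : Set Plane :=
  {x | ∃ γ : ℝ → Plane, Parametrizes γ L ∧
    ∃ a b t : ℝ, γ a = p ∧ γ b = q ∧ t ∈ Set.uIcc a b ∧ γ t = x}

/-- The pseudolines `L` and `M` meet in precisely one point, and there `M` passes from one side
of `L` to another: two points of `M` that are separated on `M` by the common point `x` lie in
different connected components of the complement of `L`. -/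
def CrossesOnce (L M : Set Plane) : Prop :=
  ∃ x : Plane, L ∩ M = {x} ∧
    ∀ y ∈ M, ∀ z ∈ M, y ≠ x → z ≠ x → x ∈ pseudosegment M y z →
      connectedComponentIn Lᶜ y ≠ connectedComponentIn Lᶜ z

/-- An arrangement of pseudolines: any two of them meet in precisely one point, at a proper
crossing (the condition is imposed on both orders of a pair). -/
def IsPseudolineArrangement (A : Set (Set Plane)) : Prop :=
  (∀ L ∈ A, IsPseudoline L) ∧ ∀ L ∈ A, ∀ M ∈ A, L ≠ M → CrossesOnce L M

/-- A pseudo-configuration: a finite set of points in the plane, together with a connecting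
pseudoline `line p q` for each pair of distinct points (the values of `line` at other arguments
play no role). -/
structure PseudoConfiguration where
  /-- the points of the configuration -/
  points : Finset Plane
  /-- the connecting pseudolines -/
  line : Plane → Plane → Set Plane
  line_comm : ∀ p ∈ points, ∀ q ∈ points, p ≠ q → line p q = line q p
  line_inter : ∀ p ∈ points, ∀ q ∈ points, p ≠ q → line p q ∩ (points : Set Plane) = {p, q}
  arrangement : IsPseudolineArrangement
    {L | ∃ p ∈ points, ∃ q ∈ points, p ≠ q ∧ L = line p q}

namespace PseudoConfiguration

/-- The union of the pseudosegments between the elements of `Q`, including the elements of `Q`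
themselves (which matters only if `Q` is a single point). -/
def skeleton (P : PseudoConfiguration) (Q : Set Plane) : Set Plane :=
  Q ∪ {x | ∃ p ∈ Q, ∃ q ∈ Q, p ≠ q ∧ x ∈ pseudosegment (P.line p q) p q}

/-- The convex hull of a set `Q` of points of `P`: the complement of the unbounded connected
component of the complement of the pseudosegments between the elements of `Q`. -/
def hull (P : PseudoConfiguration) (Q : Set Plane) : Set Plane :=
  {x | x ∈ (P.skeleton Q)ᶜ ∧
    ¬ Bornology.IsBounded (connectedComponentIn (P.skeleton Q)ᶜ x)}ᶜ

/-- `Q` is in convex position with respect to `P`: no point of `Q` is in the convex hull of the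
others. -/
def InConvexPosition (P : PseudoConfiguration) (Q : Finset Plane) : Prop :=
  Q ⊆ P.points ∧ ∀ p ∈ Q, p ∉ P.hull ((Q : Set Plane) \ {p})

end PseudoConfiguration

/-- Every pseudo-configuration of size at least `N` has `n` members in convex position. -/
def PseudoESProperty (n N : ℕ) : Prop :=
  ∀ P : PseudoConfiguration, N ≤ P.points.card →
    ∃ Q : Finset Plane, Q.card = n ∧ P.InConvexPosition Q

/-- No three points of the set are collinear. -/
def InGeneralPosition (P : Finset Plane) : Prop :=
  ∀ p ∈ P, ∀ q ∈ P, ∀ r ∈ P, p ≠ q → p ≠ r → q ≠ r → ¬ Collinear ℝ {p, q, r}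

/-- Every set of at least `N` points in general position in the plane has `n` elements in convex
position, in the usual sense of convexity. -/
def ClassicalESProperty (n N : ℕ) : Prop :=
  ∀ P : Finset Plane, InGeneralPosition P → N ≤ P.card →
    ∃ Q : Finset Plane, Q ⊆ P ∧ Q.card = n ∧
      ∀ p ∈ Q, p ∉ convexHull ℝ ((Q : Set Plane) \ {p})

/-! The proof has three layers.

From topology to combinatorics. Two pseudolines cross exactly once, so "on the same side of one
pseudoline" can be read off from betweenness on another one (`CrossesOnce.sameSide_iff`). Pasch-type
statements about triangles follow. Some pseudoline through two points v and f has all other points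
on one side (`exists_isExtremePair`). Hence v lies in no triangle of points, and a pseudoline
rotating about v sorts the remaining points linearly. With this order the orientations of triples
satisfy `IsOrientation`: they are alternating, obey an exchange rule, and for i < j < k < l the
signs of ijk, ijl, ikl, jkl change at most once. A set that is convex for the orientation has a
tangent at each of its points; along the tangent one escapes to infinity without meeting the
pseudosegments of the other points, so the set is in convex position
(`inConvexPosition_of_tangent`).

Counting caps. Let there be A points, no n of them convex, and put L = 2k + 3. The cups-caps theorem
finds a cap or cup of size L among any 4^L points, so by supersaturation (`pow_le_card_mul_pow`)
there are at least about (A / 4^L)^L of them. Conversely, fix a frame of k + 3 points of a cap; the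
other k points lie in k cells above its edges, one in each. In a cell over a and b, order points by
nesting of the triangles that they span with a and b. Antichains without large cups contain caps,
and chains contain subchains whose triples all turn the same way. Thus a cell has at most 2^(K + K')
(2n)^M points, where M, K, K' are the largest sizes of a cap, a clockwise chain and a
counterclockwise chain (`exists_card_cell_le`). Caps in non-adjacent cells unite to a cap, so the M
sum to at most 2n. A clockwise chain and a counterclockwise chain in the next cell unite to a convex
set, so K in one cell plus K' in the next is less than n. The product of the cell sizes is therefore
at most 2^((k + 1) n) (2n)^(2n) (`prod_card_cells_le`), and there are at most A^(k + 3) times as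
many caps. Comparing the two counts gives A^k ≤ 2^(kn + O(n + k²)) (2n)^(2n), and k of order √(n log
n) yields the bound.

Classical point sets. A projective map close to the identity removes parallel connecting lines and
preserves convex hulls. The straight lines then form a pseudo-configuration whose hulls contain the
ordinary ones, so e(n) ≤ b(n). -/

open Set Filter Topology

/-! ### Betweenness on a pseudoline -/

theorem Parametrizes.mem {γ : ℝ → Plane} {L : Set Plane} (h : Parametrizes γ L) (t : ℝ) :
    γ t ∈ L := h.2.2.2 ▸ mem_range_self t

theorem Parametrizes.exists_eq {γ : ℝ → Plane} {L : Set Plane} (h : Parametrizes γ L) {x : Plane}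
    (hx : x ∈ L) : ∃ t, γ t = x := by
  rw [← h.2.2.2] at hx
  exact hx

theorem Parametrizes.isClosedEmbedding {γ : ℝ → Plane} {L : Set Plane} (h : Parametrizes γ L) :
    IsClosedEmbedding γ :=
  .of_continuous_injective_isClosedMap h.1 h.2.1
    (isProperMap_iff_tendsto_cocompact.2 ⟨h.1, h.2.2.1⟩).isClosedMap

/-- Both maps are closed embeddings with the same image, so the change of parameter is a continuous
injection of the real line and hence strictly monotone. This makes pseudosegments independent of the
parametrization. -/
theorem Parametrizes.exists_transition {γ δ : ℝ → Plane} {L : Set Plane} (h : Parametrizes γ L)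
    (h' : Parametrizes δ L) : ∃ φ : ℝ → ℝ, (∀ t, δ (φ t) = γ t) ∧ (StrictMono φ ∨ StrictAnti φ) := by
  choose φ hφ using fun t => h'.exists_eq (h.mem t)
  have hc : Continuous φ := by
    rw [h'.isClosedEmbedding.isInducing.continuous_iff]
    exact h.1.congr fun t => (hφ t).symm
  refine ⟨φ, hφ, hc.strictMono_of_inj fun s t hst => h.2.1 ?_⟩
  rw [← hφ s, ← hφ t, hst]

theorem pseudosegment_eq_image {γ : ℝ → Plane} {L : Set Plane} (h : Parametrizes γ L) (a b : ℝ) :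
    pseudosegment L (γ a) (γ b) = γ '' uIcc a b := by
  ext x
  constructor
  · rintro ⟨δ, hδ, a', b', t, ha, hb, ht, rfl⟩
    obtain ⟨φ, hφ, hm⟩ := hδ.exists_transition h
    have ea : φ a' = a := h.2.1 (by rw [hφ, ha])
    have eb : φ b' = b := h.2.1 (by rw [hφ, hb])
    refine ⟨φ t, ?_, hφ t⟩
    rw [← ea, ← eb]
    rcases hm with hm | hm
    · exact hm.monotone.image_uIcc_subset (mem_image_of_mem _ ht)
    · exact hm.antitone.image_uIcc_subset (mem_image_of_mem _ ht)
  · rintro ⟨t, ht, rfl⟩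
    exact ⟨γ, h, a, b, t, rfl, rfl, ht, rfl⟩

theorem pseudosegment_comm (L : Set Plane) (p q : Plane) :
    pseudosegment L p q = pseudosegment L q p := by
  ext x
  constructor <;> rintro ⟨γ, h, a, b, t, ha, hb, ht, hx⟩ <;>
    exact ⟨γ, h, b, a, t, hb, ha, uIcc_comm a b ▸ ht, hx⟩

theorem pseudosegment_subset {L : Set Plane} {p q : Plane} : pseudosegment L p q ⊆ L := by
  rintro x ⟨γ, h, a, b, t, ha, hb, ht, rfl⟩
  exact h.mem t

section Betweenness

variable {L : Set Plane} {x y z w : Plane}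

theorem IsPseudoline.left_mem (hL : IsPseudoline L) (hx : x ∈ L) (hy : y ∈ L) :
    x ∈ pseudosegment L x y := by
  obtain ⟨γ, h⟩ := hL
  obtain ⟨a, rfl⟩ := h.exists_eq hx
  obtain ⟨b, rfl⟩ := h.exists_eq hy
  exact ⟨γ, h, a, b, a, rfl, rfl, left_mem_uIcc, rfl⟩

theorem IsPseudoline.right_mem (hL : IsPseudoline L) (hx : x ∈ L) (hy : y ∈ L) :
    y ∈ pseudosegment L x y := by
  rw [pseudosegment_comm]
  exact hL.left_mem hy hx

theorem IsPseudoline.isPreconnected_pseudosegment (hL : IsPseudoline L) (hx : x ∈ L) (hy : y ∈ L) :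
    IsPreconnected (pseudosegment L x y) := by
  obtain ⟨γ, h⟩ := hL
  obtain ⟨a, rfl⟩ := h.exists_eq hx
  obtain ⟨b, rfl⟩ := h.exists_eq hy
  rw [pseudosegment_eq_image h]
  exact isPreconnected_uIcc.image _ h.1.continuousOn

/-- Carries betweenness on a pseudoline over to intervals of reals, where the order facts below are
elementary. -/
theorem IsPseudoline.mem_iff_transfer (hL : IsPseudoline L) : ∃ f : Plane → ℝ, InjOn f L ∧
    ∀ x ∈ L, ∀ y ∈ L, ∀ z, z ∈ pseudosegment L x y ↔ z ∈ L ∧ f z ∈ uIcc (f x) (f y) := by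
  obtain ⟨γ, h⟩ := hL
  have hinv : ∀ t, Function.invFun γ (γ t) = t := Function.leftInverse_invFun h.2.1
  refine ⟨Function.invFun γ, ?_, ?_⟩
  · intro x hx y hy hxy
    obtain ⟨a, rfl⟩ := h.exists_eq hx
    obtain ⟨b, rfl⟩ := h.exists_eq hy
    rw [hinv, hinv] at hxy
    rw [hxy]
  · intro x hx y hy z
    obtain ⟨a, rfl⟩ := h.exists_eq hx
    obtain ⟨b, rfl⟩ := h.exists_eq hy
    rw [pseudosegment_eq_image h, hinv, hinv]
    constructor
    · rintro ⟨t, ht, rfl⟩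
      exact ⟨h.mem t, by rwa [hinv]⟩
    · rintro ⟨hz, hz'⟩
      obtain ⟨c, rfl⟩ := h.exists_eq hz
      exact ⟨c, by rwa [hinv] at hz', rfl⟩

theorem IsPseudoline.trichotomy (hL : IsPseudoline L) (hx : x ∈ L) (hy : y ∈ L) (hz : z ∈ L) :
    x ∈ pseudosegment L y z ∨ y ∈ pseudosegment L x z ∨ z ∈ pseudosegment L x y := by
  obtain ⟨f, -, hf⟩ := hL.mem_iff_transfer
  simp only [hf x hx y hy, hf y hy z hz, hf x hx z hz, mem_uIcc, hx, hy, hz, true_and]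
  grind

theorem IsPseudoline.antisymm (hL : IsPseudoline L) (hx : x ∈ L) (hy : y ∈ L) (hz : z ∈ L)
    (h : x ∈ pseudosegment L y z) (h' : y ∈ pseudosegment L x z) : x = y := by
  obtain ⟨f, hi, hf⟩ := hL.mem_iff_transfer
  simp only [hf y hy z hz, hf x hx z hz, mem_uIcc] at h h'
  apply hi hx hy
  grind

theorem IsPseudoline.not_mem_sub (hL : IsPseudoline L) (hx : x ∈ L) (hy : y ∈ L)
    (h : z ∈ pseudosegment L x y) (hne : z ≠ x) : x ∉ pseudosegment L z y := by
  intro h'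
  exact hne (hL.antisymm (pseudosegment_subset h) hx hy h h')

theorem IsPseudoline.not_mem_mono (hL : IsPseudoline L) (hx : x ∈ L) (hy : y ∈ L)
    (h : z ∈ pseudosegment L x y) (hw : w ∉ pseudosegment L x y) : w ∉ pseudosegment L z y := by
  obtain ⟨f, hi, hf⟩ := hL.mem_iff_transfer
  have hz := pseudosegment_subset h
  simp only [hf z hz y hy, hf x hx y hy, mem_uIcc] at h hw ⊢
  refine fun h' => hw ⟨h'.1, ?_⟩
  have h1 := h.2
  have h2 := h'.2
  clear hf h h' hw
  grind

end Betweenness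

/-! ### Sides of a pseudoline -/

/-- The points `y` and `z` lie in the same component of the complement of `L`. -/
def SameSide (L : Set Plane) (y z : Plane) : Prop :=
  y ∉ L ∧ z ∉ L ∧ connectedComponentIn Lᶜ y = connectedComponentIn Lᶜ z

section SameSide

variable {L M : Set Plane} {x y z : Plane}

theorem SameSide.refl (h : y ∉ L) : SameSide L y y := ⟨h, h, rfl⟩

theorem SameSide.symm (h : SameSide L y z) : SameSide L z y := ⟨h.2.1, h.1, h.2.2.symm⟩

theorem SameSide.trans (h : SameSide L x y) (h' : SameSide L y z) : SameSide L x z :=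
  ⟨h.1, h'.2.1, h.2.2.trans h'.2.2⟩

theorem sameSide_comm : SameSide L y z ↔ SameSide L z y := ⟨SameSide.symm, SameSide.symm⟩

theorem SameSide.left_congr (h : SameSide L x y) : SameSide L x z ↔ SameSide L y z :=
  ⟨h.symm.trans, h.trans⟩

theorem SameSide.right_congr (h : SameSide L x y) : SameSide L z x ↔ SameSide L z y :=
  ⟨fun h' => h'.trans h, fun h' => h'.trans h.symm⟩

theorem IsPseudoline.sameSide (hM : IsPseudoline M) (hy : y ∈ M) (hz : z ∈ M)
    (h : ∀ x ∈ pseudosegment M y z, x ∉ L) : SameSide L y z := by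
  refine ⟨h _ (hM.left_mem hy hz), h _ (hM.right_mem hy hz), ?_⟩
  apply connectedComponentIn_eq
  exact (hM.isPreconnected_pseudosegment hy hz).subset_connectedComponentIn
    (hM.left_mem hy hz) h (hM.right_mem hy hz)

/-- Proper crossing gives one direction; conversely, an arc of `M` that avoids the only common point
is a connected subset of the complement of `L`. This turns questions about sides into questions
about betweenness. -/
theorem CrossesOnce.sameSide_iff (hLM : CrossesOnce L M) (hM : IsPseudoline M) (hxL : x ∈ L)
    (hxM : x ∈ M) (hy : y ∈ M) (hz : z ∈ M) (hyx : y ≠ x) (hzx : z ≠ x) :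
    SameSide L y z ↔ x ∉ pseudosegment M y z := by
  obtain ⟨x', hx', h⟩ := hLM
  have hu : ∀ w, w ∈ L → w ∈ M → w = x' := fun w h1 h2 => by
    have : w ∈ L ∩ M := ⟨h1, h2⟩
    rwa [hx'] at this
  obtain rfl : x = x' := hu x hxL hxM
  constructor
  · intro hs hx
    exact h y hy z hz hyx hzx hx hs.2.2
  · intro hx
    refine hM.sameSide hy hz fun w hw hwL => hx ?_
    rwa [← hu w hwL (pseudosegment_subset hw)]

end SameSide

/-! ### Crossings and sides in a pseudo-configuration -/

namespace PseudoConfiguration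

variable (P : PseudoConfiguration)

/-- The pseudoline through two points of the configuration. -/
def ln (a b : {p // p ∈ P.points}) : Set Plane := P.line a b

/-- The bounded portion of a connecting pseudoline. -/
def sg (a b : {p // p ∈ P.points}) : Plane → Plane → Set Plane := pseudosegment (P.ln a b)

variable {P} {a b c d x y z v f : {p // p ∈ P.points}} {s t u w : Plane}

theorem ln_comm (a b : {p // p ∈ P.points}) : P.ln a b = P.ln b a := by
  rcases eq_or_ne a b with rfl | h
  · rfl
  · exact P.line_comm a a.2 b b.2 (Subtype.coe_injective.ne h)

theorem mem_ln (h : a ≠ b) : (c : Plane) ∈ P.ln a b ↔ c = a ∨ c = b := by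
  have := P.line_inter a a.2 b b.2 (Subtype.coe_injective.ne h)
  have h2 : (c : Plane) ∈ P.line a b ∩ P.points ↔ (c : Plane) ∈ ({(a : Plane), (b : Plane)} : Set Plane) := by
    rw [this]
  simpa [Subtype.coe_inj, ln] using h2

theorem left_mem_ln (h : a ≠ b) : (a : Plane) ∈ P.ln a b := (mem_ln h).2 (.inl rfl)

theorem right_mem_ln (h : a ≠ b) : (b : Plane) ∈ P.ln a b := (mem_ln h).2 (.inr rfl)

theorem not_mem_ln (h : a ≠ b) (ha : c ≠ a) (hb : c ≠ b) : (c : Plane) ∉ P.ln a b := by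
  rw [mem_ln h]
  tauto

theorem isPseudoline_ln (h : a ≠ b) : IsPseudoline (P.ln a b) :=
  P.arrangement.1 _ ⟨a, a.2, b, b.2, Subtype.coe_injective.ne h, rfl⟩

theorem crossesOnce_ln (h : a ≠ b) (h' : c ≠ d) (hne : P.ln a b ≠ P.ln c d) :
    CrossesOnce (P.ln a b) (P.ln c d) :=
  P.arrangement.2 _ ⟨a, a.2, b, b.2, Subtype.coe_injective.ne h, rfl⟩ _
    ⟨c, c.2, d, d.2, Subtype.coe_injective.ne h', rfl⟩ hne

theorem ln_ne (h : a ≠ b) (h' : c ≠ d) (ha : a ≠ c) (hb : a ≠ d) : P.ln a b ≠ P.ln c d := by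
  intro e
  have := left_mem_ln h
  rw [e, mem_ln h'] at this
  tauto

theorem ln_ne_of_left (h : a ≠ b) (h' : a ≠ c) (hb : b ≠ c) : P.ln a b ≠ P.ln a c := by
  rw [ln_comm a b]
  exact ln_ne h.symm h' h.symm hb

/-- Two points of a pseudoline through `a` are on the same side of another pseudoline through `a`
if and only if `a` is not between them. -/
theorem sameSide_ln_iff (hab : a ≠ b) (hac : a ≠ c) (hbc : b ≠ c) (hs : s ∈ P.ln a b)
    (ht : t ∈ P.ln a b) (hsa : s ≠ a) (hta : t ≠ a) :
    SameSide (P.ln a c) s t ↔ (a : Plane) ∉ P.sg a b s t :=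
  (crossesOnce_ln hac hab (ln_ne_of_left hac hab hbc.symm)).sameSide_iff (isPseudoline_ln hab)
    (left_mem_ln hac) (left_mem_ln hab) hs ht hsa hta

theorem SameSide.not_mem (h : a ≠ b) (h' : c ≠ d) (hne : P.ln a b ≠ P.ln c d)
    (hss : SameSide (P.ln a b) s t) (hs : s ∈ P.ln c d) (ht : t ∈ P.ln c d)
    (hu : u ∈ P.sg c d s t) : u ∉ P.ln a b := fun huL =>
  ((crossesOnce_ln h h' hne).sameSide_iff (isPseudoline_ln h') huL (pseudosegment_subset hu)
    hs ht (fun e => hss.1 (e ▸ huL)) (fun e => hss.2.1 (e ▸ huL))).1 hss hu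

theorem SameSide.of_mem (h : a ≠ b) (h' : c ≠ d) (hne : P.ln a b ≠ P.ln c d)
    (hss : SameSide (P.ln a b) s t) (hs : s ∈ P.ln c d) (ht : t ∈ P.ln c d)
    (hu : u ∈ P.sg c d s t) : SameSide (P.ln a b) u t := by
  refine (isPseudoline_ln h').sameSide (pseudosegment_subset hu) ht fun w hw => ?_
  refine SameSide.not_mem h h' hne hss hs ht ?_
  by_contra hw'
  exact (isPseudoline_ln h').not_mem_mono hs ht hu hw' hw

/-- A pseudoline that separates two points meets the connecting pseudosegment. -/
theorem exists_crossing (hyz : y ≠ z) (h : ¬ SameSide (P.ln a b) y z) :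
    ∃ s, s ∈ P.sg y z y z ∧ s ∈ P.ln a b := by
  by_contra! hc
  exact h ((isPseudoline_ln hyz).sameSide (left_mem_ln hyz) (right_mem_ln hyz) hc)

/-- The pseudolines `ab` and `bc` meet only at `b`, and `b` is not on the part of the pseudosegment
from `s` to `c`. -/
theorem sameSide_of_mem_sg (hac : a ≠ c) (hab : a ≠ b) (hbc : b ≠ c) (hs : s ∈ P.sg b c b c)
    (hsb : s ≠ b) : SameSide (P.ln a b) s c := by
  rw [ln_comm]
  have h := isPseudoline_ln hbc
  refine (sameSide_ln_iff hbc hab.symm hac.symm (pseudosegment_subset hs) (right_mem_ln hbc) hsb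
    (Subtype.coe_injective.ne hbc.symm)).2 ?_
  exact h.not_mem_sub (left_mem_ln hbc) (right_mem_ln hbc) hs hsb

theorem sg_comm (a b : {p // p ∈ P.points}) (s t : Plane) : P.sg a b s t = P.sg b a t s := by
  rw [sg, sg, ln_comm, pseudosegment_comm]

theorem ne_of_mem_of_not_mem' (hs : s ∈ P.ln a b) (hc : (c : Plane) ∉ P.ln a b) : s ≠ c :=
  fun e => hc (e ▸ hs)

/-- The relation between the sides of the pseudolines through `c` and four other points. -/
theorem sameSide_exchange (hcx : c ≠ x) (hcy : c ≠ y) (hcz : c ≠ z) (hcv : c ≠ v) (hxy : x ≠ y)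
    (hxv : x ≠ v) (hyz : y ≠ z)
    (h : ¬ SameSide (P.ln c x) y z) (h' : SameSide (P.ln c v) y z) :
    SameSide (P.ln c y) x z ↔ SameSide (P.ln c v) x y := by
  -- With respect to `cy` the crossing `s` can replace `z`, and with respect to `cv` it can replace
  -- `y`. Both sides of the equivalence then say that `c` is not between `x` and `s` on `cx`.
  obtain ⟨s, hs, hsx⟩ := exists_crossing hyz h
  have hsy : s ≠ y := ne_of_mem_of_not_mem' hsx (not_mem_ln hcx hcy.symm hxy.symm)
  have hsc : s ≠ c := ne_of_mem_of_not_mem' (pseudosegment_subset hs) (not_mem_ln hyz hcy hcz)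
  have hx : (x : Plane) ≠ c := Subtype.coe_injective.ne hcx.symm
  have h1 : SameSide (P.ln c y) s z := sameSide_of_mem_sg hcz hcy hyz hs hsy
  have h2 : SameSide (P.ln c v) s y := by
    refine SameSide.of_mem hcv hyz.symm (ln_ne hcv hyz.symm hcz hcy) h'.symm (left_mem_ln hyz.symm)
      (right_mem_ln hyz.symm) ?_
    rwa [sg_comm] at hs
  rw [← h1.right_congr, ← h2.right_congr,
    sameSide_ln_iff hcx hcy hxy (right_mem_ln hcx) hsx hx hsc,
    sameSide_ln_iff hcx hcv hxv (right_mem_ln hcx) hsx hx hsc]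

end PseudoConfiguration

/-! ### Triangles and separation -/

namespace PseudoConfiguration

variable {P : PseudoConfiguration} {a b c d x y z v f r : {p // p ∈ P.points}} {s t u w : Plane}

/-- `s₁` and `s₃` are on the side of `yz` that contains `x`, so the arc of `ab` between them cannot
meet `yz`. Since one of three points of `ab` is always between the others, no pseudoline crosses all
three sides of a triangle in their interiors. -/
theorem not_between_crossings (hab : a ≠ b) (hxy : x ≠ y) (hxz : x ≠ z) (hyz : y ≠ z) (hay : a ≠ y)
    (haz : a ≠ z) (hby : b ≠ y) (hbz : b ≠ z)
    {s₁ s₂ s₃ : Plane} (h₁ : s₁ ∈ P.sg x y x y) (h₂ : s₂ ∈ P.sg y z y z) (h₃ : s₃ ∈ P.sg x z x z)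
    (l₁ : s₁ ∈ P.ln a b) (l₃ : s₃ ∈ P.ln a b) : s₂ ∉ P.sg a b s₁ s₃ := by
  intro hs
  have k₁ : SameSide (P.ln y z) s₁ x := by
    rw [ln_comm]
    rw [sg_comm] at h₁
    exact sameSide_of_mem_sg hxz.symm hyz.symm hxy.symm h₁
      (ne_of_mem_of_not_mem' l₁ (not_mem_ln hab hay.symm hby.symm))
  have k₃ : SameSide (P.ln y z) s₃ x := by
    rw [sg_comm] at h₃
    exact sameSide_of_mem_sg hxy.symm hyz hxz.symm h₃
      (ne_of_mem_of_not_mem' l₃ (not_mem_ln hab haz.symm hbz.symm))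
  exact SameSide.not_mem hyz hab (ln_ne hab hyz hay haz).symm (k₁.trans k₃.symm) l₁ l₃ hs
    (pseudosegment_subset h₂)

/-- A connecting pseudoline has only two sides. -/
theorem two_sides (hab : a ≠ b) (hax : a ≠ x) (hbx : b ≠ x) (hay : a ≠ y)
    (haz : a ≠ z) (hby : b ≠ y) (hbz : b ≠ z) (h : ¬ SameSide (P.ln a b) x y)
    (h' : ¬ SameSide (P.ln a b) y z) : SameSide (P.ln a b) x z := by
  by_contra h''
  have hxy : x ≠ y := fun e => h (e ▸ SameSide.refl (not_mem_ln hab hax.symm hbx.symm))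
  have hyz : y ≠ z := fun e => h' (e ▸ SameSide.refl (not_mem_ln hab hay.symm hby.symm))
  have hxz : x ≠ z := fun e => h'' (e ▸ SameSide.refl (not_mem_ln hab hax.symm hbx.symm))
  obtain ⟨s₁, h₁, l₁⟩ := exists_crossing hxy h
  obtain ⟨s₂, h₂, l₂⟩ := exists_crossing hyz h'
  obtain ⟨s₃, h₃, l₃⟩ := exists_crossing hxz h''
  rcases (isPseudoline_ln hab).trichotomy l₁ l₂ l₃ with k | k | k
  · exact not_between_crossings hab hxz.symm hyz.symm hxy hax hay hbx hby (sg_comm x z x z ▸ h₃) h₁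
      (sg_comm y z y z ▸ h₂) l₃ l₂ (by rw [sg, pseudosegment_comm]; exact k)
  · exact not_between_crossings hab hxy hxz hyz hay haz hby hbz h₁ h₂ h₃ l₁ l₃ k
  · exact not_between_crossings hab hxy.symm hyz hxz hax haz hbx hbz (sg_comm x y x y ▸ h₁) h₃
      h₂ l₁ l₂ k

/-- The two separations are the working definition of "`v` is inside the triangle `abc`"; the
crossing `s` exhibits `v` on a pseudosegment from a vertex to the opposite side. -/
theorem exists_of_separated (hva : v ≠ a) (hvb : v ≠ b) (hvc : v ≠ c) (hab : a ≠ b)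
    (hbc : b ≠ c) (h₁ : ¬ SameSide (P.ln v a) b c)
    (h₂ : ¬ SameSide (P.ln v b) a c) :
    ∃ s, s ∈ P.sg b c b c ∧ s ∈ P.ln v a ∧ (v : Plane) ∈ P.sg v a a s := by
  obtain ⟨s, hs, hsa⟩ := exists_crossing hbc h₁
  refine ⟨s, hs, hsa, ?_⟩
  have h3 : SameSide (P.ln v b) s c := sameSide_of_mem_sg hvc hvb hbc hs
    (ne_of_mem_of_not_mem' hsa (not_mem_ln hva hvb.symm hab.symm))
  rw [← h3.right_congr, sameSide_ln_iff hva hvb hab (right_mem_ln hva) hsa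
    (Subtype.coe_injective.ne hva.symm) (ne_of_mem_of_not_mem' (pseudosegment_subset hs)
    (not_mem_ln hbc hvb hvc)), not_not] at h₂
  exact h₂

theorem separated_third (hva : v ≠ a) (hvb : v ≠ b) (hvc : v ≠ c) (hab : a ≠ b) (hac : a ≠ c)
    (hbc : b ≠ c) (h₁ : ¬ SameSide (P.ln v a) b c)
    (h₂ : ¬ SameSide (P.ln v b) a c) : ¬ SameSide (P.ln v c) a b := by
  obtain ⟨s, hs, hsa, hv⟩ := exists_of_separated hva hvb hvc hab hbc h₁ h₂
  rw [sg_comm] at hs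
  have h3 : SameSide (P.ln v c) s b := sameSide_of_mem_sg hvb hvc hbc.symm hs
    (ne_of_mem_of_not_mem' hsa (not_mem_ln hva hvc.symm hac.symm))
  rw [← h3.right_congr, sameSide_ln_iff hva hvc hac (right_mem_ln hva) hsa
    (Subtype.coe_injective.ne hva.symm) (ne_of_mem_of_not_mem' (pseudosegment_subset hs)
    (not_mem_ln hbc.symm hvc hvb)), not_not]
  exact hv

theorem not_all_sameSide_of_mem (hva : v ≠ a) (hvb : v ≠ b) (hvc : v ≠ c) (hab : a ≠ b)
    (hac : a ≠ c) (hbc : b ≠ c) (hs : s ∈ P.ln b c) (hsa : s ∈ P.ln v a)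
    (hcs : (c : Plane) ∈ P.sg b c b s) (h₃ : SameSide (P.ln v c) a b) :
    ¬ SameSide (P.ln v b) a c := by
  have hsb : s ≠ b := ne_of_mem_of_not_mem' hsa (not_mem_ln hva hvb.symm hab.symm)
  have hsc : s ≠ c := ne_of_mem_of_not_mem' hsa (not_mem_ln hva hvc.symm hac.symm)
  have hsv : s ≠ v := ne_of_mem_of_not_mem' hs (not_mem_ln hbc hvb hvc)
  have hav : (a : Plane) ≠ v := Subtype.coe_injective.ne hva.symm
  have hbc' : (b : Plane) ≠ c := Subtype.coe_injective.ne hbc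
  have hL := isPseudoline_ln (P := P) hbc
  have k₁ : ¬ SameSide (P.ln v c) b s := by
    rw [ln_comm, sameSide_ln_iff hbc.symm hvc.symm hvb.symm (right_mem_ln hbc.symm)
      (ln_comm b c ▸ hs) hbc' hsc, not_not, sg, ln_comm]
    exact hcs
  rw [← h₃.left_congr, sameSide_ln_iff hva hvc hac (right_mem_ln hva) hsa hav hsv, not_not] at k₁
  have k₂ : SameSide (P.ln v b) c s := by
    rw [ln_comm, sameSide_ln_iff hbc hvb.symm hvc.symm (right_mem_ln hbc) hs hbc'.symm hsb]
    intro k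
    exact hbc' (hL.antisymm (left_mem_ln hbc) (right_mem_ln hbc) hs k hcs)
  rw [k₂.right_congr, sameSide_ln_iff hva hvb hab (right_mem_ln hva) hsa hav hsv, not_not]
  exact k₁

/-- Let `va` meet the pseudoline `bc` in `s`. By `h₁` the point `s` is outside the pseudosegment,
say beyond `c`. Then `vc` separates `b` from `s`, so if it does not separate `a` from `b`, `v` is
between `a` and `s`. But then `vb`, which does not separate `c` from `s`, separates `a` from `c`. -/
theorem not_all_sameSide (hva : v ≠ a) (hvb : v ≠ b) (hvc : v ≠ c) (hab : a ≠ b) (hac : a ≠ c)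
    (hbc : b ≠ c) (h₁ : SameSide (P.ln v a) b c) (h₂ : SameSide (P.ln v b) a c) :
    ¬ SameSide (P.ln v c) a b := by
  intro h₃
  obtain ⟨s, hs, -⟩ := crossesOnce_ln hva hbc (ln_ne hva hbc hvb hvc)
  obtain ⟨hsa, hsb⟩ : s ∈ P.ln v a ∩ P.ln b c := by rw [hs]; rfl
  rcases (isPseudoline_ln hbc).trichotomy hsb (left_mem_ln hbc) (right_mem_ln hbc) with k | k | k
  · exact SameSide.not_mem hva hbc (ln_ne hva hbc hvb hvc) h₁ (left_mem_ln hbc) (right_mem_ln hbc) k hsa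
  · refine not_all_sameSide_of_mem hva hvc hvb hac hab hbc.symm (ln_comm b c ▸ hsb) hsa ?_ h₂ h₃
    rw [sg, ln_comm, pseudosegment_comm]
    exact k
  · refine not_all_sameSide_of_mem hva hvb hvc hab hac hbc hsb hsa ?_ h₃ h₂
    rw [sg, pseudosegment_comm]
    exact k

/-- A closed side of a connecting pseudoline is convex along every connecting pseudoline; `w` only
names the side. -/
theorem mem_or_sameSide_of_mem (hab : a ≠ b) (hcd : c ≠ d) (hs : s ∈ P.ln c d) (ht : t ∈ P.ln c d)
    (hu : u ∈ P.sg c d s t) (h : s ∈ P.ln a b ∨ SameSide (P.ln a b) s w)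
    (h' : t ∈ P.ln a b ∨ SameSide (P.ln a b) t w) : u ∈ P.ln a b ∨ SameSide (P.ln a b) u w := by
  by_cases huL : u ∈ P.ln a b
  · exact .inl huL
  right
  have hM := isPseudoline_ln (P := P) hcd
  have huM : u ∈ P.ln c d := pseudosegment_subset hu
  have hne : P.ln a b ≠ P.ln c d := fun e => huL (e ▸ huM)
  obtain ⟨x, hx, -⟩ := crossesOnce_ln hab hcd hne
  obtain ⟨hxL, hxM⟩ : x ∈ P.ln a b ∩ P.ln c d := by rw [hx]; rfl
  have hxu : ∀ y ∈ P.ln c d, y ∈ P.ln a b → y = x := fun y h1 h2 => by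
    have : y ∈ P.ln a b ∩ P.ln c d := ⟨h2, h1⟩
    rwa [hx] at this
  have hux : u ≠ x := fun e => huL (e ▸ hxL)
  have key : ∀ y ∈ P.ln c d, y ≠ x → (SameSide (P.ln a b) u y ↔ x ∉ P.sg c d u y) := fun y hy hyx =>
    (crossesOnce_ln hab hcd hne).sameSide_iff hM hxL hxM huM hy hux hyx
  by_cases hsL : s ∈ P.ln a b
  · obtain rfl := hxu s hs hsL
    by_cases htL : t ∈ P.ln a b
    · obtain rfl := hxu t ht htL
      obtain ⟨g, hi, hg⟩ := hM.mem_iff_transfer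
      rw [sg, hg _ hs _ hs] at hu
      have := hu.2
      rw [uIcc_self] at this
      exact absurd (hi huM hs this) hux
    · refine SameSide.trans ((key t ht fun e => htL (e ▸ hsL)).2 ?_) (h'.resolve_left htL)
      exact hM.not_mem_sub hs ht hu hux
  · refine SameSide.trans ((key s hs fun e => hsL (e ▸ hxL)).2 ?_) (h.resolve_left hsL)
    by_cases htL : t ∈ P.ln a b
    · obtain rfl := hxu t ht htL
      exact hM.not_mem_sub ht hs (pseudosegment_comm (P.ln c d) s t ▸ hu) hux
    · have h1 := (h.resolve_left hsL).trans (h'.resolve_left htL).symm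
      intro hx'
      refine SameSide.not_mem hab hcd hne h1 hs ht (u := x) ?_ hxL
      by_contra hx''
      rw [sg, pseudosegment_comm] at hu hx''
      exact hM.not_mem_mono ht hs hu hx'' hx'

/-- If `v` is in the triangle `a`, `b`, `c`, then `v` is in every closed side that contains
`a`, `b` and `c`. -/
theorem mem_or_sameSide_of_separated (hva : v ≠ a) (hvb : v ≠ b) (hvc : v ≠ c) (hab : a ≠ b)
    (hbc : b ≠ c) (h₁ : ¬ SameSide (P.ln v a) b c)
    (h₂ : ¬ SameSide (P.ln v b) a c) (hxy : x ≠ y)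
    (ka : (a : Plane) ∈ P.ln x y ∨ SameSide (P.ln x y) a w)
    (kb : (b : Plane) ∈ P.ln x y ∨ SameSide (P.ln x y) b w)
    (kc : (c : Plane) ∈ P.ln x y ∨ SameSide (P.ln x y) c w) :
    (v : Plane) ∈ P.ln x y ∨ SameSide (P.ln x y) v w := by
  obtain ⟨s, hs, hsa, hv⟩ := exists_of_separated hva hvb hvc hab hbc h₁ h₂
  have ks := mem_or_sameSide_of_mem hxy hbc (left_mem_ln hbc) (right_mem_ln hbc) hs kb kc
  exact mem_or_sameSide_of_mem hxy hva (right_mem_ln hva) hsa hv ka ks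

end PseudoConfiguration

/-! ### Orientations, extreme pairs and the radial order -/

/-- An orientation of the triples of a linearly ordered set that behaves like the orientation of
the triples of a planar point set, ordered from left to right; `o p q r` stands for a clockwise
triple, so that it says of `p < q < r` that they form a cap. -/
structure IsOrientation {α : Type*} [LinearOrder α] (o : α → α → α → Prop) : Prop where
  cyc : ∀ p q r, p ≠ q → q ≠ r → p ≠ r → o p q r → o q r p
  swap : ∀ p q r, p ≠ q → q ≠ r → p ≠ r → (o q p r ↔ ¬ o p q r)
  exchange : ∀ c x y z v, c ≠ x → c ≠ y → c ≠ z → c ≠ v → x ≠ y → x ≠ z → x ≠ v → y ≠ z → y ≠ v →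
    z ≠ v → ¬ (o c x y ↔ o c x z) → (o c v y ↔ o c v z) →
    ((o c y x ↔ o c y z) ↔ (o c v x ↔ o c v y))
  mono_fst : ∀ i j k l, i < j → j < k → k < l → (o i j k ↔ o i k l) → (o i j k ↔ o i j l)
  mono_snd : ∀ i j k l, i < j → j < k → k < l → (o i j k ↔ o j k l) → (o i j k ↔ o i j l)
  mono_trd : ∀ i j k l, i < j → j < k → k < l → (o i j k ↔ o j k l) → (o i j k ↔ o i k l)
  mono_fth : ∀ i j k l, i < j → j < k → k < l → (o i j l ↔ o j k l) → (o i j l ↔ o i k l)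

namespace PseudoConfiguration

variable {P : PseudoConfiguration} {a b c d x y z v f r : {p // p ∈ P.points}} {s t u w : Plane}

/-- All points of `S` other than `v` and `f` are on one side of the pseudoline of `v` and `f`. -/
def IsExtremePair (S : Finset {p // p ∈ P.points}) (v f : {p // p ∈ P.points}) : Prop :=
  v ≠ f ∧ ∀ r ∈ S, ∀ s ∈ S, r ≠ v → r ≠ f → s ≠ v → s ≠ f → SameSide (P.ln v f) r s

/-- The hypothesis says that `z` is in no triangle of `S`. Among all pseudolines through `z` and a
point of `S`, take one with the most points on one side. -/
theorem exists_isExtremePair_of_not_separated {S : Finset {p // p ∈ P.points}} (hS : 2 ≤ S.card)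
    (hz : z ∉ S) (h : ∀ a ∈ S, ∀ b ∈ S, ∀ c ∈ S, a ≠ b → a ≠ c → b ≠ c →
      ¬ SameSide (P.ln z a) b c → SameSide (P.ln z b) a c) :
    ∃ w ∈ S, IsExtremePair (insert z S) z w := by
  classical
  have hne : ∀ a ∈ S, z ≠ a := fun a ha e => hz (e ▸ ha)
  let F : {p // p ∈ P.points} × {p // p ∈ P.points} → Finset {p // p ∈ P.points} :=
    fun q => S.filter fun r => r ≠ q.1 ∧ SameSide (P.ln z q.1) q.2 r
  obtain ⟨⟨w, s⟩, hws, hmax⟩ := S.offDiag.exists_max_image (fun q => (F q).card) (by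
    obtain ⟨a, ha, b, hb, hab⟩ := Finset.one_lt_card.1 hS
    exact ⟨(a, b), Finset.mem_offDiag.2 ⟨ha, hb, hab⟩⟩)
  obtain ⟨hw, hs, hne'⟩ := Finset.mem_offDiag.1 hws
  simp only at hw hs hne'
  refine ⟨w, hw, hne w hw, ?_⟩
  suffices key : ∀ u ∈ S, u ≠ w → SameSide (P.ln z w) s u by
    intro r hr t ht hrz hrw htz htw
    exact (key r (Finset.mem_of_mem_insert_of_ne hr hrz) hrw).symm.trans
      (key t (Finset.mem_of_mem_insert_of_ne ht htz) htw)
  intro u hu huw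
  by_contra hsu
  -- If `u` were on the other side of `zw`, the side of `zu` that contains `w` would contain `w` and
  -- everything counted for `(w, s)`, contradicting maximality.
  have hsub : insert w (F (w, s)) ⊆ F (u, w) := by
    intro r hr
    rcases Finset.mem_insert.1 hr with rfl | hr
    · exact Finset.mem_filter.2 ⟨hw, huw.symm,
        SameSide.refl (not_mem_ln (hne u hu) (hne _ hw).symm huw.symm)⟩
    · obtain ⟨hrS, hrw, hsr⟩ := Finset.mem_filter.1 hr
      have hru : r ≠ u := fun e => hsu (e ▸ hsr)
      refine Finset.mem_filter.2 ⟨hrS, hru, h w hw u hu r hrS huw.symm hrw.symm hru.symm ?_⟩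
      exact fun k => hsu (hsr.trans k.symm)
  have h1 := Finset.card_le_card hsub
  rw [Finset.card_insert_of_notMem (by simp [F])] at h1
  have h2 := hmax (u, w) (Finset.mem_offDiag.2 ⟨hu, hw, huw⟩)
  omega

theorem exists_isExtremePair (S : Finset {p // p ∈ P.points}) (hS : 2 ≤ S.card) :
    ∃ v ∈ S, ∃ f ∈ S, IsExtremePair S v f := by
  classical
  induction S using Finset.induction_on with
  | empty => simp at hS
  | insert z S hz ih =>
    rw [Finset.card_insert_of_notMem hz] at hS
    by_cases hS2 : 2 ≤ S.card
    · obtain ⟨v, hv, f, hf, hvf, h⟩ := ih hS2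
      have hne : ∀ a ∈ S, z ≠ a := fun a ha e => hz (e ▸ ha)
      by_cases hall : ∀ r ∈ S, r ≠ v → r ≠ f → SameSide (P.ln v f) z r
      · refine ⟨v, Finset.mem_insert_of_mem hv, f, Finset.mem_insert_of_mem hf, hvf, ?_⟩
        intro r hr s hs hrv hrf hsv hsf
        rcases Finset.mem_insert.1 hr with rfl | hr' <;> rcases Finset.mem_insert.1 hs with rfl | hs'
        · exact SameSide.refl (not_mem_ln hvf hrv hrf)
        · exact hall s hs' hsv hsf
        · exact (hall r hr' hrv hrf).symm
        · exact h r hr' s hs' hrv hrf hsv hsf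
      -- Here `vf` separates `z` from the other points. A triangle of `S` stays in the closed side
      -- of `vf` that contains `S`, so `z` is in none.
      · push Not at hall
        obtain ⟨r, hr, hrv, hrf, hzr⟩ := hall
        have hcl : ∀ a ∈ S, (a : Plane) ∈ P.ln v f ∨ SameSide (P.ln v f) a r := by
          intro a ha
          by_cases hav : a = v
          · exact .inl ((mem_ln hvf).2 (.inl hav))
          by_cases haf : a = f
          · exact .inl ((mem_ln hvf).2 (.inr haf))
          exact .inr (h a ha r hr hav haf hrv hrf)
        obtain ⟨w, hw, hw'⟩ := exists_isExtremePair_of_not_separated hS2 hz (by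
          intro a ha b hb c hc hab hac hbc h1
          by_contra h2
          rcases mem_or_sameSide_of_separated (hne a ha) (hne b hb) (hne c hc) hab hbc h1 h2 hvf
            (hcl a ha) (hcl b hb) (hcl c hc) with h3 | h3
          · exact not_mem_ln hvf (hne v hv) (hne f hf) h3
          · exact hzr h3)
        exact ⟨z, Finset.mem_insert_self _ _, w, Finset.mem_insert_of_mem hw, hw'⟩
    · obtain ⟨s, rfl⟩ := Finset.card_eq_one.1 (show S.card = 1 by omega)
      refine ⟨z, by simp, s, by simp, by simpa using hz, ?_⟩
      intro r hr t ht h1 h2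
      simp [h1, h2] at hr

section Order

variable (hE : IsExtremePair Finset.univ v f)
include hE

/-- An extreme point `v` is in no triangle: otherwise `v` would be between `a` and a point `s` of
the opposite side, although both are on one side of `vf`. Triangles with the vertex `f` contradict
extremality directly. -/
theorem IsExtremePair.sameSide_of_separated (hva : v ≠ a) (hvb : v ≠ b) (hvc : v ≠ c) (hab : a ≠ b)
    (hac : a ≠ c) (hbc : b ≠ c) (h₁ : ¬ SameSide (P.ln v a) b c) : SameSide (P.ln v b) a c := by
  by_contra h₂
  obtain ⟨hvf, h⟩ := hE
  by_cases hfa : a = f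
  · subst hfa
    exact h₁ (h b (Finset.mem_univ _) c (Finset.mem_univ _) hvb.symm hab.symm hvc.symm hac.symm)
  by_cases hfb : b = f
  · subst hfb
    exact h₂ (h a (Finset.mem_univ _) c (Finset.mem_univ _) hva.symm hab hvc.symm hbc.symm)
  by_cases hfc : c = f
  · subst hfc
    exact separated_third hva hvb hvc hab hac hbc h₁ h₂
      (h a (Finset.mem_univ _) b (Finset.mem_univ _) hva.symm hac hvb.symm hbc)
  · obtain ⟨s, hs, hsa, hv⟩ := exists_of_separated hva hvb hvc hab hbc h₁ h₂
    have h3 := SameSide.of_mem hvf hbc (ln_ne hvf hbc hvb hvc)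
      (h b (Finset.mem_univ _) c (Finset.mem_univ _) hvb.symm hfb hvc.symm hfc) (left_mem_ln hbc)
      (right_mem_ln hbc) hs
    have h4 := (h a (Finset.mem_univ _) c (Finset.mem_univ _) hva.symm hfa hvc.symm hfc).trans h3.symm
    exact SameSide.not_mem hvf hva (ln_ne_of_left hvf hva (Ne.symm hfa)) h4 (right_mem_ln hva) hsa
      hv (left_mem_ln hvf)

omit hE in
variable (v f) in
/-- The order in which a pseudoline that rotates about `v`, starting from `f`, meets the other
points. -/
def before (r s : {p // p ∈ P.points}) : Prop :=
  r ≠ s ∧ (r = f ∨ (s ≠ f ∧ ¬ SameSide (P.ln v r) f s))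

theorem IsExtremePair.before_total (hr : a ≠ v) (hs : b ≠ v) (h : a ≠ b) :
    before v f a b ∨ before v f b a := by
  by_cases hfa : a = f
  · exact .inl ⟨h, .inl hfa⟩
  by_cases hfb : b = f
  · exact .inr ⟨h.symm, .inl hfb⟩
  by_contra! hc
  simp only [before, h, h.symm, hfa, hfb, ne_eq, not_false_eq_true, true_and, false_or,
    not_not] at hc
  exact not_all_sameSide hE.1 hr.symm hs.symm (Ne.symm hfa) (Ne.symm hfb) h
    (hE.2 a (Finset.mem_univ _) b (Finset.mem_univ _) hr hfa hs hfb) hc.1 hc.2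

theorem IsExtremePair.before_asymm (hr : a ≠ v) (hs : b ≠ v) (h : before v f a b) :
    ¬ before v f b a := by
  rintro ⟨-, h'⟩
  obtain ⟨hab, h⟩ := h
  rcases h with rfl | ⟨hb, h⟩
  · simp [hab.symm] at h'
  · rcases h' with rfl | ⟨ha, h'⟩
    · exact hb rfl
    · apply h'
      rw [sameSide_comm]
      rw [sameSide_comm] at h
      exact hE.sameSide_of_separated hr.symm hs.symm hE.1 hab ha hb h

/-- The pseudoline from `v` to the middle one of three points separates the other two. -/
theorem IsExtremePair.separated (hr : a ≠ v) (hs : b ≠ v) (h : before v f a b)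
    (h' : before v f b c) : ¬ SameSide (P.ln v b) a c := by
  obtain ⟨hab, h⟩ := h
  obtain ⟨hbc, h'⟩ := h'
  by_cases hb : b = f
  · exact absurd (h.resolve_right fun k => k.1 hb) fun k => hab (k.trans hb.symm)
  have h' := (h'.resolve_left hb).2
  by_cases ha : a = f
  · rwa [ha]
  have h := (h.resolve_left ha).2
  have h4 : SameSide (P.ln v b) a f := by
    rw [sameSide_comm] at h
    exact hE.sameSide_of_separated hr.symm hs.symm hE.1 hab ha hb h
  rwa [h4.left_congr]

end Order

end PseudoConfiguration

/-! ### The orientation of triples as seen from an extreme point -/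

namespace PseudoConfiguration

variable {P : PseudoConfiguration} {a b c d x y z v f r : {p // p ∈ P.points}} {s t u w : Plane}

/-- If the pseudoline of `v` and `b` separates `a` and `c`, but the one of `v` and `a` does not
separate `b` and `c`, then `b` is below the pseudoline of `a` and `c`, as seen from `v`, if and only
if `c` is above that of `a` and `b`. -/
theorem sameSide_iff_not_sameSide (hva : v ≠ a) (hvb : v ≠ b) (hvc : v ≠ c) (hab : a ≠ b)
    (hac : a ≠ c) (hbc : b ≠ c) (h : ¬ SameSide (P.ln v b) a c) (h' : SameSide (P.ln v a) b c) :
    SameSide (P.ln a c) v b ↔ ¬ SameSide (P.ln a b) v c := by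
  obtain ⟨s, hs, hsb⟩ := exists_crossing hac h
  have hsac := pseudosegment_subset hs
  have hsa : s ≠ a := ne_of_mem_of_not_mem' hsb (not_mem_ln hvb hva.symm hab)
  have hsv : s ≠ v := ne_of_mem_of_not_mem' hsac (not_mem_ln hac hva hvc)
  have hsb' : s ≠ b := ne_of_mem_of_not_mem' hsac (not_mem_ln hac hab.symm hbc)
  have hbv : (b : Plane) ≠ v := Subtype.coe_injective.ne hvb.symm
  have hM := isPseudoline_ln (P := P) hvb
  have hv := left_mem_ln (P := P) hvb
  have hb := right_mem_ln (P := P) hvb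
  have k₁ : (v : Plane) ∉ P.sg v b b s := by
    rw [← sameSide_ln_iff hvb hva hab.symm hb hsb hbv hsv]
    refine h'.trans (SameSide.symm ?_)
    exact sameSide_of_mem_sg hvc hva hac hs hsa
  have k₂ : SameSide (P.ln a b) s c := by
    rw [ln_comm]
    exact sameSide_of_mem_sg hbc hab.symm hac hs hsa
  -- Both statements concern the order of `v`, `b`, `s` on `vb`: the left one says that `s` is not
  -- between `v` and `b`, the right one that `b` is between `v` and `s`. They agree because `k₁`
  -- excludes `v` from the middle.
  rw [← k₂.right_congr, (crossesOnce_ln hac hvb (ln_ne hvb hac hva hvc).symm).sameSide_iff hM hsac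
    hsb hv hb hsv.symm hsb'.symm, ln_comm a b, sameSide_ln_iff hvb.symm hab.symm hva
    (right_mem_ln hvb.symm) (ln_comm v b ▸ hsb) hbv.symm hsb', not_not, sg, ln_comm b v]
  rw [sg] at k₁
  constructor
  · intro k
    rcases hM.trichotomy hv hb hsb with h1 | h1 | h1
    · exact absurd h1 k₁
    · exact h1
    · exact absurd h1 k
  · intro k k'
    rw [pseudosegment_comm] at k k'
    exact hsb'.symm (hM.antisymm hb hsb hv k k')

variable (v) in
/-- The orientation of a triple of points, as seen from `v`. -/
def turn (lt : {p // p ∈ P.points} → {p // p ∈ P.points} → Prop)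
    (p q r : {p // p ∈ P.points}) : Prop :=
  lt p q ↔ SameSide (P.ln p q) v r

section Order

variable (hE : IsExtremePair Finset.univ v f)
include hE

theorem IsExtremePair.sameSide_left (ha : a ≠ v) (hb : b ≠ v) (hc : c ≠ v) (hac : a ≠ c)
    (h : before v f a b) (h' : before v f b c) : SameSide (P.ln v a) b c := by
  have := hE.separated ha hb h h'
  exact hE.sameSide_of_separated hb.symm ha.symm hc.symm h.1.symm h'.1 hac this

theorem IsExtremePair.sameSide_right (ha : a ≠ v) (hb : b ≠ v) (hc : c ≠ v) (hac : a ≠ c)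
    (h : before v f a b) (h' : before v f b c) : SameSide (P.ln v c) a b := by
  have := hE.separated ha hb h h'
  rw [sameSide_comm] at this ⊢
  exact hE.sameSide_of_separated hb.symm hc.symm ha.symm h'.1 h.1.symm hac.symm this

theorem IsExtremePair.before_trans (ha : a ≠ v) (hb : b ≠ v) (hc : c ≠ v)
    (h : before v f a b) (h' : before v f b c) : before v f a c := by
  have hac : a ≠ c := by
    rintro rfl
    exact hE.before_asymm ha hb h h'
  refine (hE.before_total ha hc hac).resolve_right fun k => ?_
  exact hE.separated hb hc h' k (hE.sameSide_right ha hb hc hac h h').symm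

theorem IsExtremePair.turn_snd (ha : a ≠ v) (hb : b ≠ v) (hc : c ≠ v) (hac : a ≠ c)
    (h : before v f a b) (h' : before v f b c) :
    SameSide (P.ln a c) v b ↔ ¬ SameSide (P.ln a b) v c :=
  sameSide_iff_not_sameSide ha.symm hb.symm hc.symm h.1 hac h'.1 (hE.separated ha hb h h')
    (hE.sameSide_left ha hb hc hac h h')

theorem IsExtremePair.turn_fst (ha : a ≠ v) (hb : b ≠ v) (hc : c ≠ v) (hac : a ≠ c)
    (h : before v f a b) (h' : before v f b c) :
    SameSide (P.ln a c) v b ↔ ¬ SameSide (P.ln b c) v a := by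
  rw [ln_comm a c, ln_comm b c]
  exact sameSide_iff_not_sameSide hc.symm hb.symm ha.symm h'.1.symm hac.symm h.1.symm
    (fun k => hE.separated ha hb h h' k.symm) (hE.sameSide_right ha hb hc hac h h').symm

omit hE in
-- Two points that `ab` separates from `v` are on the same side because there are only two sides
-- (`two_sides`).
theorem sameSide_iff_turn {lt : {p // p ∈ P.points} → {p // p ∈ P.points} → Prop}
    (ha : a ≠ v) (hb : b ≠ v) (hab : a ≠ b) (hac : a ≠ c) (had : a ≠ d) (hbc : b ≠ c)
    (hbd : b ≠ d) : SameSide (P.ln a b) c d ↔ (turn v lt a b c ↔ turn v lt a b d) := by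
  have h1 : SameSide (P.ln a b) v c → SameSide (P.ln a b) v d → SameSide (P.ln a b) c d :=
    fun h h' => h.symm.trans h'
  have h2 : ¬ SameSide (P.ln a b) v c → ¬ SameSide (P.ln a b) v d → SameSide (P.ln a b) c d :=
    fun h h' => two_sides hab hac hbc ha had hb hbd (fun k => h k.symm) h'
  have h3 : SameSide (P.ln a b) c d → (SameSide (P.ln a b) v c ↔ SameSide (P.ln a b) v d) :=
    fun h => h.right_congr
  unfold turn
  tauto

/-- The points of the configuration other than `v`, in the order in which they are seen from `v`. -/
noncomputable abbrev IsExtremePair.linearOrder : LinearOrder {p : {p // p ∈ P.points} // p ≠ v} :=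
  haveI : IsStrictTotalOrder {p : {p // p ∈ P.points} // p ≠ v} fun p q => before v f p q :=
    { trichotomous := fun p q h h' => by
        by_contra hne
        exact (hE.before_total p.2 q.2 fun e => hne (Subtype.ext e)).elim h h'
      irrefl := fun p h => h.1 rfl
      trans := fun p q r h h' => hE.before_trans p.2 q.2 r.2 h h' }
  haveI := Classical.decRel fun p q : {p : {p // p ∈ P.points} // p ≠ v} => before v f p q
  linearOrderOfSTO fun p q : {p : {p // p ∈ P.points} // p ≠ v} => before v f p q

/-- Cyclic symmetry comes from `turn_fst` and `turn_snd`, and the exchange axiom from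
`sameSide_exchange`. The four monotonicity axioms are the same exchange rule with `v` as the fifth
point: the radial order decides which sides of the pseudolines through `v` the points are on. -/
theorem IsExtremePair.isOrientation :
    @IsOrientation _ hE.linearOrder
      fun p q r : {p : {p // p ∈ P.points} // p ≠ v} => turn v (before v f) p q r := by
  let := hE.linearOrder
  have hlt : ∀ p q : {p : {p // p ∈ P.points} // p ≠ v}, p < q ↔ before v f p q := fun p q => Iff.rfl
  have hn : ∀ p q : {p : {p // p ∈ P.points} // p ≠ v}, p ≠ q → (p : {p // p ∈ P.points}) ≠ q :=
    fun p q h e => h (Subtype.ext e)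
  let o := fun p q r : {p : {p // p ∈ P.points} // p ≠ v} => turn v (before v f) p q r
  have hswap : ∀ p q r : {p : {p // p ∈ P.points} // p ≠ v}, p ≠ q →
      (o q p r ↔ ¬ o p q r) := by
    intro p q r hpq
    simp only [o, turn, ← hlt, ln_comm (q : {p // p ∈ P.points}) p]
    rcases lt_or_gt_of_ne hpq with h | h
    · simp [h, h.not_gt]
    · simp [h, h.not_gt]
  have hsorted : ∀ p q r : {p : {p // p ∈ P.points} // p ≠ v}, p < q → q < r →
      (o p q r ↔ o q r p) ∧ (o q r p ↔ o r p q) := by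
    intro p q r hpq hqr
    have hpr := hpq.trans hqr
    have h1 := hE.turn_fst p.2 q.2 r.2 (hn _ _ hpr.ne) hpq hqr
    have h2 := hE.turn_snd p.2 q.2 r.2 (hn _ _ hpr.ne) hpq hqr
    simp only [o, turn, ← hlt, hpq, hqr, hpr.not_gt, true_iff, false_iff,
      ln_comm (r : {p // p ∈ P.points}) p]
    tauto
  have hss : ∀ a b c d : {p : {p // p ∈ P.points} // p ≠ v}, a ≠ b → a ≠ c → a ≠ d → b ≠ c →
      b ≠ d → (SameSide (P.ln a b) c d ↔ (o a b c ↔ o a b d)) := fun a b c d h1 h2 h3 h4 h5 =>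
    sameSide_iff_turn a.2 b.2 (hn _ _ h1) (hn _ _ h2) (hn _ _ h3) (hn _ _ h4) (hn _ _ h5)
  -- The exchange rule with `v` as the fifth point; its centre `c` will be `i`, `j`, `k`, `l` in the
  -- four monotonicity axioms in turn.
  have hex : ∀ c x y z : {p : {p // p ∈ P.points} // p ≠ v}, c ≠ x → c ≠ y → c ≠ z → x ≠ y →
      x ≠ z → y ≠ z → ¬ (o c x y ↔ o c x z) → SameSide (P.ln v c) y z →
      ((o c y x ↔ o c y z) ↔ SameSide (P.ln v c) x y) := by
    intro c x y z hcx hcy hcz hxy hxz hyz h h'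
    rw [← hss c x y z hcx hcy hcz hxy hxz] at h
    rw [← hss c y x z hcy hcx hcz hxy.symm hyz]
    rw [ln_comm v c] at *
    exact sameSide_exchange (hn _ _ hcx) (hn _ _ hcy) (hn _ _ hcz) c.2 (hn _ _ hxy) x.2
      (hn _ _ hyz) h h'
  have hl : ∀ p q r : {p : {p // p ∈ P.points} // p ≠ v}, p < q → q < r →
      SameSide (P.ln v p) q r := fun p q r h h' =>
    hE.sameSide_left p.2 q.2 r.2 (hn _ _ (h.trans h').ne) h h'
  have hr : ∀ p q r : {p : {p // p ∈ P.points} // p ≠ v}, p < q → q < r →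
      SameSide (P.ln v r) p q := fun p q r h h' =>
    hE.sameSide_right p.2 q.2 r.2 (hn _ _ (h.trans h').ne) h h'
  have hm : ∀ p q r : {p : {p // p ∈ P.points} // p ≠ v}, p < q → q < r →
      ¬ SameSide (P.ln v q) p r := fun p q r h h' => hE.separated p.2 q.2 h h'
  suffices IsOrientation o from this
  clear_value o
  refine ⟨?_, ?_, ?_, ?_, ?_, ?_, ?_⟩
  · intro p q r hpq hqr hpr h
    have s1 := hswap p q r hpq
    have s2 := hswap q r p hqr
    have s3 := hswap p r q hpr
    rcases lt_or_gt_of_ne hpq with h1 | h1 <;> rcases lt_or_gt_of_ne hqr with h2 | h2 <;>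
      rcases lt_or_gt_of_ne hpr with h3 | h3
    · have := hsorted p q r h1 h2
      tauto
    · exact absurd (h1.trans h2) h3.not_gt
    · have := hsorted p r q h3 h2
      tauto
    · have := hsorted r p q h3 h1
      tauto
    · have := hsorted q p r h1 h3
      tauto
    · have := hsorted q r p h2 h3
      tauto
    · exact absurd (h2.trans h1) h3.not_gt
    · have := hsorted r q p h2 h1
      tauto
  · intro p q r hpq _ _
    exact hswap p q r hpq
  · intro c x y z v' hcx hcy hcz hcv hxy hxz hxv hyz hyv hzv h h'
    rw [← hss c x y z hcx hcy hcz hxy hxz] at h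
    rw [← hss c v' y z hcv hcy hcz hyv.symm hzv.symm] at h'
    rw [← hss c y x z hcy hcx hcz hxy.symm hyz, ← hss c v' x y hcv hcx hcy hxv.symm hyv.symm]
    exact sameSide_exchange (hn _ _ hcx) (hn _ _ hcy) (hn _ _ hcz) (hn _ _ hcv) (hn _ _ hxy)
      (hn _ _ hxv) (hn _ _ hyz) h h'
  all_goals
    intro i j k l hij hjk hkl
    have hik := hij.trans hjk
    have hjl := hjk.trans hkl
    have hil := hij.trans hjl
    intro h
    by_contra hc
  · have h1 := (hex i j k l hij.ne hik.ne hil.ne hjk.ne hjl.ne hkl.ne hc (hl i k l hik hkl)).2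
      (hl i j k hij hjk)
    have h4 := hsorted i j k hij hjk
    have h5 := hswap k i j hik.ne'
    clear hss hex hl hr hm hsorted hswap hn hlt
    grind
  · have h1 := hex j i k l hij.ne' hjk.ne hjl.ne hik.ne hil.ne hkl.ne
    have h2 := hl j k l hjk hkl
    have h3 := hm i j k hij hjk
    have h4 := hsorted i j k hij hjk
    have h5 := hswap i j k hij.ne
    have h6 := hswap i j l hij.ne
    clear hss hex hl hr hm hsorted hswap hn hlt
    grind
  · have h1 := hex k l i j hkl.ne hik.ne' hjk.ne' hil.ne' hjl.ne' hij.ne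
    have h2 := hr i j k hij hjk
    have h3 := fun k' => hm i k l hik hkl (SameSide.symm k')
    have h4 := hsorted i j k hij hjk
    have h5 := hsorted i k l hik hkl
    have h6 := hsorted j k l hjk hkl
    have h7 := hswap i k l hik.ne
    clear hss hex hl hr hm hsorted hswap hn hlt
    grind
  · have h1 := hex l k i j hkl.ne' hil.ne' hjl.ne' hik.ne' hjk.ne' hij.ne
    have h2 := hr i j l hij hjl
    have h3 := (hr i k l hik hkl).symm
    have h4 := hsorted i j l hij hjl
    have h5 := hsorted i k l hik hkl
    have h6 := hsorted j k l hjk hkl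
    have h7 := hswap k l i hkl.ne
    have h8 := hswap k l j hkl.ne
    have h9 := hswap i l k hil.ne
    clear hss hex hl hr hm hsorted hswap hn hlt
    grind

end Order

end PseudoConfiguration

/-! ### Tangents of convex sets -/

/-- No point of `Q` is inside a triangle of points of `Q`. -/
def IsConvexSet {α : Type*} (o : α → α → α → Prop) (Q : Finset α) : Prop :=
  ∀ p ∈ Q, ∀ q ∈ Q, ∀ r ∈ Q, ∀ s ∈ Q, p ≠ q → p ≠ r → p ≠ s → q ≠ r → q ≠ s → r ≠ s →
    ¬ (o p q r ∧ o p r s ∧ o p s q)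

/-- By induction: if the old source `q` does not dominate a new element `z`, then `z` dominates `q`,
and also every other `r`, as `z`, `q`, `r` would form a cycle otherwise. -/
theorem exists_forall_rel_of_no_cycle {α : Type*} (R : α → α → Prop) (S : Finset α)
    (hS : S.Nonempty) (htot : ∀ a ∈ S, ∀ b ∈ S, a ≠ b → R a b ∨ R b a)
    (hcyc : ∀ a ∈ S, ∀ b ∈ S, ∀ c ∈ S, a ≠ b → a ≠ c → b ≠ c → R a b → R b c → ¬ R c a) :
    ∃ q ∈ S, ∀ r ∈ S, r ≠ q → R q r := by
  classical
  induction hS using Finset.Nonempty.cons_induction with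
  | singleton a => exact ⟨a, by simp, by simp⟩
  | cons z S hz hS ih =>
    obtain ⟨q, hq, h⟩ := ih
      (fun a ha b hb => htot a (Finset.mem_cons_of_mem ha) b (Finset.mem_cons_of_mem hb))
      (fun a ha b hb c hc => hcyc a (Finset.mem_cons_of_mem ha) b (Finset.mem_cons_of_mem hb) c
        (Finset.mem_cons_of_mem hc))
    have hzm := Finset.mem_cons_self z S (h := hz)
    have hne : ∀ r ∈ S, z ≠ r := fun r hr e => hz (e ▸ hr)
    have hm : ∀ r ∈ S, r ∈ Finset.cons z S hz := fun r hr => Finset.mem_cons_of_mem hr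
    by_cases hqz : R q z
    · refine ⟨q, hm q hq, fun r hr hrq => ?_⟩
      rcases Finset.mem_cons.1 hr with rfl | hr
      · exact hqz
      · exact h r hr hrq
    · have hzq := (htot z hzm q (hm q hq) (hne q hq)).resolve_right hqz
      refine ⟨z, hzm, fun r hr hrz => ?_⟩
      have hr := (Finset.mem_cons.1 hr).resolve_left hrz
      by_cases hrq : r = q
      · rwa [hrq]
      · exact (htot z hzm r (hm r hr) hrz.symm).resolve_right
          (hcyc z hzm q (hm q hq) r (hm r hr) (hne q hq) hrz.symm (Ne.symm hrq) hzq (h r hr hrq))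

/-- A cycle of length three in the relation "clockwise about `p`" would be a triangle of `Q` around
`p`. Without such cycles the relation has a source, and it is the required `q`. -/
theorem IsConvexSet.exists_tangent {α : Type*} [LinearOrder α] {o : α → α → α → Prop}
    (ho : IsOrientation o) {Q : Finset α} (hQ : IsConvexSet o Q) (hc : 2 ≤ Q.card) {p : α}
    (hp : p ∈ Q) : ∃ q ∈ Q, q ≠ p ∧ ∀ r ∈ Q, r ≠ p → r ≠ q → o p q r := by
  have hne : (Q.erase p).Nonempty := by
    rw [← Finset.card_pos, Finset.card_erase_of_mem hp]
    omega
  obtain ⟨q, hq, h⟩ := exists_forall_rel_of_no_cycle (fun q r => o p q r) (Q.erase p) hne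
    (by
      intro a ha b hb hab
      have hap := Finset.ne_of_mem_erase ha
      have hbp := Finset.ne_of_mem_erase hb
      by_contra! h
      have h2 := (ho.swap p a b hap.symm hab hbp.symm).2 h.1
      have h3 := ho.cyc a p b hap hbp.symm hab h2
      exact h.2 h3)
    (by
      intro a ha b hb c hc hab hac hbc h1 h2 h3
      exact hQ p hp a (Finset.mem_of_mem_erase ha) b (Finset.mem_of_mem_erase hb) c
        (Finset.mem_of_mem_erase hc) (Finset.ne_of_mem_erase ha).symm
        (Finset.ne_of_mem_erase hb).symm (Finset.ne_of_mem_erase hc).symm hab hac hbc ⟨h1, h2, h3⟩)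
  exact ⟨q, Finset.mem_of_mem_erase hq, Finset.ne_of_mem_erase hq, fun r hr hrp hrq =>
    h r (Finset.mem_erase.2 ⟨hrp, hr⟩) hrq⟩

/-! ### From convex sets of the orientation to convex position -/

theorem Parametrizes.neg {γ : ℝ → Plane} {L : Set Plane} (h : Parametrizes γ L) :
    Parametrizes (fun t => γ (-t)) L := by
  refine ⟨h.1.comp continuous_neg, h.2.1.comp neg_injective, ?_, ?_⟩
  · exact h.2.2.1.comp (Homeomorph.neg ℝ).isClosedEmbedding.tendsto_cocompact
  · rw [← h.2.2.2]
    exact (Equiv.neg ℝ).surjective.range_comp γ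

/-- A pseudoline can be parametrized in the direction from `p` to `q`. -/
theorem IsPseudoline.exists_directed {L : Set Plane} {p q : Plane} (hL : IsPseudoline L)
    (hp : p ∈ L) (hq : q ∈ L) (hpq : p ≠ q) :
    ∃ γ a b, Parametrizes γ L ∧ γ a = p ∧ γ b = q ∧ a < b := by
  obtain ⟨γ, h⟩ := hL
  obtain ⟨a, rfl⟩ := h.exists_eq hp
  obtain ⟨b, rfl⟩ := h.exists_eq hq
  rcases lt_or_gt_of_ne (fun e => hpq (congrArg γ e) : a ≠ b) with hab | hab
  · exact ⟨γ, a, b, h, rfl, rfl, hab⟩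
  · exact ⟨_, -a, -b, h.neg, by simp, by simp, neg_lt_neg hab⟩

theorem Parametrizes.not_isBounded_image_Iic {γ : ℝ → Plane} {L : Set Plane}
    (h : Parametrizes γ L) (a : ℝ) : ¬ Bornology.IsBounded (γ '' Iic a) := by
  intro hb
  have h1 := (h.2.2.1.mono_left atBot_le_cocompact).eventually
    hb.isCompact_closure.compl_mem_cocompact
  obtain ⟨t, ht, hta⟩ := (h1.and (eventually_le_atBot a)).exists
  exact ht (subset_closure (mem_image_of_mem γ hta))

namespace PseudoConfiguration

variable {P : PseudoConfiguration}

/-- A set of points is in convex position if each of them is on a pseudoline through another one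
that leaves all others on one side. -/
theorem inConvexPosition_of_tangent (Q : Finset {p // p ∈ P.points})
    (h : ∀ p ∈ Q, ∃ q, q ≠ p ∧ ∀ r ∈ Q, ∀ s ∈ Q, r ≠ p → r ≠ q → s ≠ p → s ≠ q →
      SameSide (P.ln p q) r s) :
    P.InConvexPosition (Q.map (Function.Embedding.subtype _)) := by
  refine ⟨?_, ?_⟩
  · intro p hp
    obtain ⟨p', -, rfl⟩ := Finset.mem_map.1 hp
    exact p'.2
  intro p' hp'
  obtain ⟨p, hp, rfl⟩ := Finset.mem_map.1 hp'
  obtain ⟨q, hqp, hpq⟩ := h p hp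
  -- The parametrization runs from `p` to `q`, so the image of `Iic a` is the ray that leaves `p`
  -- away from `q`. It is connected and unbounded; what remains is that it avoids the pseudosegments
  -- of the other points.
  obtain ⟨γ, a, b, hγ, ha, hb, hab⟩ := (isPseudoline_ln hqp.symm).exists_directed
    (left_mem_ln hqp.symm) (right_mem_ln hqp.symm) (Subtype.coe_injective.ne hqp.symm)
  have hmem : ∀ x ∈ ((Q.map (Function.Embedding.subtype _) : Finset Plane) : Set Plane) \
      {(p : Plane)}, ∃ r ∈ Q, r ≠ p ∧ (r : Plane) = x := by
    rintro x ⟨hx, hxp⟩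
    obtain ⟨r, hr, rfl⟩ := Finset.mem_map.1 (Finset.mem_coe.1 hx)
    exact ⟨r, hr, fun e => hxp (by rw [e]; rfl), rfl⟩
  have hray : ∀ t ≤ a, γ t ≠ q := fun t ht e => by
    have := hγ.2.1 (e.trans hb.symm)
    linarith
  -- A pseudoline through `q` meets that of `p` and `q` only in `q`, which is not on the ray.
  -- Pseudosegments not ending in `q` stay on one side of it instead.
  have hq : ∀ s : {p // p ∈ P.points}, s ≠ q → s ≠ p → ∀ t ≤ a, γ t ∉ P.ln q s := by
    intro s hsq hsp t ht hts
    obtain ⟨x, hx, -⟩ := crossesOnce_ln hqp hsq.symm (ln_ne_of_left hqp hsq.symm hsp.symm)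
    have h1 : (q : Plane) ∈ P.ln q p ∩ P.ln q s := ⟨left_mem_ln hqp, left_mem_ln hsq.symm⟩
    have h2 : γ t ∈ P.ln q p ∩ P.ln q s := ⟨ln_comm p q ▸ hγ.mem t, hts⟩
    rw [hx] at h1 h2
    exact hray t ht (h2.trans h1.symm)
  have hsub : γ '' Iic a ⊆ (P.skeleton (((Q.map (Function.Embedding.subtype _) : Finset Plane) :
      Set Plane) \ {(p : Plane)}))ᶜ := by
    rintro _ ⟨t, ht, rfl⟩
    rintro (hx | ⟨r', hr', s', hs', hrs, hx⟩)
    · obtain ⟨r, -, hrp, hr⟩ := hmem _ hx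
      have h1 := hγ.mem t
      rw [← hr, mem_ln hqp.symm] at h1
      exact hray t ht (by rw [← hr, h1.resolve_left hrp])
    · obtain ⟨r, hr, hrp, rfl⟩ := hmem _ hr'
      obtain ⟨s, hs, hsp, rfl⟩ := hmem _ hs'
      have hrs' : r ≠ s := fun e => hrs (by rw [e])
      have hx' := pseudosegment_subset hx
      by_cases hrq : r = q
      · exact hq s (fun e => hrs' (hrq.trans e.symm)) hsp t ht (hrq ▸ hx')
      by_cases hsq : s = q
      · refine hq r (fun e => hrs' (e.trans hsq.symm)) hrp t ht ?_
        rw [← hsq, ln_comm]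
        exact hx'
      exact SameSide.not_mem hqp.symm hrs' (ln_ne hqp.symm hrs' hrp.symm hsp.symm)
        (hpq r hr s hs hrp hrq hsp hsq) (left_mem_ln hrs') (right_mem_ln hrs') hx (hγ.mem t)
  have hpm : (p : Plane) ∈ γ '' Iic a := ⟨a, mem_Iic.2 le_rfl, ha⟩
  rw [hull, mem_compl_iff, not_not]
  refine ⟨hsub hpm, fun hbd => hγ.not_isBounded_image_Iic a (hbd.subset ?_)⟩
  exact (isPreconnected_Iic.image γ hγ.1.continuousOn).subset_connectedComponentIn hpm hsub

/-- The combinatorial structure of a pseudo-configuration. -/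
theorem exists_orientation (P : PseudoConfiguration) (hP : 2 ≤ P.points.card) :
    ∃ (α : Type) (_ : LinearOrder α) (_ : Fintype α) (o : α → α → α → Prop), IsOrientation o ∧
      Fintype.card α + 1 = P.points.card ∧ ∀ Q : Finset α, 2 ≤ Q.card → IsConvexSet o Q →
        ∃ Q' : Finset Plane, Q'.card = Q.card ∧ P.InConvexPosition Q' := by
  classical
  obtain ⟨v, -, f, -, hE⟩ := exists_isExtremePair (P := P) Finset.univ (by simpa using hP)
  refine ⟨{p : {p // p ∈ P.points} // p ≠ v}, hE.linearOrder, inferInstance,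
    fun p q r => turn v (before v f) p q r, hE.isOrientation, ?_, ?_⟩
  · have h1 := Fintype.card_subtype_compl fun p : {p // p ∈ P.points} => p = v
    simp only [Fintype.card_subtype_eq, Fintype.card_coe] at h1
    rw [h1]
    omega
  · intro Q hQ hQc
    refine ⟨(Q.map (Function.Embedding.subtype _)).map (Function.Embedding.subtype _), by simp,
      inConvexPosition_of_tangent _ ?_⟩
    intro p' hp'
    obtain ⟨p, hp, rfl⟩ := Finset.mem_map.1 hp'
    obtain ⟨q, hq, hqp, h⟩ := @IsConvexSet.exists_tangent _ hE.linearOrder _ hE.isOrientation _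
      hQc hQ p hp
    refine ⟨q, fun e => hqp (Subtype.ext e), ?_⟩
    intro r' hr' s' hs' hrp hrq hsp hsq
    obtain ⟨r, hr, rfl⟩ := Finset.mem_map.1 hr'
    obtain ⟨s, hs, rfl⟩ := Finset.mem_map.1 hs'
    rw [Function.Embedding.subtype_apply] at *
    refine (sameSide_iff_turn (lt := before v f) p.2 q.2 (fun e => hqp (Subtype.ext e.symm))
      hrp.symm hsp.symm hrq.symm hsq.symm).2 ?_
    have h1 := h r hr (fun e => hrp (by rw [e]; rfl)) (fun e => hrq (by rw [e]))
    have h2 := h s hs (fun e => hsp (by rw [e]; rfl)) (fun e => hsq (by rw [e]))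
    exact iff_of_true h1 h2

end PseudoConfiguration

/-! ### Transitive colorings and the cups-caps theorem -/

/-- All triples `p < q < r` of elements of `C` have the color `t`. -/
def IsMono {α : Type*} [LinearOrder α] (c : α → α → α → Prop) (t : Prop) (C : Finset α) : Prop :=
  ∀ p ∈ C, ∀ q ∈ C, ∀ r ∈ C, p < q → q < r → (c p q r ↔ t)

/-- The color of a triple is transitive, in the sense that two overlapping triples of the same color
determine the color of the other triples. -/
def IsTransitiveColoring {α : Type*} [LinearOrder α] (c : α → α → α → Prop) : Prop :=
  ∀ i j k l, i < j → j < k → k < l → (c i j k ↔ c j k l) →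
    (c i j k ↔ c i j l) ∧ (c i j k ↔ c i k l)

section Coloring

variable {α : Type*} [LinearOrder α] {c : α → α → α → Prop} {t : Prop} {C D S : Finset α}
  {d e f : α}

theorem IsMono.subset (h : IsMono c t C) (hD : D ⊆ C) : IsMono c t D :=
  fun p hp q hq r hr => h p (hD hp) q (hD hq) r (hD hr)

theorem isMono_of_card_le_two (h : C.card ≤ 2) : IsMono c t C := by
  classical
  intro p hp q hq r hr hpq hqr
  have h1 : ({p, q, r} : Finset α) ⊆ C := by
    intro x
    simp only [Finset.mem_insert, Finset.mem_singleton]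
    rintro (rfl | rfl | rfl) <;> assumption
  have h2 := Finset.card_le_card h1
  rw [Finset.card_eq_three.2 ⟨p, q, r, hpq.ne, (hpq.trans hqr).ne, hqr.ne, rfl⟩] at h2
  omega

/-- Only the triple of the two largest old elements and the new one needs checking; transitivity
carries its color first to the triples with middle element `e`, then to all. -/
theorem IsMono.insert_max (hc : IsTransitiveColoring c) (hC : IsMono c t C) (he : e ∈ C)
    (hemax : ∀ x ∈ C, x ≤ e) (hd : d ∈ C) (hde : d < e) (hdmax : ∀ x ∈ C, x < e → x ≤ d)
    (hef : e < f) (h : c d e f ↔ t) : IsMono c t (insert f C) := by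
  have hf : ∀ x ∈ C, x < f := fun x hx => (hemax x hx).trans_lt hef
  have h1 : ∀ q ∈ C, q < e → (c q e f ↔ t) := by
    intro q hq hqe
    rcases (hdmax q hq hqe).eq_or_lt with rfl | hqd
    · exact h
    · have h2 := hC q hq d hd e he hqd hde
      have h3 := (hc q d e f hqd hde hef (h2.trans h.symm)).2
      exact h3.symm.trans h2
  intro p hp q hq r hr hpq hqr
  rcases Finset.mem_insert.1 hr with rfl | hr
  · have hq := (Finset.mem_insert.1 hq).resolve_left hqr.ne
    have hp := (Finset.mem_insert.1 hp).resolve_left (hpq.trans hqr).ne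
    rcases (hemax q hq).eq_or_lt with rfl | hqe
    · exact h1 p hp hpq
    · have h2 := hC p hp q hq e he hpq hqe
      have h3 := (hc p q e r hpq hqe hef (h2.trans (h1 q hq hqe).symm)).1
      exact h3.symm.trans h2
  · have hrf := hf r hr
    have hq := (Finset.mem_insert.1 hq).resolve_left (hqr.trans hrf).ne
    have hp := (Finset.mem_insert.1 hp).resolve_left (hpq.trans (hqr.trans hrf)).ne
    exact hC p hp q hq r hr hpq hqr

theorem IsMono.insert_min (hc : IsTransitiveColoring c) (hC : IsMono c t C) (he : e ∈ C)
    (hemin : ∀ x ∈ C, e ≤ x) (hd : d ∈ C) (hed : e < d) (hdmin : ∀ x ∈ C, e < x → d ≤ x)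
    (hfe : f < e) (h : c f e d ↔ t) : IsMono c t (insert f C) := by
  have hf : ∀ x ∈ C, f < x := fun x hx => hfe.trans_le (hemin x hx)
  have h1 : ∀ q ∈ C, e < q → (c f e q ↔ t) := by
    intro q hq hqe
    rcases (hdmin q hq hqe).eq_or_lt with rfl | hqd
    · exact h
    · have h2 := hC e he d hd q hq hed hqd
      have h3 := (hc f e d q hfe hed hqd (h.trans h2.symm)).1
      exact h3.symm.trans h
  intro p hp q hq r hr hpq hqr
  rcases Finset.mem_insert.1 hp with rfl | hp
  · have hq := (Finset.mem_insert.1 hq).resolve_left hpq.ne'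
    have hr := (Finset.mem_insert.1 hr).resolve_left (hpq.trans hqr).ne'
    rcases (hemin q hq).eq_or_lt with rfl | hqe
    · exact h1 r hr hqr
    · have h2 := hC e he q hq r hr hqe hqr
      have h3 := (hc p e q r hfe hqe hqr ((h1 q hq hqe).trans h2.symm)).2
      exact h3.symm.trans (h1 q hq hqe)
  · have hpf := hf p hp
    have hq := (Finset.mem_insert.1 hq).resolve_left (hpf.trans hpq).ne'
    have hr := (Finset.mem_insert.1 hr).resolve_left (hpf.trans (hpq.trans hqr)).ne'
    exact hC p hp q hq r hr hpq hqr

/-- The cups-caps theorem for transitive colorings. -/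
theorem IsTransitiveColoring.exists_isMono (hc : IsTransitiveColoring c) (k l : ℕ) (S : Finset α)
    (hS : (k + l).choose k < S.card) :
    (∃ C ⊆ S, C.card = k + 2 ∧ IsMono c True C) ∨ ∃ C ⊆ S, C.card = l + 2 ∧ IsMono c False C := by
  classical
  induction k generalizing l S with
  | zero =>
    obtain ⟨C, hCS, hC⟩ := Finset.exists_subset_card_eq (show 2 ≤ S.card by simp at hS; omega)
    exact .inl ⟨C, hCS, hC, isMono_of_card_le_two hC.le⟩
  | succ k ihk =>
    induction l generalizing S with
    | zero =>
      obtain ⟨C, hCS, hC⟩ := Finset.exists_subset_card_eq (show 2 ≤ S.card by simp at hS; omega)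
      exact .inr ⟨C, hCS, hC, isMono_of_card_le_two hC.le⟩
    | succ l ihl =>
      -- The right endpoints of caps of size `k + 2`. The rest of `S` contains no such cap, so
      -- either it yields the required cup or `E` is large enough for the induction on `l`.
      let E := S.filter fun x => ∃ C ⊆ S, C.card = k + 2 ∧ IsMono c True C ∧ x ∈ C ∧ ∀ y ∈ C, y ≤ x
      by_cases h1 : (k + (l + 1)).choose k < (S \ E).card
      · rcases ihk (l + 1) (S \ E) h1 with ⟨C, hCS, hC, hm⟩ | ⟨C, hCS, hC, hm⟩
        · have hne : C.Nonempty := by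
            rw [← Finset.card_pos]
            omega
          have hmem := C.max'_mem hne
          have h2 := Finset.mem_sdiff.1 (hCS hmem)
          exact absurd (Finset.mem_filter.2 ⟨h2.1, C, hCS.trans Finset.sdiff_subset, hC, hm, hmem,
            fun y hy => C.le_max' y hy⟩) h2.2
        · exact .inr ⟨C, hCS.trans Finset.sdiff_subset, hC, hm⟩
      · have h2 : (k + 1 + l).choose (k + 1) < E.card := by
          have h3 : (S \ E).card + E.card = S.card :=
            Finset.card_sdiff_add_card_eq_card (Finset.filter_subset _ S)
          have h4 : (k + 1 + (l + 1)).choose (k + 1) =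
              (k + (l + 1)).choose k + (k + 1 + l).choose (k + 1) := by
            rw [show k + 1 + (l + 1) = (k + (l + 1)) + 1 by ring, Nat.choose_succ_succ,
              show k + 1 + l = k + (l + 1) by ring]
          omega
        have hES : E ⊆ S := Finset.filter_subset _ S
        rcases ihl E h2 with ⟨C, hCS, hC, hm⟩ | ⟨D, hDE, hD, hDm⟩
        · exact .inl ⟨C, hCS.trans hES, hC, hm⟩
        have hDne : D.Nonempty := by
          rw [← Finset.card_pos]
          omega
        set e := D.min' hDne with he
        have heD : e ∈ D := D.min'_mem hDne
        obtain ⟨-, C, hCS, hC, hCm, heC, hemax⟩ := Finset.mem_filter.1 (hDE heD)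
        have hCne : (C.erase e).Nonempty := by
          rw [← Finset.card_pos, Finset.card_erase_of_mem heC]
          omega
        have hDne' : (D.erase e).Nonempty := by
          rw [← Finset.card_pos, Finset.card_erase_of_mem heD]
          omega
        obtain ⟨hde, hd⟩ := Finset.mem_erase.1 ((C.erase e).max'_mem hCne)
        obtain ⟨hfe, hf⟩ := Finset.mem_erase.1 ((D.erase e).min'_mem hDne')
        have hde' := lt_of_le_of_ne (hemax _ hd) hde
        have hemin : ∀ x ∈ D, e ≤ x := fun x hx => D.min'_le x hx
        have hef' := lt_of_le_of_ne (hemin _ hf) hfe.symm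
        -- A cap `C` ends at `e`, where a cup `D` starts. The color of the triple formed by `e` and
        -- its neighbours in `C` and in `D` decides which of the two is extended.
        by_cases hdef : c ((C.erase e).max' hCne) e ((D.erase e).min' hDne')
        · refine .inl ⟨insert ((D.erase e).min' hDne') C, ?_, ?_, ?_⟩
          · exact Finset.insert_subset (hES (hDE hf)) hCS
          · rw [Finset.card_insert_of_notMem, hC]
            exact fun h => (hemax _ h).not_gt hef'
          · exact hCm.insert_max hc heC hemax hd hde'
              (fun x hx hxe => (C.erase e).le_max' x (Finset.mem_erase.2 ⟨hxe.ne, hx⟩)) hef'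
              (iff_true_intro hdef)
        · refine .inr ⟨insert ((C.erase e).max' hCne) D, ?_, ?_, ?_⟩
          · exact Finset.insert_subset (hCS hd) (hDE.trans hES)
          · rw [Finset.card_insert_of_notMem, hD]
            exact fun h => (hemin _ h).not_gt hde'
          · exact hDm.insert_min hc heD hemin hf hef'
              (fun x hx hxe => (D.erase e).min'_le x (Finset.mem_erase.2 ⟨hxe.ne', hx⟩)) hde'
              (iff_false_intro hdef)

end Coloring

/-! ### Radial orders and criteria for convexity -/

namespace IsOrientation

variable {α : Type*} [LinearOrder α] {o : α → α → α → Prop} (ho : IsOrientation o)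
  {a b c d e p q r s x y z : α}

include ho

theorem rot (hpq : p ≠ q) (hqr : q ≠ r) (hpr : p ≠ r) : o p q r ↔ o q r p :=
  ⟨ho.cyc p q r hpq hqr hpr, fun h => ho.cyc r p q hpr.symm hpq hqr.symm
    (ho.cyc q r p hqr hpr.symm hpq.symm h)⟩

theorem swap' (hpq : p ≠ q) (hqr : q ≠ r) (hpr : p ≠ r) : o p r q ↔ ¬ o p q r := by
  rw [ho.rot hpr hqr.symm hpq, ho.rot hpq hqr hpr]
  exact ho.swap q r p hqr hpr.symm hpq.symm

theorem isTransitiveColoring : IsTransitiveColoring o := fun i j k l hij hjk hkl h =>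
  ⟨ho.mono_snd i j k l hij hjk hkl h, ho.mono_trd i j k l hij hjk hkl h⟩

/-- The axioms are invariant under reflection, so every result on caps also holds for cups. -/
theorem neg : IsOrientation fun p q r => ¬ o p q r where
  cyc p q r hpq hqr hpr h h' := h ((ho.rot hpq hqr hpr).2 h')
  swap p q r hpq hqr hpr := not_congr (ho.swap p q r hpq hqr hpr)
  exchange c x y z v h1 h2 h3 h4 h5 h6 h7 h8 h9 h10 := by
    have := ho.exchange c x y z v h1 h2 h3 h4 h5 h6 h7 h8 h9 h10
    simpa only [not_iff_not] using this
  mono_fst i j k l h1 h2 h3 := by simpa only [not_iff_not] using ho.mono_fst i j k l h1 h2 h3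
  mono_snd i j k l h1 h2 h3 := by simpa only [not_iff_not] using ho.mono_snd i j k l h1 h2 h3
  mono_trd i j k l h1 h2 h3 := by simpa only [not_iff_not] using ho.mono_trd i j k l h1 h2 h3
  mono_fth i j k l h1 h2 h3 := by simpa only [not_iff_not] using ho.mono_fth i j k l h1 h2 h3

/-- If `p` precedes `q` and `q` precedes `r` in the order seen from `b`, then `p` precedes `r`. -/
theorem radial_trans (hba : b ≠ a) (hbp : b ≠ p) (hbq : b ≠ q) (hbr : b ≠ r) (hap : a ≠ p)
    (haq : a ≠ q) (har : a ≠ r) (hpq : p ≠ q) (hpr : p ≠ r) (hqr : q ≠ r)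
    (h₁ : o b a p) (h₂ : o b a q) (h₃ : o b a r) (h : o b p q) (h' : o b q r) : o b p r := by
  by_contra hc
  have s1 := ho.swap' hbp hpq hbq
  have := ho.exchange b p q r a hbp hbq hbr hba hpq hpr hap.symm hqr haq.symm har.symm
  grind

/-- In the order seen from a point `b`, the orientation is a transitive coloring. -/
theorem radial_transitive (hbp : b ≠ p) (hbq : b ≠ q) (hbr : b ≠ r) (hbs : b ≠ s) (hpq : p ≠ q)
    (hpr : p ≠ r) (hps : p ≠ s) (hqr : q ≠ r) (hqs : q ≠ s) (hrs : r ≠ s)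
    (h₁ : o b p q) (h₂ : o b p r) (h₄ : o b q r) (h₅ : o b q s)
    (h₆ : o b r s) (h : o p q r ↔ o q r s) : (o p q r ↔ o p q s) ∧ (o p q r ↔ o p r s) := by
  have h2 := ho.rot hpq hqr hpr
  have h3 := ho.swap p q r hpq hqr hpr
  constructor
  · have e1 := ho.exchange q p r s b hpq.symm hqr hqs hbq.symm hpr hps hbp.symm hrs hbr.symm hbs.symm
    have s1 := ho.swap p q s hpq hqs hps
    have s2 := ho.swap b q r hbq hqr hbr
    have s3 := ho.swap b q s hbq hqs hbs
    have r1 := ho.rot hbq.symm hbp hpq.symm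
    grind
  · have e2 := ho.exchange r s q p b hrs hqr.symm hpr.symm hbr.symm hqs.symm hps.symm hbs.symm
      hpq.symm hbq.symm hbp.symm
    have r1 := ho.rot hqr hrs hqs
    have r2 := ho.rot hpr hrs hps
    have r3 := ho.rot hbr.symm hbq hqr.symm
    have r4 := ho.rot hbr.symm hbp hpr.symm
    have s1 := ho.swap q r s hqr hrs hqs
    have s2 := ho.swap q r p hqr hpr.symm hpq.symm
    have s3 := ho.swap b r s hbr hrs hbs
    grind

end IsOrientation

/-- If the triples of `Q` that are increasing for a total order are all clockwise, then `Q` is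
convex. -/
theorem IsOrientation.isConvexSet_of_rel {α : Type*} [LinearOrder α] {o : α → α → α → Prop}
    (ho : IsOrientation o) {Q : Finset α} (R : α → α → Prop)
    (htot : ∀ p ∈ Q, ∀ q ∈ Q, p ≠ q → R p q ∨ R q p)
    (htrans : ∀ p ∈ Q, ∀ q ∈ Q, ∀ r ∈ Q, R p q → R q r → R p r) (hirr : ∀ p ∈ Q, ¬ R p p)
    (h : ∀ p ∈ Q, ∀ q ∈ Q, ∀ r ∈ Q, R p q → R q r → o p q r) : IsConvexSet o Q := by
  have key : ∀ p ∈ Q, ∀ q ∈ Q, ∀ r ∈ Q, p ≠ q → p ≠ r → q ≠ r → o p q r → R p q → R p r →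
      R q r := by
    intro p hp q hq r hr hpq hpr hqr ho1 h1 h2
    refine (htot q hq r hr hqr).resolve_right fun h3 => ?_
    exact (ho.swap' hpq hqr hpr).1 (h p hp r hr q hq h2 h3) ho1
  have key2 : ∀ p ∈ Q, ∀ q ∈ Q, ∀ r ∈ Q, p ≠ q → p ≠ r → q ≠ r → o p q r → R q p → R r p →
      R q r := by
    intro p hp q hq r hr hpq hpr hqr ho1 h1 h2
    refine (htot q hq r hr hqr).resolve_right fun h3 => ?_
    have h4 := h r hr q hq p hp h3 h1
    rw [ho.rot hqr.symm hpq.symm hpr.symm, ho.rot hpq.symm hpr hqr] at h4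
    exact (ho.swap' hpq hqr hpr).1 h4 ho1
  have key3 : ∀ p ∈ Q, ∀ q ∈ Q, ∀ r ∈ Q, p ≠ q → p ≠ r → q ≠ r → o p q r → R q p → ¬ R p r := by
    intro p hp q hq r hr hpq hpr hqr ho1 h1 h2
    exact (ho.swap p q r hpq hqr hpr).1 (h q hq p hp r hr h1 h2) ho1
  intro p hp q hq r hr s hs hpq hpr hps hqr hqs hrs ⟨h1, h2, h3⟩
  -- If `p` is inside the triangle `qrs`, it cannot be in the middle of the order, so it precedes or
  -- follows all three points. In either case the turns at `p` would order `q`, `r`, `s` cyclically.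
  have c1 := key3 p hp q hq r hr hpq hpr hqr h1
  have c2 := key3 p hp r hr s hs hpr hps hrs h2
  have c3 := key3 p hp s hs q hq hps hpq hqs.symm h3
  have hcyc : R q r → R r s → ¬ R s q := fun h4 h5 h6 =>
    hirr q hq (htrans q hq r hr q hq h4 (htrans r hr s hs q hq h5 h6))
  rcases htot p hp q hq hpq with t1 | t1
  · have t3 := (htot p hp s hs hps).resolve_right fun k => c3 k t1
    have t2 := (htot p hp r hr hpr).resolve_right fun k => c2 k t3
    exact hcyc (key p hp q hq r hr hpq hpr hqr h1 t1 t2)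
      (key p hp r hr s hs hpr hps hrs h2 t2 t3) (key p hp s hs q hq hps hpq hqs.symm h3 t3 t1)
  · have t2 := (htot p hp r hr hpr).resolve_left (c1 t1)
    have t3 := (htot p hp s hs hps).resolve_left (c2 t2)
    exact hcyc (key2 p hp q hq r hr hpq hpr hqr h1 t1 t2)
      (key2 p hp r hr s hs hpr hps hrs h2 t2 t3) (key2 p hp s hs q hq hps hpq hqs.symm h3 t3 t1)

theorem IsConvexSet.of_neg {α : Type*} [LinearOrder α] {o : α → α → α → Prop}
    (ho : IsOrientation o) {Q : Finset α} (h : IsConvexSet (fun p q r => ¬ o p q r) Q) :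
    IsConvexSet o Q := by
  intro p hp q hq r hr s hs hpq hpr hps hqr hqs hrs ⟨h1, h2, h3⟩
  refine h p hp q hq s hs r hr hpq hps hpr hqs hqr hrs.symm ⟨?_, ?_, ?_⟩
  · exact fun h4 => (ho.swap' hpq hqs hps).1 h3 h4
  · exact fun h4 => (ho.swap' hpr hrs hps).1 h4 h2
  · exact fun h4 => (ho.swap' hpq hqr hpr).1 h4 h1

theorem IsOrientation.isConvexSet_of_isMono_true {α : Type*} [LinearOrder α]
    {o : α → α → α → Prop} (ho : IsOrientation o) {Q : Finset α} (h : IsMono o True Q) :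
    IsConvexSet o Q :=
  ho.isConvexSet_of_rel (· < ·) (fun _ _ _ _ hpq => lt_or_gt_of_ne hpq)
    (fun _ _ _ _ _ _ => lt_trans) (fun p _ => lt_irrefl p)
    fun p hp q hq r hr hpq hqr => of_iff_true (h p hp q hq r hr hpq hqr)

theorem IsMono.neg {α : Type*} [LinearOrder α] {o : α → α → α → Prop} {t : Prop} {Q : Finset α}
    (h : IsMono o t Q) : IsMono (fun p q r => ¬ o p q r) (¬ t) Q :=
  fun p hp q hq r hr hpq hqr => not_congr (h p hp q hq r hr hpq hqr)

theorem IsOrientation.isConvexSet_of_isMono_false {α : Type*} [LinearOrder α]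
    {o : α → α → α → Prop} (ho : IsOrientation o) {Q : Finset α} (h : IsMono o False Q) :
    IsConvexSet o Q :=
  .of_neg ho (ho.neg.isConvexSet_of_isMono_true (by simpa using h.neg))

theorem IsConvexSet.subset {α : Type*} {o : α → α → α → Prop} {Q S : Finset α}
    (h : IsConvexSet o Q) (hS : S ⊆ Q) : IsConvexSet o S :=
  fun p hp q hq r hr s hs => h p (hS hp) q (hS hq) r (hS hr) s (hS hs)

/-! ### Cells of a cap and nested triangles -/

/-- `z` is in the triangle that is cut off above the edge from `c` to `d` of the cap `a`, `c`, `d`,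
`b` by the lines of the adjacent edges. -/
structure InCell {α : Type*} [LinearOrder α] (o : α → α → α → Prop) (a c d b z : α) : Prop where
  lt_left : c < z
  lt_right : z < d
  left : o a c z
  mid : o c z d
  right : o z d b

/-- `p` is in the triangle `a`, `q`, `b`. -/
def InnerTo {α : Type*} (o : α → α → α → Prop) (a b p q : α) : Prop :=
  p ≠ q ∧ o p q b ∧ ¬ o p q a

section Cell

variable {α : Type*} [LinearOrder α] {o : α → α → α → Prop} (ho : IsOrientation o)
  {a b c d e p q r s x y z : α} (hac : a < c) (hdb : d < b)

include ho hac hdb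

theorem InCell.cap (hp : InCell o a c d b p) : o a p b := by
  have h1 := ho.isTransitiveColoring a c p d hac hp.lt_left hp.lt_right
    (iff_of_true hp.left hp.mid)
  have h2 := h1.2.1 hp.left
  have h3 := ho.isTransitiveColoring a p d b (hac.trans hp.lt_left) hp.lt_right hdb
    (iff_of_true h2 hp.right)
  exact h3.1.1 h2

omit hdb in
theorem InCell.cap_left (hp : InCell o a c d b p) : o a p d ∧ o a c d := by
  have h1 := ho.isTransitiveColoring a c p d hac hp.lt_left hp.lt_right
    (iff_of_true hp.left hp.mid)
  exact ⟨h1.2.1 hp.left, h1.1.1 hp.left⟩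

omit hac in
theorem InCell.cap_right (hp : InCell o a c d b p) : o c p b ∧ o c d b := by
  have h1 := ho.isTransitiveColoring c p d b hp.lt_left hp.lt_right hdb
    (iff_of_true hp.mid hp.right)
  exact ⟨h1.1.1 hp.mid, h1.2.1 hp.mid⟩

omit ho hdb in
theorem InCell.ne_left (hp : InCell o a c d b p) : a ≠ p := (hac.trans hp.lt_left).ne

omit ho hac in
theorem InCell.ne_right (hp : InCell o a c d b p) : b ≠ p := (hp.lt_right.trans hdb).ne'

/-- Nesting means that `p` precedes `q` radially about `b` and follows it about `a`. All points of
the cell are on one side of `ab`, where these radial relations are transitive, so nesting is a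
partial order. -/
theorem InCell.inner_iff (hp : InCell o a c d b p) (hq : InCell o a c d b q) :
    InnerTo o a b p q ↔ p ≠ q ∧ o b p q ∧ ¬ o a p q := by
  refine and_congr_right fun hpq => ?_
  rw [← ho.rot (hp.ne_left hac) hpq (hq.ne_left hac),
    ho.rot (hp.ne_right hdb) hpq (hq.ne_right hdb)]

theorem InCell.inner_trans (hp : InCell o a c d b p) (hq : InCell o a c d b q)
    (hr : InCell o a c d b r) (h : InnerTo o a b p q) (h' : InnerTo o a b q r) : InnerTo o a b p r := by
  rw [hp.inner_iff ho hac hdb hq] at h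
  rw [hq.inner_iff ho hac hdb hr] at h'
  rw [hp.inner_iff ho hac hdb hr]
  have hab : a < b := (hac.trans (hp.lt_left.trans hp.lt_right)).trans hdb
  have hpr : p ≠ r := by
    rintro rfl
    have := ho.swap' (hp.ne_right hdb) h.1 (hq.ne_right hdb)
    exact this.1 h'.2.1 h.2.1
  have k : ∀ z, InCell o a c d b z → o b a z ∧ ¬ o a b z := fun z hz => by
    have h1 := hz.cap ho hac hdb
    exact ⟨(ho.rot hab.ne' (hz.ne_left hac) (hz.ne_right hdb)).2 h1,
      (ho.swap' (hz.ne_left hac) (hz.ne_right hdb).symm hab.ne).1.mt (not_not.2 h1)⟩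
  refine ⟨hpr, ?_, ?_⟩
  · exact ho.radial_trans hab.ne' (hp.ne_right hdb) (hq.ne_right hdb) (hr.ne_right hdb)
      (hp.ne_left hac) (hq.ne_left hac) (hr.ne_left hac) h.1 hpr h'.1 (k p hp).1 (k q hq).1
      (k r hr).1 h.2.1 h'.2.1
  · exact ho.neg.radial_trans hab.ne (hp.ne_left hac) (hq.ne_left hac) (hr.ne_left hac)
      (hp.ne_right hdb) (hq.ne_right hdb) (hr.ne_right hdb) h.1 hpr h'.1 (k p hp).2 (k q hq).2
      (k r hr).2 h.2.2 h'.2.2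

/-- A chain of nested triangles is sorted radially about `b`, so `radial_transitive` applies. -/
theorem InCell.inner_transitive (hp : InCell o a c d b p) (hq : InCell o a c d b q)
    (hr : InCell o a c d b r) (hs : InCell o a c d b s) (h₁ : InnerTo o a b p q)
    (h₂ : InnerTo o a b q r) (h₃ : InnerTo o a b r s) (h : o p q r ↔ o q r s) :
    (o p q r ↔ o p q s) ∧ (o p q r ↔ o p r s) := by
  have h₄ := hp.inner_trans ho hac hdb hq hr h₁ h₂
  have h₅ := hq.inner_trans ho hac hdb hr hs h₂ h₃
  have h₆ := hp.inner_trans ho hac hdb hq hs h₁ h₅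
  rw [hp.inner_iff ho hac hdb hq] at h₁
  rw [hq.inner_iff ho hac hdb hr] at h₂
  rw [hr.inner_iff ho hac hdb hs] at h₃
  rw [hp.inner_iff ho hac hdb hr] at h₄
  rw [hq.inner_iff ho hac hdb hs] at h₅
  exact ho.radial_transitive (hp.ne_right hdb) (hq.ne_right hdb) (hr.ne_right hdb) (hs.ne_right hdb)
    h₁.1 h₄.1 h₆.1 h₂.1 h₅.1 h₃.1 h₁.2.1 h₄.2.1 h₂.2.1 h₅.2.1 h₃.2.1 h

/-- Incomparable points form a cap with `a` and `b`, so that caps found inside an antichain extend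
to both ends of the cell. -/
theorem InCell.cap_of_not_inner (hp : InCell o a c d b p) (hq : InCell o a c d b q) (hpq : p < q)
    (h : ¬ InnerTo o a b p q) (h' : ¬ InnerTo o a b q p) : o a p q ∧ o p q b := by
  have hap := hac.trans hp.lt_left
  have hqb := hq.lt_right.trans hdb
  have h1 := hp.cap ho hac hdb
  have h2 := ho.mono_snd a p q b hap hpq hqb
  have h3 := ho.swap p q b hpq.ne hqb.ne (hpq.trans hqb).ne
  have h4 := ho.swap p q a hpq.ne (hap.trans hpq).ne' hap.ne'
  have h5 := ho.rot hap.ne hpq.ne (hap.trans hpq).ne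
  have h6 := hpq.ne
  have h7 := hpq.ne'
  unfold InnerTo at h h'
  grind

omit hdb in
-- When `p` is inside the triangle `aqb`, the line of `p` and `q` separates `a` from `b`. The next
-- cell is entirely on the side of `b`.
theorem InCell.inner_next (hp : InCell o a c d b p)
    (hq : InCell o a c d b q) (h : InnerTo o a b p q) (hz : InCell o c d b e z) : o p q z := by
  have hzb := hz.lt_right
  have hdz := hz.lt_left
  have hzp : ∀ q, InCell o a c d b q → o q z b := fun q hq => by
    have := ho.mono_fth q d z b hq.lt_right hdz hzb (iff_of_true hq.right hz.mid)
    exact this.1 hq.right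
  have haz : ∀ q, InCell o a c d b q → o a q z := fun q hq => by
    have h1 := (ho.isTransitiveColoring a c d z hac (hq.lt_left.trans hq.lt_right) hdz
      (iff_of_true (hq.cap_left ho hac).2 hz.left)).2.1 (hq.cap_left ho hac).2
    exact (ho.mono_fst a q d z (hac.trans hq.lt_left) hq.lt_right hdz
      (iff_of_true (hq.cap_left ho hac).1 h1)).1 (hq.cap_left ho hac).1
  obtain ⟨hpq, h1, h2⟩ := h
  have hap := hac.trans hp.lt_left
  have haq := hac.trans hq.lt_left
  have hpz := hp.lt_right.trans hdz
  have hqz := hq.lt_right.trans hdz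
  have zp := hzp p hp
  have zq := hzp q hq
  have ap := haz p hp
  rcases lt_or_gt_of_ne hpq with hlt | hlt
  · by_contra h3
    rw [← ho.rot hap.ne hpq haq.ne] at h2
    have := (ho.mono_snd a p q z hap hlt hqz (iff_of_false h2 h3)).2 ap
    exact h2 this
  · have h4 := (ho.swap p q b hpq (hqz.trans hzb).ne (hpz.trans hzb).ne).not_left.2 h1
    by_contra h3
    have h5 := (ho.swap p q z hpq hqz.ne hpz.ne).2 h3
    exact h4 ((ho.mono_fst q p z b hlt hpz hzb (iff_of_true h5 zq)).1 h5)

omit hac in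
-- The counterpart of `inner_next`: the previous cell is on the side of `a`.
theorem InCell.inner_prev (hp : InCell o a c d b p)
    (hq : InCell o a c d b q) (h : InnerTo o a b p q) (hz : InCell o e a c d z) : ¬ o p q z := by
  have hzc := hz.lt_right
  have haz := hz.lt_left
  have hza : ∀ q, InCell o a c d b q → o a z q := fun q hq =>
    (ho.mono_fst a z c q haz hzc hq.lt_left (iff_of_true hz.mid hq.left)).1 hz.mid
  have hzb : ∀ q, InCell o a c d b q → o z q b := fun q hq => by
    have h1 := (ho.isTransitiveColoring z c d b hzc (hq.lt_left.trans hq.lt_right) hdb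
      (iff_of_true hz.right (hq.cap_right ho hdb).2)).1.1 hz.right
    exact (ho.mono_fth z c q b hzc hq.lt_left (hq.lt_right.trans hdb)
      (iff_of_true h1 (hq.cap_right ho hdb).1)).1 h1
  obtain ⟨hpq, h1, h2⟩ := h
  have hzp := hzc.trans hp.lt_left
  have hzq := hzc.trans hq.lt_left
  have hpb := hp.lt_right.trans hdb
  have hqb := hq.lt_right.trans hdb
  have ap := hza p hp
  have bq := hzb q hq
  intro h3
  rcases lt_or_gt_of_ne hpq with hlt | hlt
  · rw [← ho.rot hzp.ne hpq hzq.ne] at h3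
    rw [← ho.rot (haz.trans hzp).ne hpq (haz.trans hzq).ne] at h2
    have := ho.mono_fth a z p q haz hzp hlt (iff_of_true (hza q hq) h3)
    exact h2 (this.1 (hza q hq))
  · have h4 : ¬ o q p b := (ho.swap p q b hpq hqb.ne hpb.ne).not_left.2 h1
    have h5 : ¬ o z q p := by
      rw [ho.rot hzq.ne hpq.symm hzp.ne]
      exact (ho.swap p q z hpq hzq.ne' hzp.ne').not_left.2 h3
    exact h5 ((ho.mono_snd z q p b hzq hlt hpb (iff_of_false h5 h4)).2 bq)

end Cell

/-! ### Caps and chains inside one cell -/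

/-- If all chains of a partial order have at most `h` elements and all antichains have at most `w`,
then there are at most `h * w` elements. -/
theorem card_le_of_chains_of_antichains {α : Type*} (R : α → α → Prop) (h w : ℕ) (T : Finset α)
    (hirr : ∀ p ∈ T, ¬ R p p)
    (htrans : ∀ p ∈ T, ∀ q ∈ T, ∀ r ∈ T, R p q → R q r → R p r)
    (hh : ∀ C ⊆ T, (∀ p ∈ C, ∀ q ∈ C, p ≠ q → R p q ∨ R q p) → C.card ≤ h)
    (hw : ∀ A ⊆ T, (∀ p ∈ A, ∀ q ∈ A, ¬ R p q) → A.card ≤ w) : T.card ≤ h * w := by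
  classical
  induction h generalizing T with
  | zero =>
    have : T = ∅ := by
      by_contra hne
      obtain ⟨x, hx⟩ := Finset.nonempty_iff_ne_empty.2 hne
      have := hh {x} (by simpa using hx) (by simp)
      simp at this
    simp [this]
  | succ h ih =>
    -- The minimal elements form an antichain; removing them shortens the longest chain, because a
    -- chain in the rest can be extended below its least element.
    let M := T.filter fun x => ∀ y ∈ T, ¬ R y x
    have hMT : M ⊆ T := Finset.filter_subset _ _
    have hM : M.card ≤ w := hw M hMT fun p hp q hq =>
      (Finset.mem_filter.1 hq).2 p (hMT hp)
    have hTM : (T \ M).card ≤ h * w := by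
      have hsub : T \ M ⊆ T := Finset.sdiff_subset
      refine ih (T \ M) (fun p hp => hirr p (hsub hp))
        (fun p hp q hq r hr => htrans p (hsub hp) q (hsub hq) r (hsub hr)) ?_
        fun A hA => hw A (hA.trans hsub)
      intro C hC hch
      rcases C.eq_empty_or_nonempty with rfl | hne
      · simp
      obtain ⟨m, hm, hmin⟩ : ∃ m ∈ C, ∀ x ∈ C, x ≠ m → R m x :=
        exists_forall_rel_of_no_cycle R C hne hch fun a ha b hb c hc _ _ _ h1 h2 h3 =>
          have ht := fun x (hx : x ∈ C) => hsub (hC hx)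
          hirr a (ht a ha) (htrans a (ht a ha) b (ht b hb) a (ht a ha) h1
            (htrans b (ht b hb) c (ht c hc) a (ht a ha) h2 h3))
      obtain ⟨hmT, hmM⟩ := Finset.mem_sdiff.1 (hC hm)
      have : ∃ y ∈ T, R y m := by
        by_contra! hc
        exact hmM (Finset.mem_filter.2 ⟨hmT, hc⟩)
      obtain ⟨y, hy, hym⟩ := this
      have hyx : ∀ x ∈ C, R y x := fun x hx => by
        by_cases hxm : x = m
        · rwa [hxm]
        · exact htrans y hy m hmT x (hsub (hC hx)) hym (hmin x hx hxm)
      have hyC : y ∉ C := fun k => hirr y hy (hyx y k)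
      have := hh (insert y C) (Finset.insert_subset hy (hC.trans hsub)) (by
        intro p hp q hq hpq
        rcases Finset.mem_insert.1 hp with hp | hp <;> rcases Finset.mem_insert.1 hq with hq | hq
        · exact absurd (hp.trans hq.symm) hpq
        · exact .inl (hp ▸ hyx q hq)
        · exact .inr (hq ▸ hyx p hp)
        · exact hch p hp q hq hpq)
      rw [Finset.card_insert_of_notMem hyC] at this
      omega
    have h3 : (T \ M).card + M.card = T.card := Finset.card_sdiff_add_card_eq_card hMT
    rw [← h3, add_mul, one_mul]
    exact add_le_add hTM hM

/-- A chain of nested triangles over `a` and `b`, all of whose triples have the orientation `t`. -/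
structure IsNestedChain {α : Type*} (o : α → α → α → Prop) (a b : α) (t : Prop) (K : Finset α) :
    Prop where
  total : ∀ p ∈ K, ∀ q ∈ K, p ≠ q → InnerTo o a b p q ∨ InnerTo o a b q p
  color : ∀ p ∈ K, ∀ q ∈ K, ∀ r ∈ K, InnerTo o a b p q → InnerTo o a b q r → (o p q r ↔ t)

/-- The set `L` forms a cap together with `a` and `b`. -/
structure IsCapOver {α : Type*} [LinearOrder α] (o : α → α → α → Prop) (a b : α) (L : Finset α) :
    Prop where
  mono : IsMono o True L
  ends : ∀ p ∈ L, ∀ q ∈ L, p < q → o a p q ∧ o p q b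

theorem isNestedChain_singleton {α : Type*} {o : α → α → α → Prop} {a b p : α} (t : Prop) (h : ∀ q, ¬ InnerTo o a b q q) :
    IsNestedChain o a b t {p} := by
  constructor
  · simp
  · intro p' hp q hq r _ hpq
    rw [Finset.mem_singleton] at hp hq
    subst hp hq
    exact absurd hpq (h _)

theorem exists_max_card {α : Type*} (T : Finset α) (p : Finset α → Prop) (h0 : p ∅) :
    ∃ S ⊆ T, p S ∧ ∀ S' ⊆ T, p S' → S'.card ≤ S.card := by
  classical
  obtain ⟨S, hS, hmax⟩ := (T.powerset.filter p).exists_max_image Finset.card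
    ⟨∅, Finset.mem_filter.2 ⟨Finset.empty_mem_powerset T, h0⟩⟩
  obtain ⟨h1, h2⟩ := Finset.mem_filter.1 hS
  exact ⟨S, Finset.mem_powerset.1 h1, h2, fun S' h3 h4 =>
    hmax S' (Finset.mem_filter.2 ⟨Finset.mem_powerset.2 h3, h4⟩)⟩

section Cell

variable {α : Type*} [LinearOrder α] {o : α → α → α → Prop} (ho : IsOrientation o)
  {a b c d e p q r s x y z : α} (hac : a < c) (hdb : d < b)

include ho hac hdb

theorem exists_isNestedChain {C : Finset α} (hC : ∀ z ∈ C, InCell o a c d b z)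
    (hch : ∀ p ∈ C, ∀ q ∈ C, p ≠ q → InnerTo o a b p q ∨ InnerTo o a b q p) (k l : ℕ)
    (hcard : (k + l).choose k < C.card) :
    (∃ K ⊆ C, K.card = k + 2 ∧ IsNestedChain o a b True K) ∨
      ∃ K ⊆ C, K.card = l + 2 ∧ IsNestedChain o a b False K := by
  classical
  have hasymm : ∀ p ∈ C, ∀ q ∈ C, InnerTo o a b p q → ¬ InnerTo o a b q p := fun p hp q hq h h' =>
    ((hC p hp).inner_trans ho hac hdb (hC q hq) (hC p hp) h h').1 rfl
  let β := {x // x ∈ C}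
  let R : β → β → Prop := fun p q => InnerTo o a b p q
  have : IsStrictTotalOrder β R :=
    { trichotomous := fun p q h h' => by
        by_contra hne
        exact (hch p p.2 q q.2 fun e => hne (Subtype.ext e)).elim h h'
      irrefl := fun p h => h.1 rfl
      trans := fun p q r h h' => (hC p p.2).inner_trans ho hac hdb (hC q q.2) (hC r r.2) h h' }
  let := linearOrderOfSTO R
  have htc : IsTransitiveColoring fun p q r : β => o p q r := fun p q r s h1 h2 h3 h4 =>
    (hC p p.2).inner_transitive ho hac hdb (hC q q.2) (hC r r.2) (hC s s.2) h1 h2 h3 h4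
  have key : ∀ (t : Prop) (K : Finset β), IsMono (fun p q r : β => o p q r) t K →
      IsNestedChain o a b t (K.map (Function.Embedding.subtype _)) := by
    intro t K hK
    constructor
    · intro p hp q hq hpq
      obtain ⟨p, hp, rfl⟩ := Finset.mem_map.1 hp
      obtain ⟨q, hq, rfl⟩ := Finset.mem_map.1 hq
      exact hch p p.2 q q.2 hpq
    · intro p' hp' q' hq' r' hr' hpq hqr
      obtain ⟨p, hp, rfl⟩ := Finset.mem_map.1 hp'
      obtain ⟨q, hq, rfl⟩ := Finset.mem_map.1 hq'
      obtain ⟨r, hr, rfl⟩ := Finset.mem_map.1 hr'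
      exact hK p hp q hq r hr hpq hqr
  have hsub : ∀ K : Finset β, K.map (Function.Embedding.subtype _) ⊆ C := by
    intro K p hp
    obtain ⟨p, -, rfl⟩ := Finset.mem_map.1 hp
    exact p.2
  rcases htc.exists_isMono k l Finset.univ (by simpa [β] using hcard) with ⟨K, -, hK, hm⟩ | ⟨K, -, hK, hm⟩
  · exact .inl ⟨_, hsub K, by rw [Finset.card_map, hK], key _ K hm⟩
  · exact .inr ⟨_, hsub K, by rw [Finset.card_map, hK], key _ K hm⟩

/-- A cell with many points contains a large cap or large nested chains. -/
theorem exists_card_cell_le {T : Finset α} (hT : ∀ z ∈ T, InCell o a c d b z) {n : ℕ} (hn : 3 ≤ n)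
    (hconv : ∀ Q : Finset α, Q.card = n → ¬ IsConvexSet o Q) :
    ∃ L ⊆ T, ∃ K ⊆ T, ∃ K' ⊆ T, IsCapOver o a b L ∧ IsNestedChain o a b True K ∧
      IsNestedChain o a b False K' ∧
      T.card ≤ 2 ^ (K.card + K'.card) * (2 * n) ^ L.card := by
  classical
  have hirr : ∀ q, ¬ InnerTo o a b q q := fun q h => h.1 rfl
  obtain ⟨L, hLT, hL, hLmax⟩ := exists_max_card T (IsCapOver o a b)
    ⟨isMono_of_card_le_two (by simp), by simp⟩
  obtain ⟨K, hKT, hK, hKmax⟩ := exists_max_card T (IsNestedChain o a b True)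
    ⟨by simp, by simp⟩
  obtain ⟨K', hKT', hK', hKmax'⟩ := exists_max_card T (IsNestedChain o a b False)
    ⟨by simp, by simp⟩
  refine ⟨L, hLT, K, hKT, K', hKT', hL, hK, hK', ?_⟩
  apply card_le_of_chains_of_antichains (InnerTo o a b) _ _ T (fun p _ => hirr p)
    fun p hp q hq r hr h h' => (hT p hp).inner_trans ho hac hdb (hT q hq) (hT r hr) h h'
  · intro C hCT hch
    rcases C.eq_empty_or_nonempty with rfl | ⟨x, hx⟩
    · simp
    -- Singletons show that `K` and `K'` are nonempty, so the truncated subtractions below are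
    -- exact. The cups-caps theorem along a longer chain would give a nested chain with one element
    -- more than `K` or `K'`.
    have h1 := hKmax {x} (by simpa using hCT hx) (isNestedChain_singleton _ hirr)
    have h2 := hKmax' {x} (by simpa using hCT hx) (isNestedChain_singleton _ hirr)
    rw [Finset.card_singleton] at h1 h2
    by_contra! hlt
    have h3 : (K.card - 1 + (K'.card - 1)).choose (K.card - 1) < C.card := by
      refine lt_of_le_of_lt ?_ hlt
      exact (Nat.choose_le_two_pow _ _).trans (Nat.pow_le_pow_right two_pos (by omega))
    rcases exists_isNestedChain ho hac hdb (fun z hz => hT z (hCT hz)) hch _ _ h3 with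
      ⟨J, hJ, hJc, hJn⟩ | ⟨J, hJ, hJc, hJn⟩
    · have := hKmax J (hJ.trans hCT) hJn
      omega
    · have := hKmax' J (hJ.trans hCT) hJn
      omega
  · intro A hAT hA
    rcases A.eq_empty_or_nonempty with rfl | ⟨x, hx⟩
    · simp
    have h1 := hLmax {x} (by simpa using hAT hx)
      ⟨isMono_of_card_le_two (by simp), by simp⟩
    rw [Finset.card_singleton] at h1
    have hLn : L.card < n := by
      by_contra! h
      obtain ⟨Q, hQ, hQn⟩ := Finset.exists_subset_card_eq h
      exact hconv Q hQn (ho.isConvexSet_of_isMono_true (hL.mono.subset hQ))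
    by_contra! hlt
    have h3 : (L.card - 1 + (n - 2)).choose (L.card - 1) < A.card := by
      refine lt_of_le_of_lt ?_ hlt
      calc (L.card - 1 + (n - 2)).choose (L.card - 1) ≤ (L.card - 1 + (n - 2)) ^ (L.card - 1) :=
            Nat.choose_le_pow _ _
        _ ≤ (2 * n) ^ (L.card - 1) := Nat.pow_le_pow_left (by omega) _
        _ ≤ (2 * n) ^ L.card := Nat.pow_le_pow_right (by omega) (by omega)
    -- A cap of size `L.card + 1` in the antichain contradicts the choice of `L`; a cup of size `n`
    -- is a convex set.
    rcases ho.isTransitiveColoring.exists_isMono _ _ A h3 with ⟨J, hJ, hJc, hJm⟩ | ⟨J, hJ, hJc, hJm⟩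
    · have := hLmax J (hJ.trans hAT) ⟨hJm, fun p hp q hq hpq =>
        (hT p (hAT (hJ hp))).cap_of_not_inner ho hac hdb (hT q (hAT (hJ hq))) hpq
          (hA p (hJ hp) q (hJ hq)) (hA q (hJ hq) p (hJ hp))⟩
      omega
    · exact hconv J (by omega) (ho.isConvexSet_of_isMono_false hJm)

/-- A clockwise nested chain and a counterclockwise one in the next cell are in convex position. -/
theorem isConvexSet_union {K K' : Finset α} (hK : ∀ z ∈ K, InCell o a c d b z)
    (hK' : ∀ z ∈ K', InCell o c d b e z) (hcd : c < d) (hbe : b < e)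
    (h : IsNestedChain o a b True K)
    (h' : IsNestedChain o c e False K') : IsConvexSet o (K ∪ K') := by
  classical
  have hlt : ∀ p ∈ K, ∀ q ∈ K', p < q := fun p hp q hq =>
    (hK p hp).lt_right.trans (hK' q hq).lt_left
  have hnot : ∀ p ∈ K', p ∉ K := fun p hp hpK => lt_irrefl _ (hlt p hpK p hp)
  have n1 : ∀ p ∈ K, ∀ q ∈ K, ∀ z ∈ K', InnerTo o a b p q → o p q z := fun p hp q hq z hz hpq =>
    (hK p hp).inner_next ho hac (hK q hq) hpq (hK' z hz)
  have n2 : ∀ p ∈ K', ∀ q ∈ K', ∀ z ∈ K, InnerTo o c e p q → ¬ o p q z := fun p hp q hq z hz hpq =>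
    (hK' p hp).inner_prev ho hbe (hK' q hq) hpq (hK z hz)
  -- The boundary is traversed outwards along `K` and then inwards along `K'`. Increasing triples
  -- are clockwise by color inside one chain, and by `n1` and `n2` when they use both chains.
  refine ho.isConvexSet_of_rel (fun p q => (p ∈ K ∧ q ∈ K ∧ InnerTo o a b p q) ∨ (p ∈ K ∧ q ∈ K') ∨
    (p ∈ K' ∧ q ∈ K' ∧ InnerTo o c e q p)) ?_ ?_ ?_ ?_
  · intro p hp q hq hpq
    rcases Finset.mem_union.1 hp with hp | hp <;> rcases Finset.mem_union.1 hq with hq | hq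
    · have := h.total p hp q hq hpq
      tauto
    · tauto
    · tauto
    · have := h'.total p hp q hq hpq
      tauto
  · rintro p hp q hq r hr (⟨h1, h2, h3⟩ | ⟨h1, h2⟩ | ⟨h1, h2, h3⟩) (⟨h4, h5, h6⟩ | ⟨h4, h5⟩ | ⟨h4, h5, h6⟩)
    · exact .inl ⟨h1, h5, (hK p h1).inner_trans ho hac hdb (hK q h2) (hK r h5) h3 h6⟩
    · tauto
    · exact absurd h2 (hnot q h4)
    · exact absurd h4 (hnot q h2)
    · exact absurd h4 (hnot q h2)
    · tauto
    · exact absurd h4 (hnot q h2)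
    · exact absurd h4 (hnot q h2)
    · exact .inr (.inr ⟨h1, h5, (hK' r h5).inner_trans ho hcd hbe (hK' q h2) (hK' p h1) h6 h3⟩)
  · rintro p hp (⟨-, -, h1⟩ | ⟨h1, h2⟩ | ⟨-, -, h1⟩)
    · exact h1.1 rfl
    · exact hnot p h2 h1
    · exact h1.1 rfl
  · rintro p hp q hq r hr (⟨h1, h2, h3⟩ | ⟨h1, h2⟩ | ⟨h1, h2, h3⟩) (⟨h4, h5, h6⟩ | ⟨h4, h5⟩ | ⟨h4, h5, h6⟩)
    · exact of_iff_true (h.color p h1 q h2 r h5 h3 h6)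
    · exact n1 p h1 q h2 r h5 h3
    · exact absurd h2 (hnot q h4)
    · exact absurd h4 (hnot q h2)
    · exact absurd h4 (hnot q h2)
    · have h7 := n2 r h5 q h4 p h1 h6
      have hpq := hlt p h1 q h2
      have hpr := hlt p h1 r h5
      rw [ho.rot hpq.ne h6.1.symm hpr.ne]
      exact (ho.swap r q p h6.1 hpq.ne' hpr.ne').2 h7
    · exact absurd h4 (hnot q h2)
    · exact absurd h4 (hnot q h2)
    · have h7 := not_of_iff_false (h'.color r h5 q h2 p h1 h6 h3)
      have hpr : p ≠ r := ((hK' r h5).inner_trans ho hcd hbe (hK' q h2) (hK' p h1) h6 h3).1.symm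
      rw [ho.rot h3.1.symm h6.1.symm hpr]
      exact (ho.swap r q p h6.1 h3.1 hpr.symm).2 h7

end Cell

/-! ### Combining the cells along a cap -/

/-- `y 0, …, y (m - 1)` is an increasing sequence that forms a cap. -/
structure IsCapSeq {α : Type*} [LinearOrder α] (o : α → α → α → Prop) (y : ℕ → α) (m : ℕ) :
    Prop where
  lt : ∀ i j, i < j → j < m → y i < y j
  cap : ∀ i j l, i < j → j < l → l < m → o (y i) (y j) (y l)

/-- `z` is in the cell of the cap `y` above the edge from `y (j + 1)` to `y (j + 2)`. -/
def InCellSeq {α : Type*} [LinearOrder α] (o : α → α → α → Prop) (y : ℕ → α) (j : ℕ) (z : α) :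
    Prop :=
  InCell o (y j) (y (j + 1)) (y (j + 2)) (y (j + 3)) z

section CapSeq

variable {α : Type*} [LinearOrder α] {o : α → α → α → Prop} (ho : IsOrientation o)
  {y : ℕ → α} {m i j l u v w : ℕ} {p q r z : α} (hy : IsCapSeq o y m)

include ho hy

theorem InCellSeq.cap_after (hz : InCellSeq o y i z) (hv : i + 2 ≤ v) (hvw : v < w) (hw : w < m) :
    o z (y v) (y w) := by
  have h1 : o z (y (i + 2)) (y (i + 3)) := hz.right
  have hlt : z < y (i + 2) := hz.lt_right
  have h2 : ∀ w, i + 2 < w → w < m → o z (y (i + 2)) (y w) := by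
    intro w hiw hw
    rcases (show i + 3 ≤ w from hiw).eq_or_lt with rfl | h
    · exact h1
    · exact (ho.isTransitiveColoring z _ _ _ hlt (hy.lt _ _ (by omega) (by omega))
        (hy.lt _ _ h hw) (iff_of_true h1 (hy.cap _ _ _ (by omega) h hw))).1.1 h1
  rcases hv.eq_or_lt with rfl | h
  · exact h2 w hvw hw
  · have h3 := h2 v h (by omega)
    exact (ho.isTransitiveColoring z _ _ _ hlt (hy.lt _ _ h (by omega))
        (hy.lt _ _ hvw hw) (iff_of_true h3 (hy.cap _ _ _ h hvw hw))).2.1 h3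

theorem InCellSeq.cap_before (hz : InCellSeq o y i z) (hv : v ≤ i + 1) (huv : u < v)
    (hi : i + 1 < m) : o (y u) (y v) z := by
  have h1 : o (y i) (y (i + 1)) z := hz.left
  have hlt : y (i + 1) < z := hz.lt_left
  have h2 : ∀ u, u < i + 1 → o (y u) (y (i + 1)) z := by
    intro u hu
    rcases (show u ≤ i from Nat.lt_succ_iff.1 hu).eq_or_lt with rfl | h
    · exact h1
    · have h3 := hy.cap u i (i + 1) h (by omega) hi
      exact (ho.isTransitiveColoring _ _ _ z (hy.lt _ _ h (by omega))
        (hy.lt _ _ (by omega) hi) hlt (iff_of_true h3 h1)).2.1 h3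
  rcases hv.eq_or_lt with rfl | h
  · exact h2 u huv
  · have h3 := hy.cap u v (i + 1) huv h hi
    exact (ho.isTransitiveColoring _ _ _ z (hy.lt _ _ huv (by omega))
        (hy.lt _ _ h hi) hlt (iff_of_true h3 (h2 v h))).1.1 h3

omit ho in
theorem InCellSeq.lt_of_le (hz : InCellSeq o y i z) (hv : i + 2 ≤ v) (hvm : v < m) : z < y v := by
  have h : z < y (i + 2) := hz.lt_right
  rcases hv.eq_or_lt with rfl | h'
  · exact h
  · exact h.trans (hy.lt _ _ h' hvm)

omit ho in
theorem InCellSeq.gt_of_le (hz : InCellSeq o y i z) (hv : v ≤ i + 1) (hi : i + 1 < m) :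
    y v < z := by
  have h : y (i + 1) < z := hz.lt_left
  rcases hv.eq_or_lt with rfl | h'
  · exact h
  · exact (hy.lt _ _ h' hi).trans h

/-- The points of the cap that lie between two non-adjacent cells link points of these cells by
transitivity; between adjacent cells there are not enough of them. -/
theorem InCellSeq.cap_between (hp : InCellSeq o y i p) (hq : InCellSeq o y j q) (hij : i + 2 ≤ j)
    (hj : j + 1 < m) (hv : i + 2 ≤ v) (hvj : v ≤ j + 1) : o p (y v) q := by
  rcases hvj.eq_or_lt with rfl | h
  · have h1 := hp.cap_after ho hy hij (Nat.lt_succ_self j) hj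
    have h2 := hq.cap_before ho hy le_rfl (Nat.lt_succ_self j) hj
    exact (ho.isTransitiveColoring _ _ _ _ (hp.lt_of_le hy hij (by omega))
      (hy.lt _ _ (Nat.lt_succ_self j) hj) (hq.gt_of_le hy le_rfl hj) (iff_of_true h1 h2)).2.1 h1
  · have h1 := hp.cap_after ho hy hv h hj
    have h2 := hq.cap_before ho hy le_rfl h hj
    exact (ho.isTransitiveColoring _ _ _ _ (hp.lt_of_le hy hv (by omega))
      (hy.lt _ _ h hj) (hq.gt_of_le hy le_rfl hj) (iff_of_true h1 h2)).1.1 h1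

omit ho in
theorem InCellSeq.lt_of_lt (hp : InCellSeq o y i p) (hq : InCellSeq o y j q) (hij : i < j)
    (hj : j + 1 < m) : p < q :=
  (hp.lt_of_le hy (show i + 2 ≤ j + 1 by omega) hj).trans (hq.gt_of_le hy le_rfl hj)

omit ho in
theorem InCellSeq.le_of_lt (hp : InCellSeq o y i p) (hq : InCellSeq o y j q) (hpq : p < q)
    (hi : i + 1 < m) : i ≤ j := by
  by_contra! h
  exact hpq.not_gt (hq.lt_of_lt hy hp h hi)

/-- Caps in cells that are not adjacent form a cap together. -/
theorem isMono_biUnion_of_isCapOver {I : Finset ℕ} {S : ℕ → Finset α}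
    (hI : ∀ i ∈ I, ∀ j ∈ I, i < j → i + 2 ≤ j) (hIm : ∀ i ∈ I, i + 3 < m)
    (hS : ∀ i ∈ I, ∀ z ∈ S i, InCellSeq o y i z)
    (hcap : ∀ i ∈ I, IsCapOver o (y i) (y (i + 3)) (S i)) : IsMono o True (I.biUnion S) := by
  intro p hp q hq r hr hpq hqr
  obtain ⟨i, hi, hp⟩ := Finset.mem_biUnion.1 hp
  obtain ⟨j, hj, hq⟩ := Finset.mem_biUnion.1 hq
  obtain ⟨l, hl, hr⟩ := Finset.mem_biUnion.1 hr
  have him := hIm i hi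
  have hjm := hIm j hj
  have hlm := hIm l hl
  have cp := hS i hi p hp
  have cq := hS j hj q hq
  have cr := hS l hl r hr
  apply iff_true_intro
  rcases (cp.le_of_lt hy cq hpq (by omega)).eq_or_lt with rfl | hij <;>
    rcases (cq.le_of_lt hy cr hqr (by omega)).eq_or_lt with rfl | hjl
  · exact of_iff_true ((hcap i hi).mono p hp q hq r hr hpq hqr)
  · have h2 := hI i hi l hl hjl
    have h1 := ((hcap i hi).ends p hp q hq hpq).2
    have h3 := cq.cap_between ho hy cr h2 (by omega) (show i + 2 ≤ i + 3 by omega) (by omega)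
    exact (ho.isTransitiveColoring _ _ _ _ hpq (cq.lt_of_le hy (by omega) (by omega))
      (cr.gt_of_le hy (by omega) (by omega)) (iff_of_true h1 h3)).1.1 h1
  · have h2 := hI i hi j hj hij
    have h1 := ((hcap j hj).ends q hq r hr hqr).1
    have h3 := cp.cap_between ho hy cq h2 (by omega) h2 (by omega)
    exact (ho.isTransitiveColoring _ _ _ _ (cp.lt_of_le hy h2 (by omega))
      (cq.gt_of_le hy (by omega) (by omega)) hqr (iff_of_true h3 h1)).2.1 h3
  · have h2 := hI i hi j hj hij
    have h3 := hI j hj l hl hjl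
    -- For points in three cells the edge below `q` is the link: `p`, `y (j + 1)`, `q`, `y (j + 2)`
    -- is a cap, and then so is `p`, `q`, `y (j + 2)`, `r`.
    have k₁ := cp.cap_between ho hy cq h2 (by omega) (show i + 2 ≤ j + 1 by omega) le_rfl
    have k₂ : o (y (j + 1)) q (y (j + 2)) := cq.mid
    have k₃ := cq.cap_between ho hy cr h3 (by omega) le_rfl (by omega)
    have l₁ := cp.lt_of_le hy (show i + 2 ≤ j + 1 by omega) (by omega)
    have l₂ := cq.gt_of_le hy le_rfl (by omega)
    have l₃ := cq.lt_of_le hy le_rfl (by omega)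
    have k₄ := (ho.isTransitiveColoring _ _ _ _ l₁ l₂ l₃ (iff_of_true k₁ k₂)).2.1 k₁
    exact (ho.isTransitiveColoring _ _ _ _ hpq l₃
      (cr.gt_of_le hy (by omega) (by omega)) (iff_of_true k₄ k₃)).1.1 k₄

theorem sum_card_lt_of_isCapOver {n : ℕ} (hconv : ∀ Q : Finset α, Q.card = n → ¬ IsConvexSet o Q)
    {I : Finset ℕ} {S : ℕ → Finset α}
    (hI : ∀ i ∈ I, ∀ j ∈ I, i < j → i + 2 ≤ j) (hIm : ∀ i ∈ I, i + 3 < m)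
    (hS : ∀ i ∈ I, ∀ z ∈ S i, InCellSeq o y i z)
    (hcap : ∀ i ∈ I, IsCapOver o (y i) (y (i + 3)) (S i)) : ∑ i ∈ I, (S i).card < n := by
  have hm := isMono_biUnion_of_isCapOver ho hy hI hIm hS hcap
  have hd : (I : Set ℕ).PairwiseDisjoint S := by
    have key : ∀ i ∈ I, ∀ j ∈ I, i < j → Disjoint (S i) (S j) := by
      intro i hi j hj hij
      rw [Finset.disjoint_left]
      intro p hp hp'
      have := hIm j hj
      exact lt_irrefl p ((hS i hi p hp).lt_of_lt hy (hS j hj p hp') hij (by omega))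
    intro i hi j hj hij
    rcases lt_or_gt_of_ne hij with h | h
    · exact key i hi j hj h
    · exact (key j hj i hi h).symm
  rw [← Finset.card_biUnion hd]
  by_contra! h
  obtain ⟨Q, hQ, hQn⟩ := Finset.exists_subset_card_eq h
  exact hconv Q hQn (ho.isConvexSet_of_isMono_true (hm.subset hQ))

/-- If there are no `n` points in convex position, then the cells of a cap are small on average. -/
theorem prod_card_cells_le {n k : ℕ} (hn : 3 ≤ n) (hm : k + 3 ≤ m)
    (hconv : ∀ Q : Finset α, Q.card = n → ¬ IsConvexSet o Q) {T : ℕ → Finset α}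
    (hT : ∀ j, ∀ z ∈ T j, InCellSeq o y j z) :
    ∏ j ∈ Finset.range k, (T j).card ≤ 2 ^ ((k + 1) * n) * (2 * n) ^ (2 * n) := by
  have hlt : ∀ Q : Finset α, IsConvexSet o Q → Q.card < n := by
    intro Q hQ
    by_contra! h
    obtain ⟨Q', hQ', hQn⟩ := Finset.exists_subset_card_eq h
    exact hconv Q' hQn (hQ.subset hQ')
  have hcell : ∀ j, j < k → ∃ L ⊆ T j, ∃ K ⊆ T j, ∃ K' ⊆ T j, IsCapOver o (y j) (y (j + 3)) L ∧
      IsNestedChain o (y j) (y (j + 3)) True K ∧ IsNestedChain o (y j) (y (j + 3)) False K' ∧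
      (T j).card ≤ 2 ^ (K.card + K'.card) * (2 * n) ^ L.card := fun j hj =>
    exists_card_cell_le ho (hy.lt _ _ (by omega) (by omega)) (hy.lt _ _ (by omega) (by omega))
      (hT j) hn hconv
  choose! L hL K hK K' hK' hLc hKc hKc' hcard using hcell
  -- Cells with indices of the same parity are not adjacent, so the caps in the even cells form one
  -- cap and those in the odd cells another, each with fewer than `n` points.
  have hLsum : ∑ j ∈ Finset.range k, (L j).card ≤ 2 * n := by
    have h0 := Finset.sum_filter_add_sum_filter_not (Finset.range k) Even fun j => (L j).card
    have h1 := sum_card_lt_of_isCapOver ho hy hconv (I := (Finset.range k).filter Even) (S := L)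
      (by
        intro i hi j hj hij
        simp only [Finset.mem_filter, Finset.mem_range] at hi hj
        obtain ⟨i', hi'⟩ := hi.2
        obtain ⟨j', hj'⟩ := hj.2
        omega)
      (by
        intro i hi
        simp only [Finset.mem_filter, Finset.mem_range] at hi
        omega)
      (fun i hi z hz => hT i z (hL i (by simpa using (Finset.mem_filter.1 hi).1) hz))
      (fun i hi => hLc i (by simpa using (Finset.mem_filter.1 hi).1))
    have h2 := sum_card_lt_of_isCapOver ho hy hconv (I := (Finset.range k).filter fun i => ¬ Even i)
      (S := L)
      (by
        intro i hi j hj hij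
        simp only [Finset.mem_filter, Finset.mem_range, Nat.not_even_iff_odd] at hi hj
        obtain ⟨i', hi'⟩ := hi.2
        obtain ⟨j', hj'⟩ := hj.2
        omega)
      (by
        intro i hi
        simp only [Finset.mem_filter, Finset.mem_range] at hi
        omega)
      (fun i hi z hz => hT i z (hL i (by simpa using (Finset.mem_filter.1 hi).1) hz))
      (fun i hi => hLc i (by simpa using (Finset.mem_filter.1 hi).1))
    rw [← h0, two_mul]
    exact add_le_add h1.le h2.le
  have hstep : ∀ j, j + 1 < k → (K j).card + (K' (j + 1)).card < n := by
    intro j hj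
    have h1 := hlt _ (isConvexSet_union ho (hy.lt j (j + 1) (by omega) (by omega))
      (hy.lt (j + 2) (j + 3) (by omega) (by omega)) (fun z hz => hT j z (hK j (by omega) hz))
      (fun z hz => hT (j + 1) z (hK' (j + 1) hj hz)) (hy.lt (j + 1) (j + 2) (by omega) (by omega))
      (hy.lt (j + 3) (j + 4) (by omega) (by omega)) (hKc j (by omega)) (hKc' (j + 1) hj))
    rwa [Finset.card_union_of_disjoint] at h1
    rw [Finset.disjoint_left]
    intro p hp hp'
    exact lt_irrefl p ((hT j p (hK j (by omega) hp)).lt_of_lt hy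
      (hT (j + 1) p (hK' (j + 1) hj hp')) (Nat.lt_succ_self j) (by omega))
  have hends : ∀ j, j < k → (K j).card < n ∧ (K' j).card < n := by
    intro j hj
    have hac := hy.lt j (j + 1) (by omega) (by omega)
    have hcd := hy.lt (j + 1) (j + 2) (by omega) (by omega)
    have hdb := hy.lt (j + 2) (j + 3) (by omega) (by omega)
    have hirr : ∀ (K : Finset α), (∀ z ∈ K, InCellSeq o y j z) → ∀ (t : Prop),
        IsNestedChain o (y j) (y (j + 3)) t K → (∀ p ∈ K, ∀ q ∈ K, ∀ r ∈ K,
          InnerTo o (y j) (y (j + 3)) p q → InnerTo o (y j) (y (j + 3)) q r →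
          InnerTo o (y j) (y (j + 3)) p r) := fun K h t _ p hp q hq r hr h1 h2 =>
      (h p hp).inner_trans ho hac hdb (h q hq) (h r hr) h1 h2
    have c1 : ∀ z ∈ K j, InCellSeq o y j z := fun z hz => hT j z (hK j hj hz)
    have c2 : ∀ z ∈ K' j, InCellSeq o y j z := fun z hz => hT j z (hK' j hj hz)
    constructor
    · exact hlt _ (ho.isConvexSet_of_rel _ (hKc j hj).total (hirr _ c1 _ (hKc j hj))
        (fun p _ h => h.1 rfl) fun p hp q hq r hr h1 h2 =>
          of_iff_true ((hKc j hj).color p hp q hq r hr h1 h2))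
    · refine hlt _ (.of_neg ho (ho.neg.isConvexSet_of_rel _ (hKc' j hj).total
        (hirr _ c2 _ (hKc' j hj)) (fun p _ h => h.1 rfl) fun p hp q hq r hr h1 h2 =>
          not_of_iff_false ((hKc' j hj).color p hp q hq r hr h1 h2)))
  have hchain : ∑ j ∈ Finset.range k, ((K j).card + (K' j).card) ≤ (k + 1) * n := by
    -- Pairing `K j` with `K' (j + 1)` leaves only `K' 0` and the last `K` unpaired. Each of these
    -- is convex by itself, which gives `k + 1` summands below `n`.
    have key : ∀ l, l < k → ∑ j ∈ Finset.range (l + 1), ((K j).card + (K' j).card) ≤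
        (l + 1) * n + (K l).card := by
      intro l
      induction l with
      | zero =>
        intro h
        have := hends 0 h
        simp only [zero_add, Finset.sum_range_one, one_mul]
        omega
      | succ l ih =>
        intro h
        have h1 := ih (by omega)
        have h2 := hstep l h
        rw [Finset.sum_range_succ, add_mul (l + 1), one_mul]
        omega
    rcases k with _ | k
    · simp
    · have h1 := key k (by omega)
      have h2 := hends k (by omega)
      rw [add_mul (k + 1), one_mul]
      omega
  calc ∏ j ∈ Finset.range k, (T j).card
      ≤ ∏ j ∈ Finset.range k, (2 ^ ((K j).card + (K' j).card) * (2 * n) ^ (L j).card) :=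
        Finset.prod_le_prod' fun j hj => hcard j (Finset.mem_range.1 hj)
    _ = 2 ^ (∑ j ∈ Finset.range k, ((K j).card + (K' j).card)) *
          (2 * n) ^ (∑ j ∈ Finset.range k, (L j).card) := by
        rw [Finset.prod_mul_distrib, Finset.prod_pow_eq_pow_sum, Finset.prod_pow_eq_pow_sum]
    _ ≤ 2 ^ ((k + 1) * n) * (2 * n) ^ (2 * n) := by
        gcongr
        · norm_num
        · omega

end CapSeq

/-! ### Supersaturation and the number of caps -/

/-- Supersaturation: if every set of `M` elements contains a member of the family `G` of sets of
`L` elements, then `G` is large. -/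
theorem pow_le_card_mul_pow {α : Type*} [Fintype α] [DecidableEq α] {L M : ℕ}
    (G : Finset (Finset α)) (hG : ∀ S ∈ G, S.card = L) (hLM : L ≤ M) (hM : M ≤ Fintype.card α)
    (h : ∀ X : Finset α, X.card = M → ∃ S ∈ G, S ⊆ X) :
    (Fintype.card α + 1 - L) ^ L ≤ G.card * M ^ L := by
  set N := Fintype.card α with hN
  -- Double counting of the pairs of a set `X` of size `M` and a member `S` of `G` inside it.
  have h1 : N.choose M ≤ G.card * (N - L).choose (M - L) := by
    have h2 := Finset.card_mul_le_card_mul (s := Finset.powersetCard M (Finset.univ : Finset α))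
      (t := G) (fun X S => S ⊆ X) (m := 1) (n := (N - L).choose (M - L)) ?_ ?_
    · rwa [mul_one, Finset.card_powersetCard, Finset.card_univ, ← hN] at h2
    · intro X hX
      obtain ⟨S, hS, hSX⟩ := h X (Finset.mem_powersetCard.1 hX).2
      exact Finset.card_pos.2 ⟨S, Finset.mem_filter.2 ⟨hS, hSX⟩⟩
    · intro S hS
      have h3 : (Finset.powersetCard (M - L) (Finset.univ \ S)).card = (N - L).choose (M - L) := by
        rw [Finset.card_powersetCard, Finset.card_sdiff_of_subset (Finset.subset_univ S),
          Finset.card_univ, hG S hS]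
      rw [← h3]
      refine Finset.card_le_card_of_injOn (fun X => X \ S) ?_ ?_
      · intro X hX
        obtain ⟨hX, hSX⟩ := Finset.mem_filter.1 (Finset.mem_coe.1 hX)
        refine Finset.mem_coe.2 (Finset.mem_powersetCard.2
          ⟨Finset.sdiff_subset_sdiff (Finset.subset_univ X) le_rfl, ?_⟩)
        rw [Finset.card_sdiff_of_subset hSX, hG S hS, (Finset.mem_powersetCard.1 hX).2]
      · intro X hX Y hY hXY
        have hSX := (Finset.mem_filter.1 (Finset.mem_coe.1 hX)).2
        have hSY := (Finset.mem_filter.1 (Finset.mem_coe.1 hY)).2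
        rw [← Finset.sdiff_union_of_subset hSX, ← Finset.sdiff_union_of_subset hSY]
        exact congrArg (· ∪ S) hXY
  have h2 : N.choose L ≤ G.card * M.choose L := by
    have h3 : 0 < (N - L).choose (M - L) := Nat.choose_pos (by omega)
    refine Nat.le_of_mul_le_mul_right ?_ h3
    rw [← Nat.choose_mul hLM]
    calc N.choose M * M.choose L ≤ G.card * (N - L).choose (M - L) * M.choose L := by gcongr
      _ = _ := by ring
  calc (N + 1 - L) ^ L ≤ N.descFactorial L := Nat.pow_sub_le_descFactorial N L
    _ = L.factorial * N.choose L := Nat.descFactorial_eq_factorial_mul_choose N L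
    _ ≤ L.factorial * (G.card * M.choose L) := by gcongr
    _ = G.card * M.descFactorial L := by rw [Nat.descFactorial_eq_factorial_mul_choose]; ring
    _ ≤ G.card * M ^ L := by gcongr; exact Nat.descFactorial_le_pow M L

section Count

variable {α : Type*} [LinearOrder α] [Fintype α] {o : α → α → α → Prop}

/-- If there are no `n` points in convex position, then there are few caps. -/
theorem card_caps_le (ho : IsOrientation o) {n k : ℕ} (hn : 3 ≤ n)
    (hconv : ∀ Q : Finset α, Q.card = n → ¬ IsConvexSet o Q) (G : Finset (Finset α))
    (hG : ∀ S ∈ G, S.card = 2 * k + 3 ∧ IsMono o True S) :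
    G.card ≤ 2 ^ ((k + 1) * n) * (2 * n) ^ (2 * n) * Fintype.card α ^ (k + 3) := by
  classical
  let W : Finset (Fin (2 * k + 3) → α) := Finset.univ.filter fun w => StrictMono w ∧
    ∀ i j l, i < j → j < l → o (w i) (w j) (w l)
  have hGW : G.card ≤ W.card := by
    refine Finset.card_le_card_of_surjOn (fun w => Finset.univ.image w) ?_
    intro S hS
    obtain ⟨hc, hm⟩ := hG S hS
    refine ⟨S.orderEmbOfFin hc, ?_, ?_⟩
    · refine Finset.mem_coe.2 (Finset.mem_filter.2 ⟨Finset.mem_univ _,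
        (S.orderEmbOfFin hc).strictMono, fun i j l hij hjl => ?_⟩)
      exact of_iff_true (hm _ (S.orderEmbOfFin_mem hc i) _ (S.orderEmbOfFin_mem hc j) _
        (S.orderEmbOfFin_mem hc l) ((S.orderEmbOfFin hc).strictMono hij)
        ((S.orderEmbOfFin hc).strictMono hjl))
    · simp
  -- The frame of a cap with positions 0 to `2 * k + 2` consists of 0, the odd positions and `2 * k
  -- + 2`: truncated subtraction gives the first of these and the minimum the last. The omitted
  -- position `2 * j + 2` lies in cell `j` of the frame.
  let e : Fin (k + 3) → Fin (2 * k + 3) := fun j => ⟨min (2 * j - 1) (2 * k + 2), by omega⟩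
  have he : ∀ i j : Fin (k + 3), i < j → e i < e j := by
    intro i j hij
    rw [Fin.lt_def] at hij ⊢
    have := j.2
    simp only [e]
    omega
  have hcount := Finset.card_le_mul_card_image_of_maps_to (s := W)
    (t := (Finset.univ : Finset (Fin (k + 3) → α))) (f := fun w j => w (e j))
    (fun _ _ => Finset.mem_univ _) (2 ^ ((k + 1) * n) * (2 * n) ^ (2 * n)) ?_
  · rw [Finset.card_univ, Fintype.card_fun, Fintype.card_fin] at hcount
    exact hGW.trans hcount
  intro u _
  rcases Finset.eq_empty_or_nonempty (W.filter fun w => (fun j => w (e j)) = u) with hemp | ⟨w₀, hw₀⟩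
  · rw [hemp]
    simp
  obtain ⟨hw₀W, hw₀u⟩ := Finset.mem_filter.1 hw₀
  obtain ⟨-, hw₀m, hw₀c⟩ := Finset.mem_filter.1 hw₀W
  -- The value beyond the frame is arbitrary: the cells with `j < k` use only indices up to `k + 2`.
  let y : ℕ → α := fun i => if h : i < k + 3 then u ⟨i, h⟩ else u 0
  have hyu : ∀ i (h : i < k + 3), y i = u ⟨i, h⟩ := fun i h => dif_pos h
  have hyw : ∀ w : Fin (2 * k + 3) → α, (fun j => w (e j)) = u → ∀ i (h : i < k + 3), y i = w (e ⟨i, h⟩) :=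
    fun w hw i h => by rw [hyu i h, ← hw]
  have hy : IsCapSeq o y (k + 3) := by
    constructor
    · intro i j hij hj
      rw [hyw w₀ hw₀u i (by omega), hyw w₀ hw₀u j hj]
      exact hw₀m (he _ _ (Fin.lt_def.2 hij))
    · intro i j l hij hjl hl
      rw [hyw w₀ hw₀u i (by omega), hyw w₀ hw₀u j (by omega), hyw w₀ hw₀u l hl]
      exact hw₀c _ _ _ (he _ _ (Fin.lt_def.2 hij)) (he _ _ (Fin.lt_def.2 hjl))
  let T : ℕ → Finset α := fun j => Finset.univ.filter fun z => InCellSeq o y j z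
  refine le_trans ?_ (prod_card_cells_le ho hy hn le_rfl hconv (T := T) fun j z hz =>
    (Finset.mem_filter.1 hz).2)
  rw [← Fin.prod_univ_eq_prod_range (fun j => (T j).card) k,
    ← Fintype.card_piFinset (fun j : Fin k => T j)]
  -- Once the frame `u` is fixed, a cap is determined by its `k` points in the cells.
  refine Finset.card_le_card_of_injOn (fun w (j : Fin k) => w ⟨2 * j + 2, by omega⟩) ?_ ?_
  · intro w hw
    obtain ⟨hwW, hwu⟩ := Finset.mem_filter.1 (Finset.mem_coe.1 hw)
    obtain ⟨-, hwm, hwc⟩ := Finset.mem_filter.1 hwW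
    refine Finset.mem_coe.2 (Fintype.mem_piFinset.2 fun j => Finset.mem_filter.2
      ⟨Finset.mem_univ _, ?_⟩)
    have hj := j.2
    rw [InCellSeq, hyw w hwu j (by omega), hyw w hwu (j + 1) (by omega),
      hyw w hwu (j + 2) (by omega), hyw w hwu (j + 3) (by omega)]
    have l₀ : e ⟨j, by omega⟩ < e ⟨j + 1, by omega⟩ := he _ _ (Fin.lt_def.2 (Nat.lt_succ_self _))
    have l₁ : e ⟨j + 1, by omega⟩ < ⟨2 * j + 2, by omega⟩ := by
      rw [Fin.lt_def]
      simp only [e]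
      omega
    have l₂ : (⟨2 * j + 2, by omega⟩ : Fin (2 * k + 3)) < e ⟨j + 2, by omega⟩ := by
      rw [Fin.lt_def]
      simp only [e]
      omega
    have l₃ : e ⟨j + 2, by omega⟩ < e ⟨j + 3, by omega⟩ := he _ _ (Fin.lt_def.2 (Nat.lt_succ_self _))
    exact ⟨hwm l₁, hwm l₂, hwc _ _ _ l₀ l₁, hwc _ _ _ l₁ l₂, hwc _ _ _ l₂ l₃⟩
  · intro w hw w' hw' hww
    obtain ⟨-, hwu⟩ := Finset.mem_filter.1 (Finset.mem_coe.1 hw)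
    obtain ⟨-, hwu'⟩ := Finset.mem_filter.1 (Finset.mem_coe.1 hw')
    have h1 : ∀ j : Fin (k + 3), w (e j) = w' (e j) := fun j => congrFun (hwu.trans hwu'.symm) j
    have h2 : ∀ j : Fin k, w ⟨2 * j + 2, by omega⟩ = w' ⟨2 * j + 2, by omega⟩ := congrFun hww
    funext i
    have hi := i.2
    by_cases hc : (i : ℕ) % 2 = 0 ∧ 2 ≤ (i : ℕ) ∧ (i : ℕ) ≤ 2 * k
    · have h3 := h2 ⟨(i - 2) / 2, by omega⟩
      have h4 : (⟨2 * (((i : ℕ) - 2) / 2) + 2, by omega⟩ : Fin (2 * k + 3)) = i :=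
        Fin.ext (show 2 * (((i : ℕ) - 2) / 2) + 2 = i by omega)
      simpa only [h4] using h3
    · have h3 := h1 ⟨(i + 1) / 2 + if (i : ℕ) = 2 * k + 2 then 1 else 0, by
        split_ifs <;> omega⟩
      have h4 : e ⟨(i + 1) / 2 + if (i : ℕ) = 2 * k + 2 then 1 else 0, by
          split_ifs <;> omega⟩ = i := by
        apply Fin.ext
        simp only [e]
        split_ifs <;> omega
      rwa [h4] at h3

/-- The combinatorial core: a bound for the number of points without `n` of them in convex
position, in terms of a parameter `k`. -/
theorem pow_le_of_forall_not_isConvexSet (ho : IsOrientation o) {n k : ℕ} (hn : 3 ≤ n)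
    (hconv : ∀ Q : Finset α, Q.card = n → ¬ IsConvexSet o Q)
    (hN : 4 ^ (2 * k + 3) ≤ Fintype.card α) :
    (Fintype.card α + 1 - (2 * k + 3)) ^ (2 * k + 3) ≤
      2 * (2 ^ ((k + 1) * n) * (2 * n) ^ (2 * n) * Fintype.card α ^ (k + 3)) *
        (4 ^ (2 * k + 3)) ^ (2 * k + 3) := by
  classical
  let G₁ := (Finset.powersetCard (2 * k + 3) (Finset.univ : Finset α)).filter (IsMono o True)
  let G₂ := (Finset.powersetCard (2 * k + 3) (Finset.univ : Finset α)).filter (IsMono o False)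
  have h₁ : G₁.card ≤ 2 ^ ((k + 1) * n) * (2 * n) ^ (2 * n) * Fintype.card α ^ (k + 3) := by
    refine card_caps_le ho hn hconv G₁ fun S hS => ?_
    obtain ⟨hS, hm⟩ := Finset.mem_filter.1 hS
    exact ⟨(Finset.mem_powersetCard.1 hS).2, hm⟩
  have h₂ : G₂.card ≤ 2 ^ ((k + 1) * n) * (2 * n) ^ (2 * n) * Fintype.card α ^ (k + 3) := by
    refine card_caps_le ho.neg hn (fun Q hQ h => hconv Q hQ (.of_neg ho h)) G₂ fun S hS => ?_
    obtain ⟨hS, hm⟩ := Finset.mem_filter.1 hS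
    exact ⟨(Finset.mem_powersetCard.1 hS).2, by simpa using hm.neg⟩
  have hL : 2 * k + 3 ≤ 4 ^ (2 * k + 3) := (Nat.lt_pow_self (by norm_num)).le
  refine (pow_le_card_mul_pow (G₁ ∪ G₂) ?_ hL hN ?_).trans ?_
  · intro S hS
    rcases Finset.mem_union.1 hS with hS | hS <;>
      exact (Finset.mem_powersetCard.1 (Finset.mem_filter.1 hS).1).2
  · intro X hX
    have h3 : (2 * k + 1 + (2 * k + 1)).choose (2 * k + 1) < X.card := by
      rw [hX]
      calc (2 * k + 1 + (2 * k + 1)).choose (2 * k + 1) ≤ 2 ^ (2 * k + 1 + (2 * k + 1)) :=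
            Nat.choose_le_two_pow _ _
        _ < 2 ^ (2 * (2 * k + 3)) := Nat.pow_lt_pow_right one_lt_two (by omega)
        _ = 4 ^ (2 * k + 3) := by rw [pow_mul]; norm_num
    rcases ho.isTransitiveColoring.exists_isMono _ _ X h3 with ⟨C, hCX, hC, hm⟩ | ⟨C, hCX, hC, hm⟩
    · exact ⟨C, Finset.mem_union_left _ (Finset.mem_filter.2 ⟨Finset.mem_powersetCard.2
        ⟨Finset.subset_univ C, hC⟩, hm⟩), hCX⟩
    · exact ⟨C, Finset.mem_union_right _ (Finset.mem_filter.2 ⟨Finset.mem_powersetCard.2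
        ⟨Finset.subset_univ C, hC⟩, hm⟩), hCX⟩
  · refine Nat.mul_le_mul_right _ ((Finset.card_union_le _ _).trans ?_)
    rw [two_mul]
    exact add_le_add h₁ h₂

end Count

/-! ### The numerical bound -/

/-- Replacing `A + 1 - L` by `A / 2` costs a factor `2 ^ L`. As `L = 2 * k + 3`, the factor `A ^ (k
+ 3)` from the choice of the frame then cancels and leaves `A ^ k`. -/
theorem card_pow_le {α : Type*} [LinearOrder α] [Fintype α] {o : α → α → α → Prop}
    (ho : IsOrientation o) {n k : ℕ} (hn : 3 ≤ n)
    (hconv : ∀ Q : Finset α, Q.card = n → ¬ IsConvexSet o Q)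
    (hN : 4 ^ (2 * k + 3) ≤ Fintype.card α) :
    Fintype.card α ^ k ≤
      2 ^ (k * n + n + (2 * k + 3) + 1 + 2 * (2 * k + 3) ^ 2) * (2 * n) ^ (2 * n) := by
  have h := pow_le_of_forall_not_isConvexSet ho hn hconv hN
  set A := Fintype.card α
  set L := 2 * k + 3 with hL
  have hLA : 2 * L ≤ A := by
    refine le_trans ?_ hN
    calc 2 * L ≤ 2 * 2 ^ L := by gcongr; exact Nat.lt_two_pow_self.le
      _ = 2 ^ (L + 1) := by ring
      _ ≤ 2 ^ (2 * L) := Nat.pow_le_pow_right two_pos (by omega)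
      _ = 4 ^ L := by rw [pow_mul]; norm_num
  have hA : 0 < A := by omega
  have h1 : A ^ L ≤ 2 ^ L * (A + 1 - L) ^ L := by
    rw [← mul_pow]
    exact Nat.pow_le_pow_left (by omega) L
  refine Nat.le_of_mul_le_mul_right (c := A ^ (k + 3)) ?_ (by positivity)
  calc A ^ k * A ^ (k + 3) = A ^ L := by rw [← pow_add]; congr 1; omega
    _ ≤ 2 ^ L * (2 * (2 ^ ((k + 1) * n) * (2 * n) ^ (2 * n) * A ^ (k + 3)) * (4 ^ L) ^ L) :=
      h1.trans (Nat.mul_le_mul_left _ h)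
    _ = _ := by
      have : (4 : ℕ) ^ L = 2 ^ (2 * L) := by rw [pow_mul]; norm_num
      rw [this, ← pow_mul]
      ring

/-- Of the two extra points, one is the extreme point `v` removed from the configuration; the other
absorbs the rounding down in `pseudoESProperty_floor`. -/
theorem card_add_two_le {α : Type*} [LinearOrder α] [Fintype α] {o : α → α → α → Prop}
    (ho : IsOrientation o) {n : ℕ} (hn : 3 ≤ n)
    (hconv : ∀ Q : Finset α, Q.card = n → ¬ IsConvexSet o Q) :
    (Fintype.card α + 2 : ℝ) ≤ 2 ^ ((n : ℝ) + 100 * √(n * Real.log n)) := by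
  have hn' : (3 : ℝ) ≤ n := by exact_mod_cast hn
  have hlog : 1 ≤ Real.log n := by
    rw [Real.le_log_iff_exp_le (by linarith)]
    linarith [Real.exp_one_lt_d9]
  set s := √(n * Real.log n) with hs
  have hs2 : s ^ 2 = n * Real.log n := Real.sq_sqrt (by positivity)
  have hns : (n : ℝ) ≤ s ^ 2 := by rw [hs2]; nlinarith
  have hs1 : 1 ≤ s := by
    rw [hs]
    exact Real.one_le_sqrt.2 (by nlinarith)
  -- After taking the `k`-th root, the exponent exceeds `n` by terms of order `n log n / k` and `k`,
  -- which this choice balances.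
  set k := ⌈s⌉₊ with hk
  have hks : s ≤ k := Nat.le_ceil s
  have hks' : (k : ℝ) ≤ s + 1 := (Nat.ceil_lt_add_one (by linarith)).le
  have hk2 : 2 ≤ k := by
    have : (1 : ℝ) < k := by
      refine lt_of_lt_of_le ?_ hks
      rw [hs]
      exact Real.lt_sqrt_of_sq_lt (by nlinarith)
    exact_mod_cast this
  have hk2' : (2 : ℝ) ≤ k := by exact_mod_cast hk2
  set A := Fintype.card α
  by_cases hA : 4 ^ (2 * k + 3) ≤ A
  · have h1 := card_pow_le ho hn hconv hA
    have hA2 : 4 ≤ A := le_trans (by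
      calc 4 = 4 ^ 1 := by norm_num
        _ ≤ 4 ^ (2 * k + 3) := Nat.pow_le_pow_right (by norm_num) (by omega)) hA
    have hA2' : (4 : ℝ) ≤ A := by exact_mod_cast hA2
    have h2 : (A : ℝ) ^ k ≤
        2 ^ (k * n + n + (2 * k + 3) + 1 + 2 * (2 * k + 3) ^ 2) * (2 * n) ^ (2 * n) := by
      exact_mod_cast h1
    have h3 := Real.log_le_log (by positivity) h2
    rw [Real.log_mul (by positivity) (by positivity), Real.log_pow, Real.log_pow, Real.log_pow,
      Real.log_mul (by norm_num) (by positivity)] at h3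
    push_cast at h3
    have hl2 := Real.log_two_gt_d9
    have h4 : Real.log (A + 2) ≤ Real.log 2 + Real.log A := by
      rw [← Real.log_mul (by norm_num) (by positivity)]
      exact Real.log_le_log (by positivity) (by linarith)
    have hss : s ^ 2 ≤ k * s := by nlinarith
    have hk35 : (2 * k + 3 : ℝ) + 1 + 2 * (2 * k + 3) ^ 2 ≤ 70 * (k * s) := by
      have : (k : ℝ) ≤ 2 * s := by linarith
      nlinarith
    have h5 : (k * n + n + (2 * k + 3) + 1 + 2 * (2 * k + 3) ^ 2 : ℝ) * Real.log 2 +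
        2 * n * (Real.log 2 + Real.log n) ≤ k * ((n + 77 * s) * Real.log 2) := by
      have e1 : 2 * n * Real.log n ≤ 4 * (k * s) * Real.log 2 := by
        have : 2 * n * Real.log n = 2 * s ^ 2 := by rw [hs2]; ring
        rw [this]
        nlinarith
      have e2 : (n + (2 * k + 3) + 1 + 2 * (2 * k + 3) ^ 2 + 2 * n : ℝ) ≤ 73 * (k * s) := by
        linarith
      have e3 := mul_le_mul_of_nonneg_right e2 (show 0 ≤ Real.log 2 by linarith)
      linarith
    have h6 : Real.log A ≤ (n + 77 * s) * Real.log 2 :=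
      le_of_mul_le_mul_left (h3.trans h5) (by linarith)
    have h7 : Real.log (A + 2) ≤ ((n : ℝ) + 100 * s) * Real.log 2 := by nlinarith
    rw [Real.rpow_def_of_pos (by norm_num), mul_comm, ← Real.log_le_iff_le_exp (by positivity)]
    exact h7
  -- With few points the bound is immediate: the exponent `4 * k + 7` is at most a constant multiple
  -- of `s`.
  · push Not at hA
    have h1 : (A + 2 : ℝ) ≤ 2 ^ (2 * (2 * k + 3) + 1) := by
      have h2 : A + 2 ≤ 2 ^ (2 * (2 * k + 3) + 1) := by
        have h3 : (1 : ℕ) ≤ 4 ^ (2 * k + 3) := Nat.one_le_pow _ _ (by norm_num)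
        rw [pow_succ, pow_mul]
        norm_num
        omega
      exact_mod_cast h2
    refine h1.trans ?_
    rw [← Real.rpow_natCast]
    apply Real.rpow_le_rpow_of_exponent_le (by norm_num)
    push_cast
    linarith

/-- The bound for the number of points of a pseudo-configuration. -/
theorem pseudoESProperty_floor {n : ℕ} (hn : 3 ≤ n) :
    PseudoESProperty n ⌊(2 : ℝ) ^ ((n : ℝ) + 100 * √(n * Real.log n))⌋₊ := by
  intro P hP
  have h8 : (8 : ℝ) ≤ 2 ^ ((n : ℝ) + 100 * √(n * Real.log n)) := by
    calc (8 : ℝ) = 2 ^ (3 : ℝ) := by norm_num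
      _ ≤ _ := by
        apply Real.rpow_le_rpow_of_exponent_le (by norm_num)
        have : (3 : ℝ) ≤ n := by exact_mod_cast hn
        linarith [Real.sqrt_nonneg (n * Real.log n)]
  have hP2 : 2 ≤ P.points.card := by
    refine le_trans ?_ hP
    exact Nat.le_floor (by push_cast; linarith)
  obtain ⟨α, _, _, o, ho, hα, hQ⟩ := P.exists_orientation hP2
  by_contra! hc
  have hconv : ∀ Q : Finset α, Q.card = n → ¬ IsConvexSet o Q := by
    intro Q hQn hQc
    obtain ⟨Q', hQ', hQ''⟩ := hQ Q (by omega) hQc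
    exact hc Q' (hQ'.trans hQn) hQ''
  have h1 := card_add_two_le ho hn hconv
  have h2 : (2 : ℝ) ^ ((n : ℝ) + 100 * √(n * Real.log n)) < Fintype.card α + 2 := by
    refine (Nat.lt_floor_add_one _).trans_le ?_
    have : (⌊(2 : ℝ) ^ ((n : ℝ) + 100 * √(n * Real.log n))⌋₊ : ℝ) ≤ Fintype.card α + 1 := by
      exact_mod_cast hP.trans hα.ge
    linarith
  linarith

/-! ### Straight lines as pseudolines -/

/-- Twice the signed area of the triangle `p`, `q`, `r`. -/
def area (p q r : Plane) : ℝ := (q 0 - p 0) * (r 1 - p 1) - (q 1 - p 1) * (r 0 - p 0)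

theorem plane_ext {p q : Plane} (h₀ : p 0 = q 0) (h₁ : p 1 = q 1) : p = q := by
  ext i
  fin_cases i <;> assumption

theorem exists_eq_of_area_eq_zero {p q x : Plane} (hpq : p ≠ q) (h : area p q x = 0) :
    ∃ t : ℝ, AffineMap.lineMap p q t = x := by
  have hne : (q 0 - p 0) ^ 2 + (q 1 - p 1) ^ 2 ≠ 0 := by
    intro h0
    apply hpq
    have h1 : q 0 - p 0 = 0 := by nlinarith [sq_nonneg (q 0 - p 0), sq_nonneg (q 1 - p 1)]
    have h2 : q 1 - p 1 = 0 := by nlinarith [sq_nonneg (q 0 - p 0), sq_nonneg (q 1 - p 1)]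
    exact plane_ext (by linarith) (by linarith)
  unfold area at h
  refine ⟨((x 0 - p 0) * (q 0 - p 0) + (x 1 - p 1) * (q 1 - p 1)) /
    ((q 0 - p 0) ^ 2 + (q 1 - p 1) ^ 2), plane_ext ?_ ?_⟩
  · simp only [AffineMap.lineMap_apply, vsub_eq_sub, vadd_eq_add, PiLp.add_apply, PiLp.smul_apply,
      PiLp.sub_apply, smul_eq_mul]
    field_simp
    linear_combination (q 1 - p 1) * h
  · simp only [AffineMap.lineMap_apply, vsub_eq_sub, vadd_eq_add, PiLp.add_apply, PiLp.smul_apply,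
      PiLp.sub_apply, smul_eq_mul]
    field_simp
    linear_combination (-(q 0 - p 0)) * h

theorem area_lineMap (a b c d : Plane) (t : ℝ) :
    area a b (AffineMap.lineMap c d t) = area a b c + t * (area a b d - area a b c) := by
  simp only [area, AffineMap.lineMap_apply, vsub_eq_sub, vadd_eq_add, PiLp.add_apply,
    PiLp.smul_apply, PiLp.sub_apply, smul_eq_mul]
  ring

theorem collinear_of_area_eq_zero {p q r : Plane} (hpq : p ≠ q) (h : area p q r = 0) :
    Collinear ℝ {p, q, r} := by
  obtain ⟨t, rfl⟩ := exists_eq_of_area_eq_zero hpq h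
  exact (collinear_insert_of_mem_affineSpan_pair (AffineMap.lineMap_mem_affineSpan_pair t p q)).subset
    (by
      intro x
      simp only [mem_insert_iff, mem_singleton_iff]
      tauto)

theorem continuous_area (a b : Plane) : Continuous (area a b) := by
  unfold area
  fun_prop

/-- The straight line through `p` and `q`, if they are distinct. -/
def straightLine (p q : Plane) : Set Plane := {x | area p q x = 0}

theorem parametrizes_straightLine {p q : Plane} (hpq : p ≠ q) :
    Parametrizes (fun t : ℝ => AffineMap.lineMap p q t) (straightLine p q) := by
  refine ⟨AffineMap.lineMap_continuous, AffineMap.lineMap_injective ℝ hpq, ?_, ?_⟩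
  · rw [← Metric.cobounded_eq_cocompact, ← Metric.cobounded_eq_cocompact]
    have hd : 0 < dist p q := dist_pos.2 hpq
    refine (AntilipschitzWith.of_le_mul_dist (K := ⟨(dist p q)⁻¹, by positivity⟩) ?_).tendsto_cobounded
    intro s t
    rw [dist_lineMap_lineMap]
    change dist s t ≤ (dist p q)⁻¹ * (dist s t * dist p q)
    field_simp
    exact le_rfl
  · ext x
    constructor
    · rintro ⟨t, rfl⟩
      change area p q _ = 0
      rw [area_lineMap]
      simp only [area]
      ring
    · exact exists_eq_of_area_eq_zero hpq

/-- Along `cd` the signed area over `ab` is affine with nonzero slope, so it has one zero and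
changes sign there. A connected set where it takes both signs meets `ab`. -/
theorem crossesOnce_straightLine {a b c d : Plane} (hcd : c ≠ d)
    (h : area a b d - area a b c ≠ 0) : CrossesOnce (straightLine a b) (straightLine c d) := by
  have hγ := parametrizes_straightLine hcd
  set t₀ := -area a b c / (area a b d - area a b c) with ht₀
  have hf : ∀ t, area a b (AffineMap.lineMap c d t) = (t - t₀) * (area a b d - area a b c) := by
    intro t
    rw [area_lineMap, ht₀]
    field_simp
    ring
  refine ⟨AffineMap.lineMap c d t₀, ?_, ?_⟩
  · ext x
    constructor
    · rintro ⟨h1, h2⟩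
      obtain ⟨t, rfl⟩ := hγ.exists_eq h2
      change area a b _ = 0 at h1
      rw [hf, mul_eq_zero, or_iff_left h, sub_eq_zero] at h1
      rw [h1]
      rfl
    · rintro rfl
      refine ⟨?_, hγ.mem t₀⟩
      change area a b _ = 0
      rw [hf]
      ring
  · intro y hy z hz hyx hzx hx heq
    obtain ⟨s, rfl⟩ := hγ.exists_eq hy
    obtain ⟨t, rfl⟩ := hγ.exists_eq hz
    rw [pseudosegment_eq_image hγ] at hx
    obtain ⟨u, hu, hut⟩ := hx
    obtain rfl : u = t₀ := hγ.2.1 hut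
    have hs : s ≠ t₀ := fun e => hyx (by rw [e])
    have ht : t ≠ t₀ := fun e => hzx (by rw [e])
    have hyc : AffineMap.lineMap c d s ∈ (straightLine a b)ᶜ := fun k => by
      change area a b _ = 0 at k
      rw [hf, mul_eq_zero, or_iff_left h, sub_eq_zero] at k
      exact hs k
    have hzc : AffineMap.lineMap c d t ∈ (straightLine a b)ᶜ := fun k => by
      change area a b _ = 0 at k
      rw [hf, mul_eq_zero, or_iff_left h, sub_eq_zero] at k
      exact ht k
    have hpc : IsPreconnected (connectedComponentIn (straightLine a b)ᶜ (AffineMap.lineMap c d s)) :=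
      isPreconnected_connectedComponentIn
    have h1 := mem_connectedComponentIn hyc
    have h2 := mem_connectedComponentIn hzc
    rw [← heq] at h2
    have hsub := hpc.image (area a b) (continuous_area a b).continuousOn
    have h0 : (0 : ℝ) ∈ area a b '' connectedComponentIn (straightLine a b)ᶜ
        (AffineMap.lineMap c d s) := by
      have k₁ := mem_image_of_mem (area a b) h1
      have k₂ := mem_image_of_mem (area a b) h2
      rw [mem_uIcc] at hu
      have hmem : (0 : ℝ) ∈ uIcc (area a b (AffineMap.lineMap c d s))
          (area a b (AffineMap.lineMap c d t)) := by
        rw [hf, hf, mem_uIcc]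
        rcases lt_or_gt_of_ne h with h | h <;> rcases hu with hu | hu
        · right; constructor <;> nlinarith
        · left; constructor <;> nlinarith
        · left; constructor <;> nlinarith
        · right; constructor <;> nlinarith
      exact hsub.ordConnected.uIcc_subset k₁ k₂ hmem
    obtain ⟨w, hw, hw0⟩ := h0
    exact connectedComponentIn_subset _ _ hw hw0

/-- A set of points in general position with no two parallel connecting lines, as a
pseudo-configuration. -/
noncomputable def straightConfiguration (P : Finset Plane)
    (hP : ∀ p ∈ P, ∀ q ∈ P, ∀ r ∈ P, p ≠ q → p ≠ r → q ≠ r → area p q r ≠ 0)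
    (hP' : ∀ a ∈ P, ∀ b ∈ P, ∀ c ∈ P, ∀ d ∈ P, a ≠ b → a ≠ c → a ≠ d → b ≠ c → b ≠ d → c ≠ d →
      area a b d - area a b c ≠ 0) : PseudoConfiguration where
  points := P
  line := straightLine
  line_comm p _ q _ _ := by
    ext x
    simp only [straightLine, mem_ofPred_eq, area]
    constructor <;> intro h <;> linarith
  line_inter p hp q hq hpq := by
    ext x
    simp only [straightLine, mem_inter_iff, mem_ofPred_eq, Finset.mem_coe, mem_insert_iff,
      mem_singleton_iff]
    constructor
    · rintro ⟨h1, h2⟩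
      by_contra! h
      exact hP p hp q hq x h2 hpq h.1.symm h.2.symm h1
    · rintro (rfl | rfl)
      · exact ⟨by simp only [area]; ring, hp⟩
      · exact ⟨by simp only [area]; ring, hq⟩
  arrangement := by
    constructor
    · rintro _ ⟨p, -, q, -, hpq, rfl⟩
      exact ⟨_, parametrizes_straightLine hpq⟩
    · rintro _ ⟨a, ha, b, hb, hab, rfl⟩ _ ⟨c, hc, d, hd, hcd, rfl⟩ hne
      have h0 : area a b a = 0 := by simp only [area]; ring
      have h0' : area a b b = 0 := by simp only [area]; ring
      apply crossesOnce_straightLine hcd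
      by_cases hac : a = c
      · subst hac
        rw [h0, sub_zero]
        refine hP a ha b hb d hd hab hcd ?_
        rintro rfl
        exact hne rfl
      by_cases had : a = d
      · subst had
        rw [h0, zero_sub, neg_ne_zero]
        refine hP a ha b hb c hc hab hac ?_
        rintro rfl
        apply hne
        ext x
        simp only [straightLine, mem_ofPred_eq, area]
        constructor <;> intro h <;> linarith
      by_cases hbc : b = c
      · subst hbc
        rw [h0', sub_zero]
        exact hP a ha b hb d hd hab had hcd
      by_cases hbd : b = d
      · subst hbd
        rw [h0', zero_sub, neg_ne_zero]
        exact hP a ha b hb c hc hab hac hbc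
      exact hP' a ha b hb c hc d hd hab hac had hbc hbd hcd

theorem segment_subset_pseudosegment {a b : Plane} (hab : a ≠ b) :
    segment ℝ a b ⊆ pseudosegment (straightLine a b) a b := by
  intro x hx
  rw [segment_eq_image_lineMap] at hx
  obtain ⟨t, ht, rfl⟩ := hx
  exact ⟨_, parametrizes_straightLine hab, 0, 1, t, by simp, by simp,
    Icc_subset_uIcc ht, rfl⟩

/-- The quotients of signed areas are the barycentric coordinates of `x` in the triangle `abc`. -/
theorem mem_segment_of_area {a b c x : Plane} (h : area a b c ≠ 0) (hx : area b c x = 0)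
    (h₁ : 0 ≤ area c a x * area a b c) (h₂ : 0 ≤ area a b x * area a b c) : x ∈ segment ℝ b c := by
  have hs : area c a x + area a b x = area a b c := by
    simp only [area] at *
    linarith
  have hsq : 0 < area a b c ^ 2 := by positivity
  refine ⟨area c a x / area a b c, area a b x / area a b c, ?_, ?_, ?_, ?_⟩
  · have : area c a x / area a b c = area c a x * area a b c / area a b c ^ 2 := by field_simp
    rw [this]
    positivity
  · have : area a b x / area a b c = area a b x * area a b c / area a b c ^ 2 := by field_simp
    rw [this]
    positivity
  · rw [← add_div, hs, div_self h]
  · apply plane_ext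
    · simp only [PiLp.add_apply, PiLp.smul_apply, smul_eq_mul]
      field_simp
      have e : area c a x * b 0 + area a b x * c 0 + area b c x * a 0 = area a b c * x 0 := by
        simp only [area]; ring
      rw [hx] at e
      linarith
    · simp only [PiLp.add_apply, PiLp.smul_apply, smul_eq_mul]
      field_simp
      have e : area c a x * b 1 + area a b x * c 1 + area b c x * a 1 = area a b c * x 1 := by
        simp only [area]; ring
      rw [hx] at e
      linarith

theorem convex_setOf_area (a b : Plane) (D : ℝ) : Convex ℝ {x | 0 ≤ area a b x * D} := by
  intro x hx y hy s t hs ht hst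
  simp only [mem_ofPred_eq] at hx hy ⊢
  have e : area a b (s • x + t • y) * D = s * (area a b x * D) + t * (area a b y * D) := by
    simp only [area, PiLp.add_apply, PiLp.smul_apply, smul_eq_mul]
    linear_combination (D * ((b 0 - a 0) * a 1 - (b 1 - a 1) * a 0)) * hst
  rw [e]
  positivity

/-- A bounded component of the complement of a triangle. -/
theorem isBounded_connectedComponentIn_of_triangle {K : Set Plane} {a b c p : Plane}
    (h : area a b c ≠ 0) (hab : segment ℝ a b ⊆ K) (hbc : segment ℝ b c ⊆ K)
    (hca : segment ℝ c a ⊆ K) (hp : p ∈ convexHull ℝ {a, b, c}) (hpK : p ∉ K) :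
    Bornology.IsBounded (connectedComponentIn Kᶜ p) := by
  set D := area a b c with hD
  have hbca : area b c a = D := by rw [hD]; simp only [area]; ring
  have hcab : area c a b = D := by rw [hD]; simp only [area]; ring
  let F : Set Plane := {x | 0 ≤ area a b x * D} ∩ ({x | 0 ≤ area b c x * D} ∩ {x | 0 ≤ area c a x * D})
  let U : Set Plane := {x | 0 < area a b x * D} ∩ ({x | 0 < area b c x * D} ∩ {x | 0 < area c a x * D})
  have hcont : ∀ a b : Plane, Continuous fun x => area a b x * D := fun a b =>
    (continuous_area a b).mul continuous_const
  have hU : IsOpen U := (isOpen_lt continuous_const (hcont _ _)).inter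
    ((isOpen_lt continuous_const (hcont _ _)).inter (isOpen_lt continuous_const (hcont _ _)))
  have hF : IsClosed F := (isClosed_le continuous_const (hcont _ _)).inter
    ((isClosed_le continuous_const (hcont _ _)).inter (isClosed_le continuous_const (hcont _ _)))
  have hUF : U ⊆ F := by
    intro x hx
    have h1 : 0 < area a b x * D := hx.1
    have h2 : 0 < area b c x * D := hx.2.1
    have h3 : 0 < area c a x * D := hx.2.2
    exact ⟨h1.le, h2.le, h3.le⟩
  have hFU : ∀ x ∈ F, x ∉ K → x ∈ U := by
    rintro x ⟨h1, h2, h3⟩ hxK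
    have h1 : 0 ≤ area a b x * D := h1
    have h2 : 0 ≤ area b c x * D := h2
    have h3 : 0 ≤ area c a x * D := h3
    suffices k : 0 < area a b x * D ∧ 0 < area b c x * D ∧ 0 < area c a x * D from k
    refine ⟨lt_of_le_of_ne h1 fun e => hxK (hab ?_), lt_of_le_of_ne h2 fun e => hxK (hbc ?_),
      lt_of_le_of_ne h3 fun e => hxK (hca ?_)⟩
    · have e' := (mul_eq_zero.1 e.symm).resolve_right h
      exact mem_segment_of_area (hcab.symm ▸ h) e' (hcab.symm ▸ h2) (hcab.symm ▸ h3)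
    · have e' := (mul_eq_zero.1 e.symm).resolve_right h
      exact mem_segment_of_area h e' h3 h1
    · have e' := (mul_eq_zero.1 e.symm).resolve_right h
      exact mem_segment_of_area (hbca.symm ▸ h) e' (hbca.symm ▸ h1) (hbca.symm ▸ h2)
  have h0 : ∀ a b : Plane, area a b a = 0 ∧ area a b b = 0 := fun a b => by
    constructor <;> (simp only [area]; ring)
  have hDD : 0 ≤ D * D := mul_self_nonneg D
  have hpF : p ∈ F := by
    refine convexHull_min ?_ ((convex_setOf_area a b D).inter
      ((convex_setOf_area b c D).inter (convex_setOf_area c a D))) hp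
    rintro x (rfl | rfl | rfl)
    · simp [h0, hbca, hDD]
    · simp [h0, hcab, hDD]
    · simp [h0, ← hD, hDD]
  have hFb : F ⊆ convexHull ℝ {a, b, c} := by
    rintro x ⟨h1, h2, h3⟩
    have hsum : area b c x + area c a x + area a b x = D := by
      rw [hD]; simp only [area]; ring
    have hdiv : ∀ r : ℝ, 0 ≤ r * D → 0 ≤ r / D := fun r hr => by
      have : r / D = r * D / D ^ 2 := by field_simp
      rw [this]
      positivity
    have hmem : ∀ y ∈ ({a, b, c} : Set Plane), y ∈ convexHull ℝ {a, b, c} :=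
      fun y hy => subset_convexHull ℝ _ hy
    have := (convex_convexHull ℝ {a, b, c}).sum_mem (t := Finset.univ)
      (w := ![area b c x / D, area c a x / D, area a b x / D]) (z := ![a, b, c]) (by
        intro i _
        fin_cases i
        · exact hdiv _ h2
        · exact hdiv _ h3
        · exact hdiv _ h1)
      (by
        simp only [Fin.sum_univ_three, Matrix.cons_val_zero, Matrix.cons_val_one, Matrix.cons_val]
        rw [← add_div, ← add_div, hsum, div_self h])
      (by
        intro i _
        fin_cases i
        · exact hmem a (by simp)
        · exact hmem b (by simp)
        · exact hmem c (by simp))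
    convert this using 1
    simp only [Fin.sum_univ_three, Matrix.cons_val_zero, Matrix.cons_val_one, Matrix.cons_val]
    apply plane_ext
    · simp only [PiLp.add_apply, PiLp.smul_apply, smul_eq_mul]
      field_simp
      rw [hD]
      simp only [area]
      ring
    · simp only [PiLp.add_apply, PiLp.smul_apply, smul_eq_mul]
      field_simp
      rw [hD]
      simp only [area]
      ring
  have hbd : Bornology.IsBounded (convexHull ℝ ({a, b, c} : Set Plane)) :=
    isBounded_convexHull.2 (Set.toFinite _).isBounded
  -- The boundary of the triangle belongs to `K`, so the component is covered by the open triangle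
  -- and the complement of the closed one, which are disjoint open sets.
  have hsub : connectedComponentIn Kᶜ p ⊆ U := by
    refine isPreconnected_connectedComponentIn.subset_left_of_subset_union hU hF.isOpen_compl
      ?_ ?_ ?_
    · exact Set.disjoint_left.2 fun x hx hx' => hx' (hUF hx)
    · intro x hx
      by_cases hxF : x ∈ F
      · exact .inl (hFU x hxF (connectedComponentIn_subset _ _ hx))
      · exact .inr hxF
    · exact ⟨p, mem_connectedComponentIn hpK, hFU p hpF hpK⟩
  exact hbd.subset (hsub.trans (hUF.trans hFb))

/-- By Carathéodory's theorem a point of the convex hull is a point of `S`, on a segment between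
points of `S`, or in a triangle of them; in the last case the sides of the triangle enclose it. -/
theorem convexHull_subset_hull_straightConfiguration {P : Finset Plane}
    (hP : ∀ p ∈ P, ∀ q ∈ P, ∀ r ∈ P, p ≠ q → p ≠ r → q ≠ r → area p q r ≠ 0)
    (hP' : ∀ a ∈ P, ∀ b ∈ P, ∀ c ∈ P, ∀ d ∈ P, a ≠ b → a ≠ c → a ≠ d → b ≠ c → b ≠ d → c ≠ d →
      area a b d - area a b c ≠ 0) {S : Set Plane} (hS : S ⊆ P) :
    convexHull ℝ S ⊆ (straightConfiguration P hP hP').hull S := by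
  intro p hp
  set K := (straightConfiguration P hP hP').skeleton S with hK
  have hseg : ∀ a ∈ S, ∀ b ∈ S, segment ℝ a b ⊆ K := by
    intro a ha b hb x hx
    by_cases hab : a = b
    · subst hab
      rw [segment_same] at hx
      obtain rfl : x = a := hx
      exact .inl ha
    · exact .inr ⟨a, ha, b, hb, hab, segment_subset_pseudosegment hab hx⟩
  rintro ⟨hpK, hunb⟩
  apply hunb
  rw [convexHull_eq_union] at hp
  simp only [mem_iUnion] at hp
  obtain ⟨t, htS, hai, hpt⟩ := hp
  have hcard : t.card ≤ 3 := by
    have h1 := hai.card_le_finrank_succ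
    have h2 := (vectorSpan ℝ (Set.range ((↑) : t → Plane))).finrank_le
    rw [Fintype.card_coe] at h1
    rw [finrank_euclideanSpace_fin] at h2
    omega
  interval_cases hc : t.card
  · rw [Finset.card_eq_zero] at hc
    subst hc
    simp at hpt
  · obtain ⟨a, rfl⟩ := Finset.card_eq_one.1 hc
    rw [Finset.coe_singleton, convexHull_singleton] at hpt
    obtain rfl : p = a := hpt
    exact absurd (.inl (htS (by simp))) hpK
  · obtain ⟨a, b, hab, rfl⟩ := Finset.card_eq_two.1 hc
    rw [Finset.coe_pair, convexHull_pair] at hpt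
    exact absurd (hseg a (htS (by simp)) b (htS (by simp)) hpt) hpK
  · obtain ⟨a, b, c, hab, hac, hbc, rfl⟩ := Finset.card_eq_three.1 hc
    have ha : a ∈ S := htS (by simp)
    have hb : b ∈ S := htS (by simp)
    have hc : c ∈ S := htS (by simp)
    refine isBounded_connectedComponentIn_of_triangle
      (hP a (hS ha) b (hS hb) c (hS hc) hab hac hbc) (hseg a ha b hb) (hseg b hb c hc)
      (hseg c hc a ha) ?_ hpK
    simpa using hpt

/-! ### Removing parallel lines by a projective map -/

/-- The denominator of the projective map `projectiveMap ε`. -/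
def projectiveDenom (ε : ℝ) (p : Plane) : ℝ := 1 + ε * p 0 + ε ^ 2 * p 1

/-- A projective map of the plane, close to the identity for small `ε`. -/
noncomputable def projectiveMap (ε : ℝ) (p : Plane) : Plane :=
  !₂[p 0 / projectiveDenom ε p, p 1 / projectiveDenom ε p]

theorem projectiveMap_zero (ε : ℝ) (p : Plane) :
    projectiveMap ε p 0 = p 0 / projectiveDenom ε p := by
  simp [projectiveMap]

theorem projectiveMap_one (ε : ℝ) (p : Plane) :
    projectiveMap ε p 1 = p 1 / projectiveDenom ε p := by
  simp [projectiveMap]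

theorem projectiveDenom_combo (ε : ℝ) (x y : Plane) {s t : ℝ} (hst : s + t = 1) :
    projectiveDenom ε (s • x + t • y) = s * projectiveDenom ε x + t * projectiveDenom ε y := by
  simp only [projectiveDenom, PiLp.add_apply, PiLp.smul_apply, smul_eq_mul]
  linear_combination -hst

/-- The area is a determinant with rows `(1, x, y)`; adding multiples of the other columns to the
column of ones turns it into the column of denominators without changing the value. -/
theorem area_projectiveMap {ε : ℝ} {a b c : Plane} (ha : projectiveDenom ε a ≠ 0)
    (hb : projectiveDenom ε b ≠ 0) (hc : projectiveDenom ε c ≠ 0) :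
    area (projectiveMap ε a) (projectiveMap ε b) (projectiveMap ε c) *
      (projectiveDenom ε a * projectiveDenom ε b * projectiveDenom ε c) = area a b c := by
  have key : area a b c = a 0 * b 1 * projectiveDenom ε c + b 0 * c 1 * projectiveDenom ε a +
      c 0 * a 1 * projectiveDenom ε b - a 0 * c 1 * projectiveDenom ε b -
      b 0 * a 1 * projectiveDenom ε c - c 0 * b 1 * projectiveDenom ε a := by
    simp only [area, projectiveDenom]
    ring
  rw [key]
  simp only [area, projectiveMap_zero, projectiveMap_one]
  field_simp
  ring

theorem projectiveMap_combo {ε : ℝ} {x y : Plane} {s t : ℝ} (hx : projectiveDenom ε x ≠ 0)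
    (hy : projectiveDenom ε y ≠ 0)
    (hxy : projectiveDenom ε (s • x + t • y) ≠ 0) :
    projectiveMap ε (s • x + t • y) =
      (s * projectiveDenom ε x / projectiveDenom ε (s • x + t • y)) • projectiveMap ε x +
        (t * projectiveDenom ε y / projectiveDenom ε (s • x + t • y)) • projectiveMap ε y := by
  apply plane_ext
  · simp only [PiLp.add_apply, PiLp.smul_apply, smul_eq_mul, projectiveMap_zero]
    field_simp
  · simp only [PiLp.add_apply, PiLp.smul_apply, smul_eq_mul, projectiveMap_one]
    field_simp

theorem projectiveMap_injOn {ε : ℝ} {x y : Plane} (hx : projectiveDenom ε x ≠ 0)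
    (hy : projectiveDenom ε y ≠ 0) (h : projectiveMap ε x = projectiveMap ε y) : x = y := by
  have h0 := congrArg (fun p : Plane => p 0) h
  have h1 := congrArg (fun p : Plane => p 1) h
  simp only [projectiveMap_zero, projectiveMap_one] at h0 h1
  rw [div_eq_div_iff hx hy] at h0 h1
  have hd : projectiveDenom ε x = projectiveDenom ε y := by
    simp only [projectiveDenom] at h0 h1 ⊢
    linear_combination ε * h0 + ε ^ 2 * h1
  rw [hd] at h0 h1
  exact plane_ext (mul_right_cancel₀ hy h0) (mul_right_cancel₀ hy h1)

/-- Where the denominators are positive, the map takes convex combinations to convex combinations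
with new weights. -/
theorem projectiveMap_mem_convexHull {ε : ℝ} {S : Set Plane}
    (hS : ∀ x ∈ S, 0 < projectiveDenom ε x) {p : Plane} (hp : p ∈ convexHull ℝ S) :
    projectiveMap ε p ∈ convexHull ℝ (projectiveMap ε '' S) := by
  have hconv : Convex ℝ {x | 0 < projectiveDenom ε x ∧
      projectiveMap ε x ∈ convexHull ℝ (projectiveMap ε '' S)} := by
    rintro x ⟨hx, hx'⟩ y ⟨hy, hy'⟩ s t hs ht hst
    have hd := projectiveDenom_combo ε x y hst
    have hpos : 0 < projectiveDenom ε (s • x + t • y) := by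
      rw [hd]
      rcases hs.eq_or_lt with rfl | hs
      · obtain rfl : t = 1 := by linarith
        simpa using hy
      · have := mul_pos hs hx
        have := mul_nonneg ht hy.le
        linarith
    refine ⟨hpos, ?_⟩
    rw [projectiveMap_combo hx.ne' hy.ne' hpos.ne']
    refine convex_convexHull ℝ _ hx' hy' (by positivity) (by positivity) ?_
    rw [← add_div, ← hd, div_self hpos.ne']
  exact (convexHull_min (fun x hx => (⟨hS x hx, subset_convexHull ℝ _ (mem_image_of_mem _ hx)⟩ :
    0 < projectiveDenom ε x ∧ _)) hconv hp).2

theorem eventually_quadratic_ne_zero {u v w : ℝ} (h : u ≠ 0 ∨ v ≠ 0 ∨ w ≠ 0) :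
    ∀ᶠ ε in 𝓝[>] (0 : ℝ), u + v * ε + w * ε ^ 2 ≠ 0 := by
  have key : ∀ x y z : ℝ, x ≠ 0 → ∀ᶠ ε in 𝓝[>] (0 : ℝ), x + y * ε + z * ε ^ 2 ≠ 0 := by
    intro x y z hx
    apply eventually_nhdsWithin_of_eventually_nhds
    have hc : ContinuousAt (fun ε : ℝ => x + y * ε + z * ε ^ 2) 0 := by fun_prop
    exact hc.eventually_ne (by simpa using hx)
  by_cases hu : u = 0
  · subst hu
    by_cases hv : v = 0
    · subst hv
      filter_upwards [self_mem_nhdsWithin] with ε hε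
      have hw : w ≠ 0 := by simpa using h
      have hε : (0 : ℝ) < ε := hε
      simp [hw, hε.ne']
    · filter_upwards [self_mem_nhdsWithin, key v w 0 hv] with ε hε hk
      have hε : (0 : ℝ) < ε := hε
      intro h0
      refine hk ((mul_eq_zero.1 (?_ : ε * _ = 0)).resolve_left hε.ne')
      linear_combination h0
  · exact key u v w hu

/-- As a polynomial in `ε`, the difference has the coefficients `A - B`, `A * c 0 - B * d 0` and `A
* c 1 - B * d 1`. If all vanish, then `A = B ≠ 0` and `c = d`. The weights `ε` and `ε ^ 2` in the
denominator keep the three coefficients apart. -/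
theorem eventually_area_projectiveMap_sub_ne_zero {A B : ℝ} {c d : Plane} (hA : A ≠ 0)
    (hcd : c ≠ d) :
    ∀ᶠ ε in 𝓝[>] (0 : ℝ), A * projectiveDenom ε c - B * projectiveDenom ε d ≠ 0 := by
  have h : A - B ≠ 0 ∨ A * c 0 - B * d 0 ≠ 0 ∨ A * c 1 - B * d 1 ≠ 0 := by
    by_contra! h
    obtain ⟨h0, h1, h2⟩ := h
    obtain rfl : A = B := sub_eq_zero.1 h0
    exact hcd (plane_ext (mul_left_cancel₀ hA (sub_eq_zero.1 h1))
      (mul_left_cancel₀ hA (sub_eq_zero.1 h2)))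
  filter_upwards [eventually_quadratic_ne_zero h] with ε hε h0
  apply hε
  rw [← h0]
  simp only [projectiveDenom]
  ring

theorem eventually_projectiveDenom_pos (p : Plane) :
    ∀ᶠ ε in 𝓝[>] (0 : ℝ), 0 < projectiveDenom ε p := by
  apply eventually_nhdsWithin_of_eventually_nhds
  have hc : ContinuousAt (fun ε : ℝ => projectiveDenom ε p) 0 := by
    unfold projectiveDenom
    fun_prop
  exact hc.eventually (lt_mem_nhds (by simp [projectiveDenom]))

/-- A projective map takes a finite set in general position to one without parallel connecting
lines. -/
theorem exists_projectiveMap_good {P : Finset Plane}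
    (hP : ∀ p ∈ P, ∀ q ∈ P, ∀ r ∈ P, p ≠ q → p ≠ r → q ≠ r → area p q r ≠ 0) :
    ∃ ε : ℝ, (∀ p ∈ P, 0 < projectiveDenom ε p) ∧
      ∀ a ∈ P, ∀ b ∈ P, ∀ c ∈ P, ∀ d ∈ P, a ≠ b → a ≠ c → a ≠ d → b ≠ c → b ≠ d → c ≠ d →
        area (projectiveMap ε a) (projectiveMap ε b) (projectiveMap ε d) -
          area (projectiveMap ε a) (projectiveMap ε b) (projectiveMap ε c) ≠ 0 := by
  have h1 : ∀ᶠ ε in 𝓝[>] (0 : ℝ), ∀ p ∈ P, 0 < projectiveDenom ε p :=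
    (Finset.eventually_all P).2 fun p _ => eventually_projectiveDenom_pos p
  have h2 : ∀ᶠ ε in 𝓝[>] (0 : ℝ), ∀ a ∈ P, ∀ b ∈ P, ∀ c ∈ P, ∀ d ∈ P,
      a ≠ b → a ≠ d → b ≠ d → c ≠ d →
        area a b d * projectiveDenom ε c - area a b c * projectiveDenom ε d ≠ 0 := by
    refine (Finset.eventually_all P).2 fun a ha => (Finset.eventually_all P).2 fun b hb =>
      (Finset.eventually_all P).2 fun c _ => (Finset.eventually_all P).2 fun d hd => ?_
    simp only [eventually_imp_distrib_left]
    intro hab had hbd hcd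
    exact eventually_area_projectiveMap_sub_ne_zero (hP a ha b hb d hd hab had hbd) hcd
  obtain ⟨ε, hpos, hne⟩ := (h1.and h2).exists
  refine ⟨ε, hpos, fun a ha b hb c hc d hd hab _ had _ hbd hcd h0 => ?_⟩
  apply hne a ha b hb c hc d hd hab had hbd hcd
  have ga := (hpos a ha).ne'
  have gb := (hpos b hb).ne'
  have gc := (hpos c hc).ne'
  have gd := (hpos d hd).ne'
  rw [← area_projectiveMap ga gb gd, ← area_projectiveMap ga gb gc]
  linear_combination (projectiveDenom ε a * projectiveDenom ε b * projectiveDenom ε c *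
    projectiveDenom ε d) * h0

/-! ### Comparison with the classical problem and conclusion -/

/-- A point in the ordinary hull of others is mapped into the ordinary hull of their images, and
hence into the hull formed in the straight configuration. So convex position there pulls back to
ordinary convex position. -/
theorem ClassicalESProperty.of_pseudo {n N : ℕ} (h : PseudoESProperty n N) :
    ClassicalESProperty n N := by
  classical
  intro P hgp hN
  have hP : ∀ p ∈ P, ∀ q ∈ P, ∀ r ∈ P, p ≠ q → p ≠ r → q ≠ r → area p q r ≠ 0 :=
    fun p hp q hq r hr hpq hpr hqr h0 =>
      hgp p hp q hq r hr hpq hpr hqr (collinear_of_area_eq_zero hpq h0)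
  obtain ⟨ε, hpos, hne⟩ := exists_projectiveMap_good hP
  have hinj : ∀ x ∈ P, ∀ y ∈ P, projectiveMap ε x = projectiveMap ε y → x = y :=
    fun x hx y hy => projectiveMap_injOn (hpos x hx).ne' (hpos y hy).ne'
  have hA : ∀ p ∈ P.image (projectiveMap ε), ∀ q ∈ P.image (projectiveMap ε),
      ∀ r ∈ P.image (projectiveMap ε), p ≠ q → p ≠ r → q ≠ r → area p q r ≠ 0 := by
    simp only [Finset.forall_mem_image]
    intro p hp q hq r hr hpq hpr hqr h0
    refine hP p hp q hq r hr (ne_of_apply_ne _ hpq) (ne_of_apply_ne _ hpr)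
      (ne_of_apply_ne _ hqr) ?_
    rw [← area_projectiveMap (hpos p hp).ne' (hpos q hq).ne' (hpos r hr).ne', h0, zero_mul]
  have hB : ∀ a ∈ P.image (projectiveMap ε), ∀ b ∈ P.image (projectiveMap ε),
      ∀ c ∈ P.image (projectiveMap ε), ∀ d ∈ P.image (projectiveMap ε),
      a ≠ b → a ≠ c → a ≠ d → b ≠ c → b ≠ d → c ≠ d → area a b d - area a b c ≠ 0 := by
    simp only [Finset.forall_mem_image]
    intro a ha b hb c hc d hd h1 h2 h3 h4 h5 h6
    exact hne a ha b hb c hc d hd (ne_of_apply_ne _ h1) (ne_of_apply_ne _ h2)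
      (ne_of_apply_ne _ h3) (ne_of_apply_ne _ h4) (ne_of_apply_ne _ h5) (ne_of_apply_ne _ h6)
  obtain ⟨Q', hcard, hsub, hQ'⟩ := h (straightConfiguration _ hA hB)
    (by
      change N ≤ (P.image (projectiveMap ε)).card
      rwa [Finset.card_image_of_injOn fun x hx y hy => hinj x hx y hy])
  change Q' ⊆ P.image (projectiveMap ε) at hsub
  obtain ⟨Q, hQP, rfl⟩ := Finset.subset_image_iff.1 hsub
  refine ⟨Q, hQP, ?_, fun p hp hpc => ?_⟩
  · rw [← hcard, Finset.card_image_of_injOn fun x hx y hy => hinj x (hQP hx) y (hQP hy)]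
  · refine hQ' _ (Finset.mem_image_of_mem _ hp) ?_
    refine convexHull_subset_hull_straightConfiguration hA hB ?_ ?_
    · exact sdiff_subset.trans (Finset.coe_subset.2 hsub)
    · refine convexHull_mono ?_ (projectiveMap_mem_convexHull
        (fun x hx => hpos x (hQP hx.1)) hpc)
      rintro _ ⟨x, hx, rfl⟩
      refine ⟨Finset.mem_coe.2 (Finset.mem_image_of_mem _ hx.1), fun e => hx.2 ?_⟩
      exact hinj x (hQP hx.1) p (hQP hp) e

theorem theorem3 :
    ∃ b e : ℕ → ℕ,
      (∀ n : ℕ, 3 ≤ n → IsLeast {N : ℕ | PseudoESProperty n N} (b n)) ∧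
      (∀ n : ℕ, 3 ≤ n → IsLeast {N : ℕ | ClassicalESProperty n N} (e n)) ∧
      (∃ C : ℝ, ∀ n : ℕ, 3 ≤ n →
        (b n : ℝ) ≤ (2 : ℝ) ^ ((n : ℝ) + C * Real.sqrt ((n : ℝ) * Real.log (n : ℝ)))) ∧
      (∀ n : ℕ, 3 ≤ n → e n ≤ b n) := by
  have hb : ∀ n : ℕ, 3 ≤ n → IsLeast {N : ℕ | PseudoESProperty n N}
      (sInf {N : ℕ | PseudoESProperty n N}) := fun n hn =>
    ⟨Nat.sInf_mem ⟨_, pseudoESProperty_floor hn⟩, fun _ hN => Nat.sInf_le hN⟩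
  have he : ∀ n : ℕ, 3 ≤ n → IsLeast {N : ℕ | ClassicalESProperty n N}
      (sInf {N : ℕ | ClassicalESProperty n N}) := fun n hn =>
    ⟨Nat.sInf_mem ⟨_, .of_pseudo (pseudoESProperty_floor hn)⟩, fun _ hN => Nat.sInf_le hN⟩
  refine ⟨_, _, hb, he, ⟨100, fun n hn => ?_⟩, fun n hn => (he n hn).2 (.of_pseudo (hb n hn).1)⟩
  exact (Nat.cast_le.2 ((hb n hn).2 (pseudoESProperty_floor hn))).trans
    (Nat.floor_le (by positivity))
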